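/- Let $a,\rho_s,\mu,\kappa>0$ and $\gamma\ge 1$ be real, and let $\mathcal O_1,\mathcal O_2,\mathcal O_3\subseteq(0,\pi)$ be open. Consider, for $T>0$ and controls $f_i\in L^2(0,T;L^2(\mathcal O_i))$, the linearized compressible Navier–Stokes system with Maxwell's law $$\begin{cases}\partial_t\rho+\rho_s\,\partial_xu=\mathbf 1_{\mathcal O_1}f_1,\\ \partial_tu+a\gamma\rho_s^{\gamma-2}\,\partial_x\rho-\frac1{\rho_s}\partial_xS=\mathbf 1_{\mathcal O_2}f_2,\\ \partial_tS+\frac1\kappa S-\frac\mu\kappa\,\partial_xu=\mathbf 1_{\mathcal O_3}f_3\end{cases}\qquad\text{in }(0,T)\times(0,\pi),$$ with $u(t,0)=u(t,\pi)=0$ and $(\rho,u,S)(0)=(\rho_0,u_0,S_0)$. All functions are complex-valued, and solutions are weak solutions in $C([0,T];(L^2(0,\pi))^3)$: for all $t\in[0,T]$ the equations hold, integrated over $(0,t)$, when tested against $\varphi\in C^\infty([0,\pi])$ with all $x$-derivatives moved onto $\varphi$ and no boundary terms, where $\varphi$ is arbitrary in the first and third equations and $\varphi(0)=\varphi(\pi)=0$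 in the second. Write $L^2_m(0,\pi)=\{g\in L^2(0,\pi):\int_0^\pi g\,dx=0\}$. For a subspace $X\subseteq(L^2(0,\pi))^3$, the system is called approximately controllable in $X$ at time $T$ by controls of a given class if for all $z_0,z_T\in X$ and all $\epsilon>0$ there are controls of that class such that the corresponding solution $z=(\rho,u,S)$ with $z(0)=z_0$ exists, stays in $X$ on $[0,T]$, and satisfies $\|z(T)-z_T\|_{(L^2(0,\pi))^3}<\epsilon$. Put $$T_*=\frac{4\pi}{\sqrt{a\gamma\rho_s^{\gamma-1}+\frac{\mu}{\kappa\rho_s}}}.$$ Then: 1. (Density control.) With $f_2=f_3=0$ and controls $f_1\in L^2(0,T;L^2(\mathcal O_1))$, the system is approximately controllable in $L^2(0,\pi)\times L^2(0,\pi)\times L^2_m(0,\pi)$ at every time $T>T_*$ if $\mathcal O_1\neq\emptyset$, and at every time $T>0$ if $\mathcal O_1=(0,\pi)$. 2. (Velocity control.) With $f_1=f_3=0$ and controls $f_2\in L^2(0,T;L^2(\mathcal O_2))$, the system is approximately controllable in $L^2_m(0,\pi)\times L^2(0,\pi)\times L^2_m(0,\pi)$ at every time $T>T_*$ if $\mathcal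 O_2\neq\emptyset$, and at every time $T>0$ if $\mathcal O_2=(0,\pi)$. 3. (Stress control.) With $f_1=f_2=0$ and controls $f_3\in L^2(0,T;L^2(\mathcal O_3))$, the system is approximately controllable in $L^2_m(0,\pi)\times L^2(0,\pi)\times L^2(0,\pi)$ at every time $T>T_*$ if $\mathcal O_3\neq\emptyset$, and at every time $T>0$ if $\mathcal O_3=(0,\pi)$. -/

import Mathlib

open Set MeasureTheory
open scoped ContDiff

noncomputable section

namespace MaxwellNS

/-- The physical constants: pressure law `p(ρ) = a ρ ^ γ`, constant density `ρs` of the steady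
state `(ρs, 0, 0)`, viscosity `μ`, relaxation time `κ`. -/
structure Params where
  a : ℝ
  γ : ℝ
  ρs : ℝ
  μ : ℝ
  κ : ℝ
  a_pos : 0 < a
  one_le_γ : 1 ≤ γ
  ρs_pos : 0 < ρs
  μ_pos : 0 < μ
  κ_pos : 0 < κ

/-- The coefficient `b = a γ ρs ^ (γ - 2)`. -/
def Params.b (p : Params) : ℝ := p.a * p.γ * p.ρs ^ (p.γ - 2)

/-- The critical time `4π / √(a γ ρs ^ (γ - 1) + μ / (κ ρs))`. -/
def Params.criticalTime (p : Params) : ℝ :=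
  4 * Real.pi / √(p.a * p.γ * p.ρs ^ (p.γ - 1) + p.μ / (p.κ * p.ρs))

/-- The space `L²(O)` of complex-valued square-integrable functions on `O ⊆ ℝ`. -/
abbrev L2On (O : Set ℝ) : Type := Lp ℂ 2 (volume.restrict O)

/-- The interval `(0, π)`. -/
abbrev I : Set ℝ := Ioo 0 Real.pi

/-- The state space `L²(0,π) × L²(0,π) × L²(0,π)`; a state is a triple `(ρ, u, S)`
(density, velocity, stress). -/
abbrev State : Type := L2On I × L2On I × L2On I

/-- The Hilbert norm of `(L²(0,π))³`. -/
def l2Norm (z : State) : ℝ := √(‖z.1‖ ^ 2 + ‖z.2.1‖ ^ 2 + ‖z.2.2‖ ^ 2)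

/-- The space `L²_m(0,π)` of square-integrable functions with zero mean. -/
def L2m : Set (L2On I) := {g | ∫ x in I, g x = 0}

/-- A triple of controls, `fᵢ(t) ∈ L²(Oᵢ)`. -/
structure Control (O₁ O₂ O₃ : Set ℝ) where
  f₁ : ℝ → L2On O₁
  f₂ : ℝ → L2On O₂
  f₃ : ℝ → L2On O₃

/-- `fᵢ ∈ L²(0,T; L²(Oᵢ))` for `i = 1, 2, 3`. -/
def Control.SquareIntegrable {O₁ O₂ O₃ : Set ℝ} (F : Control O₁ O₂ O₃) (T : ℝ) : Prop :=
  MemLp F.f₁ 2 (volume.restrict (Ioo 0 T)) ∧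
  MemLp F.f₂ 2 (volume.restrict (Ioo 0 T)) ∧
  MemLp F.f₃ 2 (volume.restrict (Ioo 0 T))

/-- `z = (ρ, u, S) ∈ C([0,T]; (L²(0,π))³)` is the (weak) solution of

* `∂ₜρ + ρs ∂ₓu = 1_{O₁} f₁`,
* `∂ₜu + b ∂ₓρ - (1/ρs) ∂ₓS = 1_{O₂} f₂`,
* `∂ₜS + (1/κ) S - (μ/κ) ∂ₓu = 1_{O₃} f₃`

in `(0,T) × (0,π)`, with `z(0) = z₀` and `u(t,0) = u(t,π) = 0`.

Each equation is multiplied by a smooth function `φ` on `[0,π]`, integrated by parts in `x`, and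
integrated in time. The boundary condition on `u` is expressed by the fact that the test functions
of the first and third equations, where `∂ₓu` occurs, are arbitrary at `0` and `π`; those of the
second equation vanish there, as no boundary values of `ρ` and `S` are prescribed. -/
structure IsSolution (p : Params) (T : ℝ) {O₁ O₂ O₃ : Set ℝ} (F : Control O₁ O₂ O₃)
    (z₀ : State) (z : ℝ → State) : Prop where
  continuousOn : ContinuousOn z (Icc 0 T)
  initial : z 0 = z₀
  density : ∀ φ : ℝ → ℂ, ContDiff ℝ ∞ φ → ∀ t ∈ Icc 0 T,
    ∫ x in I, (z t).1 x * φ x =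
      (∫ x in I, z₀.1 x * φ x) +
      ∫ s in (0 : ℝ)..t,
        ((p.ρs : ℂ) * (∫ x in I, (z s).2.1 x * deriv φ x) + ∫ x in O₁, F.f₁ s x * φ x)
  velocity : ∀ φ : ℝ → ℂ, ContDiff ℝ ∞ φ → φ 0 = 0 → φ Real.pi = 0 → ∀ t ∈ Icc 0 T,
    ∫ x in I, (z t).2.1 x * φ x =
      (∫ x in I, z₀.2.1 x * φ x) +
      ∫ s in (0 : ℝ)..t,
        ((p.b : ℂ) * (∫ x in I, (z s).1 x * deriv φ x)
          - (1 / p.ρs : ℂ) * (∫ x in I, (z s).2.2 x * deriv φ x)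
          + ∫ x in O₂, F.f₂ s x * φ x)
  stress : ∀ φ : ℝ → ℂ, ContDiff ℝ ∞ φ → ∀ t ∈ Icc 0 T,
    ∫ x in I, (z t).2.2 x * φ x =
      (∫ x in I, z₀.2.2 x * φ x) +
      ∫ s in (0 : ℝ)..t,
        (-(1 / p.κ : ℂ) * (∫ x in I, (z s).2.2 x * φ x)
          - (p.μ / p.κ : ℂ) * (∫ x in I, (z s).2.1 x * deriv φ x)
          + ∫ x in O₃, F.f₃ s x * φ x)

/-- Approximate controllability at time `T` in the subspace `X` of `(L²(0,π))³`, by controls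
`fᵢ ∈ L²(0,T; L²(Oᵢ))` that belong to the class `U`: every state of `X` can be steered, by a
trajectory in `X`, arbitrarily close to every other one. The corresponding solution has to exist,
and what is said about it is said about every solution. -/
def ApproxControllable (p : Params) (T : ℝ) (X : Set State) {O₁ O₂ O₃ : Set ℝ}
    (U : Set (Control O₁ O₂ O₃)) : Prop :=
  ∀ z₀ ∈ X, ∀ zT ∈ X, ∀ ε : ℝ, 0 < ε →
    ∃ F ∈ U, F.SquareIntegrable T ∧
      (∃ z : ℝ → State, IsSolution p T F z₀ z) ∧
      ∀ z : ℝ → State, IsSolution p T F z₀ z →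
        (∀ t ∈ Icc 0 T, z t ∈ X) ∧ l2Norm (z T - zT) < ε

/-- Only the density equation is controlled: `f₂ = 0` and `f₃ = 0`. -/
def densityControls (O₁ O₂ O₃ : Set ℝ) : Set (Control O₁ O₂ O₃) := {F | F.f₂ = 0 ∧ F.f₃ = 0}

/-- Only the velocity equation is controlled: `f₁ = 0` and `f₃ = 0`. -/
def velocityControls (O₁ O₂ O₃ : Set ℝ) : Set (Control O₁ O₂ O₃) := {F | F.f₁ = 0 ∧ F.f₃ = 0}

/-- Only the stress equation is controlled: `f₁ = 0` and `f₂ = 0`. -/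
def stressControls (O₁ O₂ O₃ : Set ℝ) : Set (Control O₁ O₂ O₃) := {F | F.f₁ = 0 ∧ F.f₂ = 0}

end MaxwellNS

end

noncomputable section

namespace MaxwellNS

/-! ### Pairing of square-integrable functions with continuous functions -/

/-! Expand density and stress in cosines and velocity in sines. The condition `u = 0` at the ends is
then built in, and the system splits into linear ODEs on `ℂ³`, one for each mode, with matrix `A n =
modeGen p n`. A weighted energy decreases along each of them, so the flows are bounded uniformly in
`n`, the Fourier series of the free evolution sums to a continuous weak solution, and testing
against the modes gives uniqueness.

By linearity and Hahn–Banach (`approxControllable_of_reachable`) it suffices that a functional `f`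
vanishing on all states reachable from `0` vanishes on `X`. Let `W` be the free solution issued from
a profile `w`, a function `φ` supported in the control region and placed in the controlled component
`e`. The `(k+1)`-fold time primitive of `W` starts at `0` and is driven by the forcing `(t ^ k / k!)
w`, so its value at `T` is reachable. Hence all moments of `f (W t)` on `[0, T]` vanish, and `f (W
t) = 0` there (`dual_orbit_eq_zero`). In Fourier modes this says `∑ qₙ ℓₙ (exp (t A n) e) = 0`,
where `qₙ` are the coefficients of `φ` and `ℓₙ` is `f` restricted to mode `n`.

If the control region is the whole interval, `φ` may be the `n`-th mode itself and the terms vanish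
one by one, for every `T > 0`. Otherwise they are separated by `unique_continuation`. With `c =
p.speed` and `w = p.limitRate` the characteristic polynomial is `r² (r + 1/κ) + c² n² (r + w)`; for
large `n` its roots are a pair `-(1/κ - w)/2 ± i c n + O(1/n)` and a real number `-(w + xₙ)` with
`xₙ` decreasing to `0`. Replacing `φ` by `φ'' + j² φ` preserves the support and multiplies `qₙ` by
`j² - n²`, which removes any finite set of modes and also shows that `qₙ` decays rapidly. After
multiplication by `exp (w t)` and `k` differentiations, the real exponentials contribute `O(2⁻ᵏ)`,
while the coefficients of the oscillating ones do not decrease; the Riesz-type bound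
`exists_norm_coeff_le` on one period `2π / c` forces the latter to vanish. The real exponentials are
then told apart by their moments (`eq_zero_of_moments_eq_zero`). Once the high modes are gone, each
low mode is isolated by removing the other low ones. Only `T > 2π / c`, half of the critical time,
enters.

Finally, `ℓₙ (exp (t A n) e) = 0` gives `ℓₙ e = ℓₙ (A n e) = ℓₙ (A n (A n e)) = 0`, and for `n ≠ 0`
these three vectors form a basis (Kalman's condition), so `ℓₙ = 0`. Mode `0` carries only the means
of density and stress; each of them is either zero in `X` or directly controlled. -/

theorem memLp_of_continuous {φ : ℝ → ℂ} (hφ : Continuous φ) (O : Set ℝ) (hO : MeasurableSet O)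
    (hOI : O ⊆ I) : MemLp φ 2 (volume.restrict O) := by
  have : IsFiniteMeasure (volume.restrict O) := by
    refine ⟨?_⟩
    rw [Measure.restrict_apply_univ]
    exact (measure_mono hOI).trans_lt (by simp [I])
  obtain ⟨C, hC⟩ := (isCompact_Icc (a := (0 : ℝ)) (b := Real.pi)).exists_bound_of_continuousOn
    hφ.continuousOn
  refine MemLp.of_bound hφ.aestronglyMeasurable C ?_
  filter_upwards [ae_restrict_mem hO] with x hx
  exact hC x (Ioo_subset_Icc_self (hOI hx))

/-- The class in `L²(0,π)` of a square-integrable function (and `0` for other functions). -/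
def toL2 (φ : ℝ → ℂ) : L2On I :=
  open Classical in if h : MemLp φ 2 (volume.restrict I) then h.toLp φ else 0

theorem coeFn_toL2 {φ : ℝ → ℂ} (hφ : Continuous φ) : toL2 φ =ᵐ[volume.restrict I] φ := by
  have h := memLp_of_continuous hφ I measurableSet_Ioo Subset.rfl
  rw [toL2, dif_pos h]
  exact h.coeFn_toLp

/-- The bilinear pairing `g ↦ ∫ g φ` on `L²(0,π)`. -/
def pairing (φ : ℝ → ℂ) : L2On I →L[ℂ] ℂ :=
  -- The inner product is conjugate-linear in its first slot; the conjugation makes the pairing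
  -- bilinear.
  innerSL ℂ (toL2 fun x => starRingEnd ℂ (φ x))

theorem pairing_apply {φ : ℝ → ℂ} (hφ : Continuous φ) (g : L2On I) :
    pairing φ g = ∫ x in I, g x * φ x := by
  rw [pairing, innerSL_apply_apply, L2.inner_def]
  refine integral_congr_ae ?_
  filter_upwards [coeFn_toL2 (φ := fun x => starRingEnd ℂ (φ x)) (by fun_prop)] with x hx
  simp [hx]

theorem pairing_toL2 {φ ψ : ℝ → ℂ} (hφ : Continuous φ) (hψ : Continuous ψ) :
    pairing φ (toL2 ψ) = ∫ x in I, ψ x * φ x := by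
  rw [pairing_apply hφ]
  refine integral_congr_ae ?_
  filter_upwards [coeFn_toL2 hψ] with x hx
  rw [hx]

theorem pairing_toL2' {φ ψ : ℝ → ℂ} (hφ : Continuous φ) (hψ : Continuous ψ) :
    pairing φ (toL2 ψ) = ∫ x in (0 : ℝ)..Real.pi, ψ x * φ x := by
  rw [pairing_toL2 hφ hψ, intervalIntegral.integral_of_le Real.pi_pos.le,
    integral_Ioc_eq_integral_Ioo]

/-! ### The cosine and sine modes -/

/-- The normalized cosines. -/
def cosMode (n : ℕ) (x : ℝ) : ℝ :=
  (if n = 0 then (√Real.pi)⁻¹ else √(2 / Real.pi)) * Real.cos (n * x)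

/-- The normalized sines; `sinMode 0 = 0`. -/
def sinMode (n : ℕ) (x : ℝ) : ℝ := √(2 / Real.pi) * Real.sin (n * x)

/-- The cosine modes as complex-valued functions. -/
def cosC (n : ℕ) (x : ℝ) : ℂ := cosMode n x

/-- The sine modes as complex-valued functions. -/
def sinC (n : ℕ) (x : ℝ) : ℂ := sinMode n x

theorem contDiff_cosC (n : ℕ) : ContDiff ℝ ∞ (cosC n) := by
  have h : ContDiff ℝ ∞ (cosMode n) := contDiff_const.mul (by fun_prop)
  exact Complex.ofRealCLM.contDiff.comp h

theorem contDiff_sinC (n : ℕ) : ContDiff ℝ ∞ (sinC n) := by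
  have h : ContDiff ℝ ∞ (sinMode n) := contDiff_const.mul (by fun_prop)
  exact Complex.ofRealCLM.contDiff.comp h

theorem continuous_cosC (n : ℕ) : Continuous (cosC n) := (contDiff_cosC n).continuous

theorem continuous_sinC (n : ℕ) : Continuous (sinC n) := (contDiff_sinC n).continuous

theorem sinC_zero : sinC 0 = 0 := by
  ext x; simp [sinC, sinMode]

theorem sinC_at_zero (n : ℕ) : sinC n 0 = 0 := by simp [sinC, sinMode]

theorem sinC_at_pi (n : ℕ) : sinC n Real.pi = 0 := by
  simp [sinC, sinMode, Real.sin_nat_mul_pi]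

theorem hasDerivAt_cosC (n : ℕ) (x : ℝ) : HasDerivAt (cosC n) (-(n : ℂ) * sinC n x) x := by
  have h : HasDerivAt (cosMode n) (-(n : ℝ) * sinMode n x) x := by
    unfold cosMode sinMode
    have h1 : HasDerivAt (fun x : ℝ => (n : ℝ) * x) n x := by
      simpa using (hasDerivAt_id x).const_mul (n : ℝ)
    refine ((h1.cos).const_mul (if n = 0 then (√Real.pi)⁻¹ else √(2 / Real.pi))).congr_deriv ?_
    rcases eq_or_ne n 0 with h | h
    · simp [h]
    · simp only [h, if_false]; ring
  refine h.ofReal_comp.congr_deriv ?_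
  simp [sinC]

theorem hasDerivAt_sinC (n : ℕ) (x : ℝ) : HasDerivAt (sinC n) ((n : ℂ) * cosC n x) x := by
  have h : HasDerivAt (sinMode n) ((n : ℝ) * cosMode n x) x := by
    unfold cosMode sinMode
    have h1 : HasDerivAt (fun x : ℝ => (n : ℝ) * x) n x := by
      simpa using (hasDerivAt_id x).const_mul (n : ℝ)
    refine ((h1.sin).const_mul (√(2 / Real.pi))).congr_deriv ?_
    rcases eq_or_ne n 0 with h | h
    · simp [h]
    · simp only [h, if_false]; ring
  refine h.ofReal_comp.congr_deriv ?_
  simp [cosC]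

theorem integral_cos_int_mul (k : ℤ) :
    ∫ x in (0 : ℝ)..Real.pi, Real.cos (k * x) = if k = 0 then Real.pi else 0 := by
  split_ifs with h
  · simp [h]
  · have hk : (k : ℝ) ≠ 0 := by exact_mod_cast h
    have := intervalIntegral.integral_comp_mul_left (a := 0) (b := Real.pi) Real.cos hk
    rw [this, integral_cos, Real.sin_int_mul_pi]
    simp

theorem integral_cos_mul_cos (m n : ℕ) :
    ∫ x in (0 : ℝ)..Real.pi, Real.cos (m * x) * Real.cos (n * x) =
      if m = n then (if n = 0 then Real.pi else Real.pi / 2) else 0 := by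
  have h (x : ℝ) : Real.cos (m * x) * Real.cos (n * x) =
      (Real.cos (((m - n : ℤ) : ℝ) * x) + Real.cos (((m + n : ℤ) : ℝ) * x)) / 2 := by
    push_cast
    rw [sub_mul, add_mul, Real.cos_sub, Real.cos_add]; ring
  simp_rw [h]
  rw [intervalIntegral.integral_div, intervalIntegral.integral_add
    (by apply Continuous.intervalIntegrable; fun_prop)
    (by apply Continuous.intervalIntegrable; fun_prop), integral_cos_int_mul, integral_cos_int_mul]
  rcases eq_or_ne m n with rfl | hmn
  · rcases eq_or_ne m 0 with rfl | h0
    · simp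
    · have : ¬ ((m : ℤ) + m = 0) := by omega
      simp [h0, this]
  · have h1 : ¬ ((m : ℤ) - n = 0) := by omega
    have h2 : ¬ ((m : ℤ) + n = 0) := by omega
    simp [hmn, h1, h2]

theorem integral_sin_mul_sin (m n : ℕ) (hn : n ≠ 0) :
    ∫ x in (0 : ℝ)..Real.pi, Real.sin (m * x) * Real.sin (n * x) =
      if m = n then Real.pi / 2 else 0 := by
  have h (x : ℝ) : Real.sin (m * x) * Real.sin (n * x) =
      (Real.cos (((m - n : ℤ) : ℝ) * x) - Real.cos (((m + n : ℤ) : ℝ) * x)) / 2 := by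
    push_cast
    rw [sub_mul, add_mul, Real.cos_sub, Real.cos_add]; ring
  simp_rw [h]
  rw [intervalIntegral.integral_div, intervalIntegral.integral_sub
    (by apply Continuous.intervalIntegrable; fun_prop)
    (by apply Continuous.intervalIntegrable; fun_prop), integral_cos_int_mul, integral_cos_int_mul]
  have h2 : ¬ ((m : ℤ) + n = 0) := by omega
  rcases eq_or_ne m n with rfl | hmn
  · simp [h2]
  · have h1 : ¬ ((m : ℤ) - n = 0) := by omega
    simp [hmn, h1, h2]

theorem star_cosC (n : ℕ) (x : ℝ) : starRingEnd ℂ (cosC n x) = cosC n x := Complex.conj_ofReal _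

theorem star_sinC (n : ℕ) (x : ℝ) : starRingEnd ℂ (sinC n x) = sinC n x := Complex.conj_ofReal _

/-- `∫ g cosₙ`. -/
theorem pairing_cosC (n : ℕ) (g : L2On I) : pairing (cosC n) g = inner ℂ (toL2 (cosC n)) g := by
  simp [pairing, star_cosC]

theorem pairing_sinC (n : ℕ) (g : L2On I) : pairing (sinC n) g = inner ℂ (toL2 (sinC n)) g := by
  simp [pairing, star_sinC]

theorem sq_sqrt_two_div_pi : √(2 / Real.pi) * √(2 / Real.pi) = 2 / Real.pi :=
  Real.mul_self_sqrt (by positivity)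

theorem orthonormal_cosC : Orthonormal ℂ fun n => toL2 (cosC n) := by
  rw [orthonormal_iff_ite]
  intro m n
  rw [← pairing_cosC, pairing_toL2' (continuous_cosC m) (continuous_cosC n)]
  have h (x : ℝ) : cosC n x * cosC m x =
      (((if n = 0 then (√Real.pi)⁻¹ else √(2 / Real.pi)) *
        (if m = 0 then (√Real.pi)⁻¹ else √(2 / Real.pi)) *
        (Real.cos (n * x) * Real.cos (m * x)) : ℝ) : ℂ) := by
    simp only [cosC, cosMode]; push_cast; ring
  simp_rw [h]
  rw [intervalIntegral.integral_ofReal, intervalIntegral.integral_const_mul, integral_cos_mul_cos]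
  rcases eq_or_ne m n with rfl | hmn
  · rcases eq_or_ne m 0 with rfl | h0
    · have : (√Real.pi)⁻¹ * (√Real.pi)⁻¹ * Real.pi = 1 := by
        rw [← mul_inv, Real.mul_self_sqrt Real.pi_pos.le, inv_mul_cancel₀ Real.pi_ne_zero]
      simp only [if_true, this, Complex.ofReal_one]
    · simp only [h0, if_true, if_false, sq_sqrt_two_div_pi]
      have : 2 / Real.pi * (Real.pi / 2) = 1 := by field_simp
      rw [this]; simp
  · simp [hmn, hmn.symm]

theorem orthonormal_sinC : Orthonormal ℂ fun n => toL2 (sinC (n + 1)) := by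
  rw [orthonormal_iff_ite]
  intro m n
  rw [← pairing_sinC, pairing_toL2' (continuous_sinC _) (continuous_sinC _)]
  have h (x : ℝ) : sinC (n + 1) x * sinC (m + 1) x =
      ((√(2 / Real.pi) * √(2 / Real.pi) *
        (Real.sin ((n + 1 : ℕ) * x) * Real.sin ((m + 1 : ℕ) * x)) : ℝ) : ℂ) := by
    simp only [sinC, sinMode]; push_cast; ring
  simp_rw [h]
  rw [intervalIntegral.integral_ofReal, intervalIntegral.integral_const_mul,
    integral_sin_mul_sin _ _ (by omega), sq_sqrt_two_div_pi]
  rcases eq_or_ne m n with rfl | hmn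
  · have : 2 / Real.pi * (Real.pi / 2) = 1 := by field_simp
    simp [this]
  · simp [hmn, hmn.symm]

/-! ### Completeness -/

theorem integrable_L2On (g : L2On I) : Integrable g (volume.restrict I) :=
  (Lp.memLp g).integrable (by norm_num)

theorem integrable_mul_of_continuous {g : ℝ → ℂ} (hg : Integrable g (volume.restrict I))
    {φ : ℝ → ℂ} (hφ : Continuous φ) : Integrable (fun x => g x * φ x) (volume.restrict I) := by
  obtain ⟨C, hC⟩ := (isCompact_Icc (a := (0 : ℝ)) (b := Real.pi)).exists_bound_of_continuousOn
    hφ.continuousOn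
  refine hg.mul_bdd (c := C) hφ.aestronglyMeasurable ?_
  filter_upwards [ae_restrict_mem measurableSet_Ioo] with x hx
  exact hC x (Ioo_subset_Icc_self hx)

/-- The product formula `cos x cos nx = (cos (n+1)x + cos (n-1)x) / 2` raises the degree of the
polynomial by one. The factor `cos nx` is kept in the statement so that this induction closes. -/
theorem integral_mul_polynomial_cos_eq_zero {g : ℝ → ℂ} (hg : Integrable g (volume.restrict I))
    (h : ∀ n : ℕ, ∫ x in I, g x * Complex.cos (n * x) = 0) (P : Polynomial ℝ) (n : ℕ) :
    ∫ x in I, g x * ((P.eval (Real.cos x) : ℝ) : ℂ) * Complex.cos (n * x) = 0 := by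
  induction P using Polynomial.induction_on generalizing n with
  | C a =>
    have := congrArg (fun z => z * (a : ℂ)) (h n)
    simp only [zero_mul, ← integral_mul_const] at this
    rw [← this]
    congr 1; ext x; simp; ring
  | add p q hp hq =>
    have hpq := congrArg₂ (· + ·) (hp n) (hq n)
    simp only [add_zero] at hpq
    rw [← integral_add] at hpq
    · rw [← hpq]
      congr 1; ext x; simp; ring
    all_goals
      exact integrable_mul_of_continuous (integrable_mul_of_continuous hg (by fun_prop))
        (by fun_prop)
  | monomial k a ih =>
    have key (x : ℝ) : g x * ((Polynomial.C a * Polynomial.X ^ (k + 1)).eval (Real.cos x) : ℝ) *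
        Complex.cos (n * x) =
        (g x * ((Polynomial.C a * Polynomial.X ^ k).eval (Real.cos x) : ℝ) *
          Complex.cos ((n + 1 : ℕ) * x) +
        g x * ((Polynomial.C a * Polynomial.X ^ k).eval (Real.cos x) : ℝ) *
          Complex.cos (((n : ℂ) - 1) * x)) / 2 := by
      push_cast
      rw [add_mul, sub_mul, Complex.cos_add, Complex.cos_sub]
      simp [pow_succ]; ring
    simp_rw [key]
    rw [integral_div, integral_add]
    · rw [ih (n + 1)]
      -- For `n = 0` the index `n - 1 = -1` is replaced by `1`, since cosine is even.
      have : ∀ x : ℝ, Complex.cos (((n : ℂ) - 1) * x) =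
          Complex.cos (((if n = 0 then 1 else n - 1 : ℕ) : ℂ) * x) := by
        intro x
        rcases n with _ | n
        · simp
        · simp
      simp_rw [this, ih]
      simp
    all_goals
      exact integrable_mul_of_continuous (integrable_mul_of_continuous hg (by fun_prop))
        (by fun_prop)

/-- On `(0, π)` a continuous `ψ` is a continuous function of `cos x`, namely `ψ ∘ arccos`, so
Weierstrass approximates it uniformly by polynomials in `cos x`. Hence `g` integrates to zero
against every test function. -/
theorem ae_eq_zero_of_integral_mul_cos {g : ℝ → ℂ} (hg : Integrable g (volume.restrict I))
    (h : ∀ n : ℕ, ∫ x in I, g x * Complex.cos (n * x) = 0) : g =ᵐ[volume.restrict I] 0 := by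
  have hcont : ∀ ψ : ℝ → ℝ, Continuous ψ → ∫ x in I, ψ x • g x = 0 := by
    intro ψ hψ
    set C := ∫ x in I, ‖g x‖ with hC
    have hC0 : 0 ≤ C := integral_nonneg fun _ => norm_nonneg _
    rw [← norm_eq_zero]
    refine le_antisymm (le_of_forall_pos_le_add fun ε hε => ?_) (norm_nonneg _)
    obtain ⟨P, hP⟩ := exists_polynomial_near_of_continuousOn (-1) 1 (fun y => ψ (Real.arccos y))
      (by fun_prop) (ε / (C + 1)) (by positivity)
    have h0 := integral_mul_polynomial_cos_eq_zero hg h P 0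
    simp only [Nat.cast_zero, zero_mul, Complex.cos_zero, mul_one] at h0
    have hint1 : Integrable (fun x => ψ x • g x) (volume.restrict I) := by
      have := integrable_mul_of_continuous hg (φ := fun x => (ψ x : ℂ)) (by fun_prop)
      refine this.congr (Filter.Eventually.of_forall fun x => ?_)
      simp [mul_comm]
    have hint2 : Integrable (fun x => g x * ((P.eval (Real.cos x) : ℝ) : ℂ)) (volume.restrict I) :=
      integrable_mul_of_continuous hg (by fun_prop)
    rw [← sub_zero (∫ x in I, ψ x • g x), ← h0, ← integral_sub hint1 hint2, zero_add]
    calc ‖∫ x in I, (ψ x • g x - g x * ((P.eval (Real.cos x) : ℝ) : ℂ))‖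
        ≤ ∫ x in I, ε / (C + 1) * ‖g x‖ := by
          refine norm_integral_le_of_norm_le (hg.norm.const_mul _) ?_
          filter_upwards [ae_restrict_mem measurableSet_Ioo] with x hx
          have h1 := hP (Real.cos x) ⟨Real.neg_one_le_cos x, Real.cos_le_one x⟩
          rw [Real.arccos_cos hx.1.le hx.2.le, abs_sub_comm] at h1
          have : ψ x • g x - g x * ((P.eval (Real.cos x) : ℝ) : ℂ) =
              ((ψ x - P.eval (Real.cos x) : ℝ) : ℂ) * g x := by
            simp; ring
          rw [this, norm_mul, Complex.norm_real, Real.norm_eq_abs]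
          exact mul_le_mul_of_nonneg_right h1.le (norm_nonneg _)
      _ = ε / (C + 1) * C := by rw [integral_const_mul]
      _ ≤ ε := by
          rw [div_mul_eq_mul_div, div_le_iff₀ (by positivity)]
          nlinarith
  have := IsOpen.ae_eq_zero_of_integral_contDiff_smul_eq_zero (U := I) (f := g)
    (μ := volume.restrict I) isOpen_Ioo
    (hg.locallyIntegrable.locallyIntegrableOn _) (fun ψ hψ _ _ => hcont ψ hψ.continuous)
  filter_upwards [this, ae_restrict_mem measurableSet_Ioo] with x hx hxI
  exact hx hxI

theorem eq_zero_of_pairing_cosC (g : L2On I) (h : ∀ n, pairing (cosC n) g = 0) : g = 0 := by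
  rw [Lp.eq_zero_iff_ae_eq_zero]
  refine ae_eq_zero_of_integral_mul_cos (integrable_L2On g) fun n => ?_
  have h1 := h n
  rw [pairing_apply (continuous_cosC n)] at h1
  have hne : (((if n = 0 then (√Real.pi)⁻¹ else √(2 / Real.pi)) : ℝ) : ℂ) ≠ 0 := by
    have := Real.pi_pos
    split_ifs
    · exact_mod_cast (by positivity : (√Real.pi)⁻¹ ≠ 0)
    · exact_mod_cast (by positivity : √(2 / Real.pi) ≠ 0)
  have h2 : ∀ x : ℝ, g x * cosC n x = ((if n = 0 then (√Real.pi)⁻¹ else √(2 / Real.pi) : ℝ) : ℂ) *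
      (g x * Complex.cos (n * x)) := by
    intro x; simp only [cosC, cosMode]; push_cast; ring
  simp_rw [h2] at h1
  rw [integral_const_mul] at h1
  exact (mul_eq_zero.1 h1).resolve_left hne

/-- Reduction to the cosines: `sin x cos nx` is a combination of sines, so `g sin` is orthogonal to
all cosines, and `sin` has no zero in `(0, π)`. -/
theorem eq_zero_of_pairing_sinC (g : L2On I) (h : ∀ n, pairing (sinC n) g = 0) : g = 0 := by
  have h0 : ∀ n : ℕ, ∫ x in I, g x * Complex.sin (n * x) = 0 := by
    intro n
    have h1 := h n
    rw [pairing_apply (continuous_sinC n)] at h1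
    have hne : ((√(2 / Real.pi) : ℝ) : ℂ) ≠ 0 := by
      have := Real.pi_pos
      exact_mod_cast (by positivity : √(2 / Real.pi) ≠ 0)
    have h2 : ∀ x : ℝ, g x * sinC n x = ((√(2 / Real.pi) : ℝ) : ℂ) *
        (g x * Complex.sin (n * x)) := by
      intro x; simp only [sinC, sinMode]; push_cast; ring
    simp_rw [h2] at h1
    rw [integral_const_mul] at h1
    exact (mul_eq_zero.1 h1).resolve_left hne
  have hg := integrable_L2On g
  have h3 : (fun x => g x * Complex.sin x) =ᵐ[volume.restrict I] 0 := by
    refine ae_eq_zero_of_integral_mul_cos (integrable_mul_of_continuous hg (by fun_prop))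
      fun n => ?_
    have key (x : ℝ) : g x * Complex.sin x * Complex.cos (n * x) =
        (g x * Complex.sin ((n + 1 : ℕ) * x) - g x * Complex.sin (((n : ℂ) - 1) * x)) / 2 := by
      push_cast
      rw [add_mul, sub_mul, Complex.sin_add, Complex.sin_sub]
      simp; ring
    simp_rw [key]
    rw [integral_div, integral_sub (integrable_mul_of_continuous hg (by fun_prop))
      (integrable_mul_of_continuous hg (by fun_prop)), h0]
    rcases n with _ | n
    · have := h0 1
      simp only [Nat.cast_one, one_mul] at this
      simp [integral_neg, this]
    · have := h0 n
      simp [this]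
  rw [Lp.eq_zero_iff_ae_eq_zero]
  filter_upwards [h3, ae_restrict_mem measurableSet_Ioo] with x hx hxI
  have : Complex.sin x ≠ 0 := by
    rw [← Complex.ofReal_sin]
    exact_mod_cast (Real.sin_pos_of_mem_Ioo hxI).ne'
  exact (mul_eq_zero.1 hx).resolve_right this

/-- The Hilbert basis of normalized cosines. -/
def cosBasis : HilbertBasis ℕ ℂ (L2On I) :=
  HilbertBasis.mkOfOrthogonalEqBot orthonormal_cosC <| by
    rw [Submodule.eq_bot_iff]
    intro g hg
    refine eq_zero_of_pairing_cosC g fun n => ?_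
    rw [pairing_cosC]
    exact hg _ (Submodule.subset_span ⟨n, rfl⟩)

/-- The Hilbert basis of normalized sines. -/
def sinBasis : HilbertBasis ℕ ℂ (L2On I) :=
  HilbertBasis.mkOfOrthogonalEqBot orthonormal_sinC <| by
    rw [Submodule.eq_bot_iff]
    intro g hg
    refine eq_zero_of_pairing_sinC g fun n => ?_
    rcases n with _ | n
    · rw [sinC_zero, pairing_apply (by exact continuous_zero)]; simp
    · rw [pairing_sinC]
      exact hg _ (Submodule.subset_span ⟨n, rfl⟩)

theorem cosBasis_apply (n : ℕ) : cosBasis n = toL2 (cosC n) := by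
  simp [cosBasis]

theorem sinBasis_apply (n : ℕ) : sinBasis n = toL2 (sinC (n + 1)) := by
  simp [sinBasis]

theorem pairing_cosC_cosC (m n : ℕ) :
    pairing (cosC m) (toL2 (cosC n)) = if m = n then 1 else 0 := by
  rw [pairing_cosC, orthonormal_iff_ite.1 orthonormal_cosC]

theorem toL2_zero : toL2 0 = 0 := by
  rw [Lp.eq_zero_iff_ae_eq_zero]
  exact coeFn_toL2 continuous_zero

theorem pairing_zero : pairing 0 = 0 := by
  ext g
  rw [pairing_apply (by exact continuous_zero)]; simp

theorem pairing_sinC_sinC (m n : ℕ) (hn : n ≠ 0) :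
    pairing (sinC m) (toL2 (sinC n)) = if m = n then 1 else 0 := by
  obtain ⟨n, rfl⟩ := Nat.exists_eq_succ_of_ne_zero hn
  rcases m with _ | m
  · simp [sinC_zero, pairing_zero]
  · rw [pairing_sinC]
    have := orthonormal_iff_ite.1 orthonormal_sinC m n
    simpa using this

theorem hasSum_cosC (g : L2On I) : HasSum (fun n => pairing (cosC n) g • toL2 (cosC n)) g := by
  have := cosBasis.hasSum_repr g
  simpa only [HilbertBasis.repr_apply_apply, cosBasis_apply, ← pairing_cosC] using this

theorem hasSum_sinC (g : L2On I) : HasSum (fun n => pairing (sinC n) g • toL2 (sinC n)) g := by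
  have := sinBasis.hasSum_repr g
  simp only [HilbertBasis.repr_apply_apply, sinBasis_apply, ← pairing_sinC] at this
  -- The sine basis starts at frequency `1`; since `sinC 0 = 0`, a void term at `0` lets sines and
  -- cosines share one index set.
  rw [← hasSum_nat_add_iff' 1]
  simpa [sinC_zero, toL2_zero] using this

/-! ### The modes of the system -/

theorem Params.b_pos (p : Params) : 0 < p.b :=
  mul_pos (mul_pos p.a_pos (zero_lt_one.trans_le p.one_le_γ)) (Real.rpow_pos_of_pos p.ρs_pos _)

/-- The amplitudes of density, velocity and stress in one Fourier mode. -/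
abbrev Amp : Type := ℂ × ℂ × ℂ

/-- The generator of the homogeneous system in the `n`-th Fourier mode. -/
def modeGen (p : Params) (n : ℕ) : Amp →L[ℂ] Amp :=
  LinearMap.toContinuousLinearMap
    { toFun := fun v => (-((p.ρs : ℂ) * n * v.2.1), (p.b : ℂ) * n * v.1 - (1 / p.ρs : ℂ) * n * v.2.2,
        -(1 / p.κ : ℂ) * v.2.2 + (p.μ / p.κ : ℂ) * n * v.2.1)
      map_add' := fun v w => by ext <;> simp <;> ring
      map_smul' := fun c v => by ext <;> simp <;> ring }

theorem modeGen_apply (p : Params) (n : ℕ) (v : Amp) :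
    modeGen p n v = (-((p.ρs : ℂ) * n * v.2.1),
      (p.b : ℂ) * n * v.1 - (1 / p.ρs : ℂ) * n * v.2.2,
      -(1 / p.κ : ℂ) * v.2.2 + (p.μ / p.κ : ℂ) * n * v.2.1) := rfl

/-- The flow of the homogeneous system in the `n`-th Fourier mode. -/
def modeFlow (p : Params) (n : ℕ) (t : ℝ) : Amp →L[ℂ] Amp :=
  NormedSpace.exp ((t : ℂ) • modeGen p n)

theorem modeFlow_zero (p : Params) (n : ℕ) : modeFlow p n 0 = 1 := by
  rw [modeFlow, Complex.ofReal_zero]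
  exact (congrArg NormedSpace.exp (zero_smul ℂ (modeGen p n))).trans NormedSpace.exp_zero

theorem hasDerivAt_modeFlow (p : Params) (n : ℕ) (v : Amp) (t : ℝ) :
    HasDerivAt (fun t => modeFlow p n t v) (modeGen p n (modeFlow p n t v)) t := by
  have h := (hasDerivAt_exp_smul_const' (𝕂 := ℂ) (modeGen p n) (t : ℂ)).scomp t
    Complex.ofRealCLM.hasDerivAt
  rw [Complex.ofRealCLM_apply, Complex.ofReal_one, one_smul] at h
  have h2 := (((ContinuousLinearMap.apply ℂ Amp v).restrictScalars ℝ).hasFDerivAt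
    (x := modeFlow p n t)).comp_hasDerivAt t h
  exact h2

theorem continuous_modeFlow (p : Params) (n : ℕ) (v : Amp) :
    Continuous fun t => modeFlow p n t v :=
  continuous_iff_continuousAt.2 fun t => (hasDerivAt_modeFlow p n v t).continuousAt

/-- The energy of an amplitude. -/
def energy (p : Params) (v : Amp) : ℝ :=
  p.b / p.ρs * ‖v.1‖ ^ 2 + ‖v.2.1‖ ^ 2 + p.κ / (p.μ * p.ρs) * ‖v.2.2‖ ^ 2

/-- The weights are chosen so that the coupling terms between the components cancel; only the
relaxation term `-(1/κ) S` contributes to the derivative, with a negative sign. -/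
theorem energy_modeFlow_le (p : Params) (n : ℕ) (v : Amp) {t : ℝ} (ht : 0 ≤ t) :
    energy p (modeFlow p n t v) ≤ energy p v := by
  have hρ := p.ρs_pos
  have hμ := p.μ_pos
  have hκ := p.κ_pos
  have hd : ∀ t, HasDerivAt (fun t => energy p (modeFlow p n t v))
      (-(2 / (p.μ * p.ρs)) * ‖(modeFlow p n t v).2.2‖ ^ 2) t := by
    intro t
    have h := hasDerivAt_modeFlow p n v t
    rw [modeGen_apply] at h
    have h1 := (hasFDerivAt_fst (𝕜 := ℝ) (p := modeFlow p n t v)).comp_hasDerivAt t h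
    have h2 := (hasFDerivAt_snd (𝕜 := ℝ) (p := modeFlow p n t v)).comp_hasDerivAt t h
    have h21 := (hasFDerivAt_fst (𝕜 := ℝ) (p := (modeFlow p n t v).2)).comp_hasDerivAt t h2
    have h22 := (hasFDerivAt_snd (𝕜 := ℝ) (p := (modeFlow p n t v).2)).comp_hasDerivAt t h2
    refine (((h1.norm_sq.const_mul (p.b / p.ρs)).add h21.norm_sq).add
      (h22.norm_sq.const_mul (p.κ / (p.μ * p.ρs)))).congr_deriv ?_
    rw [← Complex.normSq_eq_norm_sq, Complex.normSq_apply]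
    have e1 : (1 / p.ρs : ℂ) = ((1 / p.ρs : ℝ) : ℂ) := by push_cast; rfl
    have e2 : (1 / p.κ : ℂ) = ((1 / p.κ : ℝ) : ℂ) := by push_cast; rfl
    have e3 : (p.μ / p.κ : ℂ) = ((p.μ / p.κ : ℝ) : ℂ) := by push_cast; rfl
    have e4 : (n : ℂ) = ((n : ℝ) : ℂ) := by push_cast; rfl
    simp only [Function.comp_apply, Complex.inner, e1, e2, e3, e4, ContinuousLinearMap.coe_fst',
      ContinuousLinearMap.coe_snd', Complex.mul_re, Complex.mul_im, Complex.conj_re,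
      Complex.conj_im, Complex.sub_re, Complex.sub_im, Complex.add_re, Complex.add_im,
      Complex.neg_re, Complex.neg_im, Complex.ofReal_re, Complex.ofReal_im]
    field_simp
    ring
  have hanti : Antitone fun t => energy p (modeFlow p n t v) :=
    antitone_of_hasDerivAt_nonpos hd fun t => by
      rw [Pi.zero_apply, neg_mul, neg_nonpos]
      positivity
  have := hanti ht
  simpa [modeFlow_zero] using this

/-- The energy is equivalent to the squared norm with constants that do not depend on the mode.
Uniformity in `n` is what makes the Fourier series of the flow converge. -/
theorem exists_norm_modeFlow_le (p : Params) :
    ∃ K : ℝ, 0 ≤ K ∧ ∀ n v t, 0 ≤ t → ‖modeFlow p n t v‖ ≤ K * ‖v‖ := by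
  have hρ := p.ρs_pos
  have hμ := p.μ_pos
  have hκ := p.κ_pos
  have hb := p.b_pos
  set α := p.b / p.ρs with hα
  set β := p.κ / (p.μ * p.ρs) with hβ
  have hα0 : 0 < α := by positivity
  have hβ0 : 0 < β := by positivity
  set m := min α (min 1 β) with hm
  have hm0 : 0 < m := by positivity
  have hmα : m ≤ α := min_le_left _ _
  have hm1 : m ≤ 1 := (min_le_right _ _).trans (min_le_left _ _)
  have hmβ : m ≤ β := (min_le_right _ _).trans (min_le_right _ _)
  refine ⟨√((α + 1 + β) / m), by positivity, fun n v t ht => ?_⟩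
  have hE := energy_modeFlow_le p n v ht
  set w := modeFlow p n t v
  have hup : energy p v ≤ (α + 1 + β) * ‖v‖ ^ 2 := by
    have h1 : ‖v.1‖ ^ 2 ≤ ‖v‖ ^ 2 := by gcongr; exact norm_fst_le v
    have h2 : ‖v.2.1‖ ^ 2 ≤ ‖v‖ ^ 2 := by
      gcongr; exact (norm_fst_le v.2).trans (norm_snd_le v)
    have h3 : ‖v.2.2‖ ^ 2 ≤ ‖v‖ ^ 2 := by
      gcongr; exact (norm_snd_le v.2).trans (norm_snd_le v)
    rw [energy, ← hα, ← hβ]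
    nlinarith
  have hlow : m * ‖w‖ ^ 2 ≤ energy p w := by
    rw [energy, ← hα, ← hβ]
    have h1 := mul_le_mul_of_nonneg_right hmα (sq_nonneg ‖w.1‖)
    have h2 := mul_le_mul_of_nonneg_right hm1 (sq_nonneg ‖w.2.1‖)
    have h3 := mul_le_mul_of_nonneg_right hmβ (sq_nonneg ‖w.2.2‖)
    have h4 : ‖w‖ = ‖w.1‖ ∨ ‖w‖ = ‖w.2.1‖ ∨ ‖w‖ = ‖w.2.2‖ := by
      rw [Prod.norm_def, Prod.norm_def w.2]
      rcases max_choice ‖w.1‖ (max ‖w.2.1‖ ‖w.2.2‖) with h | h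
      · exact Or.inl h
      · right
        rw [h]
        exact max_choice _ _
    have p1 := mul_nonneg hm0.le (sq_nonneg ‖w.1‖)
    have p2 := mul_nonneg hm0.le (sq_nonneg ‖w.2.1‖)
    have p3 := mul_nonneg hm0.le (sq_nonneg ‖w.2.2‖)
    rcases h4 with h | h | h <;> rw [h] <;> linarith
  rw [← Real.sqrt_sq (norm_nonneg v), ← Real.sqrt_mul (by positivity)]
  refine Real.le_sqrt_of_sq_le ?_
  rw [div_mul_eq_mul_div, le_div_iff₀ hm0]
  linarith

/-! ### Fourier expansion of states -/

/-- The state with given amplitudes in the `n`-th Fourier mode. -/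
def inj (n : ℕ) : Amp →L[ℂ] State :=
  ((ContinuousLinearMap.fst ℂ ℂ (ℂ × ℂ)).smulRight (toL2 (cosC n))).prod
    ((((ContinuousLinearMap.fst ℂ ℂ ℂ).smulRight (toL2 (sinC n))).prod
      ((ContinuousLinearMap.snd ℂ ℂ ℂ).smulRight (toL2 (cosC n)))).comp
        (ContinuousLinearMap.snd ℂ ℂ (ℂ × ℂ)))

theorem inj_apply (n : ℕ) (v : Amp) :
    inj n v = (v.1 • toL2 (cosC n), v.2.1 • toL2 (sinC n), v.2.2 • toL2 (cosC n)) := rfl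

/-- The Fourier coefficients of a state. -/
def proj (n : ℕ) : State →L[ℂ] Amp :=
  (pairing (cosC n)).prodMap ((pairing (sinC n)).prodMap (pairing (cosC n)))

theorem proj_apply (n : ℕ) (z : State) :
    proj n z = (pairing (cosC n) z.1, pairing (sinC n) z.2.1, pairing (cosC n) z.2.2) := rfl

theorem hasSum_inj_proj (z : State) : HasSum (fun n => inj n (proj n z)) z :=
  (hasSum_cosC z.1).prodMk ((hasSum_sinC z.2.1).prodMk (hasSum_cosC z.2.2))

theorem eq_zero_of_proj (z : State) (h : ∀ n, proj n z = 0) : z = 0 := by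
  have := hasSum_inj_proj z
  simp only [h, map_zero] at this
  exact this.unique hasSum_zero

theorem summable_sq_pairing_cosC (g : L2On I) : Summable fun n => ‖pairing (cosC n) g‖ ^ 2 := by
  simp_rw [pairing_cosC]
  exact orthonormal_cosC.inner_products_summable g

theorem summable_sq_pairing_sinC (g : L2On I) : Summable fun n => ‖pairing (sinC n) g‖ ^ 2 := by
  rw [← summable_nat_add_iff 1]
  simp_rw [pairing_sinC]
  exact orthonormal_sinC.inner_products_summable g

theorem summable_sq_proj (z : State) : Summable fun n => ‖proj n z‖ ^ 2 := by
  refine Summable.of_nonneg_of_le (fun n => sq_nonneg _) (fun n => ?_)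
    (((summable_sq_pairing_cosC z.1).add (summable_sq_pairing_sinC z.2.1)).add
      (summable_sq_pairing_cosC z.2.2))
  rw [proj_apply, Prod.norm_def, Prod.norm_def]
  rcases max_choice ‖pairing (cosC n) z.1‖
    (max ‖pairing (sinC n) z.2.1‖ ‖pairing (cosC n) z.2.2‖) with h | h
  · rw [h]; nlinarith [sq_nonneg ‖pairing (sinC n) z.2.1‖, sq_nonneg ‖pairing (cosC n) z.2.2‖]
  · rw [h]
    rcases max_choice ‖pairing (sinC n) z.2.1‖ ‖pairing (cosC n) z.2.2‖ with h | h <;> rw [h] <;>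
    nlinarith [sq_nonneg ‖pairing (sinC n) z.2.1‖, sq_nonneg ‖pairing (cosC n) z.2.2‖,
      sq_nonneg ‖pairing (cosC n) z.1‖]

/-- Riesz representation turns `L` into an inner product, and Bessel's inequality applies. -/
theorem summable_sq_functional {v : ℕ → L2On I} (hv : Orthonormal ℂ v) (L : L2On I →L[ℂ] ℂ) :
    Summable fun n => ‖L (v n)‖ ^ 2 := by
  have h := hv.inner_products_summable ((InnerProductSpace.toDual ℂ (L2On I)).symm L)
  refine h.congr fun n => ?_
  rw [← InnerProductSpace.toDual_symm_apply (y := L), norm_inner_symm]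

/-- Paired with the square-summable `proj n z`, this makes the series of a functional along an orbit
absolutely and uniformly summable; it also bounds the restrictions of a functional to the modes. -/
theorem summable_sq_functional_inj (L : State →L[ℂ] ℂ) :
    Summable fun n => ‖L.comp (inj n)‖ ^ 2 := by
  set L₁ := L.comp (ContinuousLinearMap.inl ℂ (L2On I) (L2On I × L2On I)) with h₁
  set L₂ := L.comp ((ContinuousLinearMap.inr ℂ (L2On I) (L2On I × L2On I)).comp
    (ContinuousLinearMap.inl ℂ (L2On I) (L2On I))) with h₂
  set L₃ := L.comp ((ContinuousLinearMap.inr ℂ (L2On I) (L2On I × L2On I)).comp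
    (ContinuousLinearMap.inr ℂ (L2On I) (L2On I))) with h₃
  have s₂ : Summable fun n => ‖L₂ (toL2 (sinC n))‖ ^ 2 := by
    rw [← summable_nat_add_iff 1]
    exact summable_sq_functional orthonormal_sinC L₂
  refine Summable.of_nonneg_of_le (fun n => sq_nonneg _) (fun n => ?_)
    ((((summable_sq_functional orthonormal_cosC L₁).add s₂).add
      (summable_sq_functional orthonormal_cosC L₃)).mul_left 3)
  have hb : ‖L.comp (inj n)‖ ≤
      ‖L₁ (toL2 (cosC n))‖ + ‖L₂ (toL2 (sinC n))‖ + ‖L₃ (toL2 (cosC n))‖ := by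
    refine ContinuousLinearMap.opNorm_le_bound _ (by positivity) fun v => ?_
    have : L.comp (inj n) v = v.1 * L₁ (toL2 (cosC n)) + v.2.1 * L₂ (toL2 (sinC n)) +
        v.2.2 * L₃ (toL2 (cosC n)) := by
      simp only [h₁, h₂, h₃, ContinuousLinearMap.comp_apply, inj_apply,
        ContinuousLinearMap.inl_apply, ContinuousLinearMap.inr_apply, ← smul_eq_mul, ← map_smul,
        ← map_add]
      simp
    rw [this, add_mul, add_mul]
    refine (norm_add_le _ _).trans (add_le_add ((norm_add_le _ _).trans (add_le_add ?_ ?_)) ?_) <;>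
    rw [norm_mul, mul_comm] <;> gcongr
    · exact norm_fst_le v
    · exact (norm_fst_le v.2).trans (norm_snd_le v)
    · exact (norm_snd_le v.2).trans (norm_snd_le v)
  calc ‖L.comp (inj n)‖ ^ 2 ≤
      (‖L₁ (toL2 (cosC n))‖ + ‖L₂ (toL2 (sinC n))‖ + ‖L₃ (toL2 (cosC n))‖) ^ 2 := by gcongr
    _ ≤ _ := by
      nlinarith [sq_nonneg (‖L₁ (toL2 (cosC n))‖ - ‖L₂ (toL2 (sinC n))‖),
        sq_nonneg (‖L₁ (toL2 (cosC n))‖ - ‖L₃ (toL2 (cosC n))‖),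
        sq_nonneg (‖L₂ (toL2 (sinC n))‖ - ‖L₃ (toL2 (cosC n))‖)]

/-! ### The semigroup -/

/-- A fixed square-summable majorant allows dominated convergence in `ℓ²`, so continuity of each
coefficient gives continuity of the sum in norm. -/
theorem exists_continuous_hasSum_of_dominated {H : Type*} [NormedAddCommGroup H]
    [InnerProductSpace ℂ H] (b : HilbertBasis ℕ ℂ H) (a : ℝ → ℕ → ℂ) (B : ℕ → ℝ)
    (ha : ∀ n, Continuous fun t => a t n) (hB : Summable fun n => B n ^ 2)
    (haB : ∀ t n, ‖a t n‖ ≤ B n) :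
    ∃ w : ℝ → H, Continuous w ∧ ∀ t, HasSum (fun n => a t n • b n) (w t) := by
  have h2 : (2 : ENNReal).toReal = 2 := by norm_num
  have hmem : ∀ t, Memℓp (a t) 2 := by
    intro t
    refine memℓp_gen ?_
    rw [h2]
    refine Summable.of_nonneg_of_le (fun n => by positivity) (fun n => ?_) hB
    rw [Real.rpow_two]
    gcongr
    exact haB t n
  let x : ℝ → lp (fun _ : ℕ => ℂ) 2 := fun t => ⟨a t, hmem t⟩
  have hx : Continuous x := by
    rw [continuous_iff_continuousAt]
    intro s
    rw [ContinuousAt, tendsto_iff_norm_sub_tendsto_zero]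
    have hsq : Filter.Tendsto (fun t => ‖x t - x s‖ ^ 2) (nhds s) (nhds 0) := by
      have e : ∀ t, ‖x t - x s‖ ^ 2 = ∑' n, ‖a t n - a s n‖ ^ 2 := by
        intro t
        have := lp.norm_rpow_eq_tsum (p := 2) (by norm_num) (x t - x s)
        simp only [h2, Real.rpow_two] at this
        exact this
      simp_rw [e]
      rw [show (0 : ℝ) = ∑' n : ℕ, (0 : ℝ) from tsum_zero.symm]
      refine tendsto_tsum_of_dominated_convergence (hB.mul_left 4) (fun n => ?_)
        (Filter.Eventually.of_forall fun t n => ?_)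
      · have : ContinuousAt (fun t => ‖a t n - a s n‖ ^ 2) s := by
          have := ha n
          fun_prop
        simpa [ContinuousAt] using this
      · rw [Real.norm_eq_abs, abs_of_nonneg (by positivity)]
        have h1 : ‖a t n - a s n‖ ≤ 2 * B n :=
          (norm_sub_le _ _).trans (by linarith [haB t n, haB s n])
        calc ‖a t n - a s n‖ ^ 2 ≤ (2 * B n) ^ 2 := by gcongr
          _ = 4 * B n ^ 2 := by ring
    have := hsq.sqrt
    simpa [Real.sqrt_sq (norm_nonneg _)] using this
  refine ⟨fun t => b.repr.symm (x t), b.repr.symm.continuous.comp hx, fun t => ?_⟩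
  exact b.hasSum_repr_symm (x t)

theorem exists_semigroup_orbit (p : Params) (z : State) :
    ∃ W : ℝ → State, Continuous W ∧
      ∀ t, 0 ≤ t → HasSum (fun n => inj n (modeFlow p n t (proj n z))) (W t) := by
  obtain ⟨K, hK, hflow⟩ := exists_norm_modeFlow_le p
  have hB : Summable fun n => (K * ‖proj n z‖) ^ 2 := by
    simp_rw [mul_pow]
    exact (summable_sq_proj z).mul_left _
  -- The uniform bound on the flow holds only for `t ≥ 0`; freezing the orbit at negative times
  -- makes the curve continuous on all of `ℝ`.
  let v : ℝ → ℕ → Amp := fun t n => modeFlow p n (max t 0) (proj n z)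
  have hv : ∀ n, Continuous fun t => v t n := fun n =>
    (continuous_modeFlow p n (proj n z)).comp (by fun_prop)
  have hvB : ∀ t n, ‖v t n‖ ≤ K * ‖proj n z‖ := fun t n => hflow _ _ _ (le_max_right _ _)
  obtain ⟨w₁, hw₁, h₁⟩ := exists_continuous_hasSum_of_dominated cosBasis (fun t n => (v t n).1) _
    (fun n => continuous_fst.comp (hv n)) hB fun t n => (norm_fst_le _).trans (hvB t n)
  obtain ⟨w₂, hw₂, h₂⟩ := exists_continuous_hasSum_of_dominated sinBasis
    (fun t n => (v t (n + 1)).2.1) (fun n => K * ‖proj (n + 1) z‖)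
    (fun n => continuous_fst.comp (continuous_snd.comp (hv (n + 1))))
    ((summable_nat_add_iff 1).2 hB)
    fun t n => ((norm_fst_le _).trans (norm_snd_le _)).trans (hvB t (n + 1))
  obtain ⟨w₃, hw₃, h₃⟩ := exists_continuous_hasSum_of_dominated cosBasis
    (fun t n => (v t n).2.2) _
    (fun n => continuous_snd.comp (continuous_snd.comp (hv n))) hB
    fun t n => ((norm_snd_le _).trans (norm_snd_le _)).trans (hvB t n)
  refine ⟨fun t => (w₁ t, w₂ t, w₃ t), by fun_prop, fun t ht => ?_⟩
  have h₁ := h₁ t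
  have h₂ := h₂ t
  have h₃ := h₃ t
  simp only [v, max_eq_left ht, cosBasis_apply, sinBasis_apply] at h₁ h₂ h₃
  refine h₁.prodMk (HasSum.prodMk ?_ h₃)
  rw [← hasSum_nat_add_iff' 1]
  simpa [sinC_zero, toL2_zero] using h₂

/-! ### Weak formulation -/

/-- `(ρ, u, S) ↦ ∫ ρ φ₁ + ∫ u φ₂ + ∫ S φ₃`. -/
def testFun (φ₁ φ₂ φ₃ : ℝ → ℂ) : State →L[ℂ] ℂ :=
  (pairing φ₁).coprod ((pairing φ₂).coprod (pairing φ₃))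

/-- The generator of the homogeneous system, tested against `(φ₁, φ₂, φ₃)`. -/
def testGen (p : Params) (φ₁ φ₂ φ₃ : ℝ → ℂ) : State →L[ℂ] ℂ :=
  ((p.b : ℂ) • pairing (deriv φ₂)).coprod
    (((p.ρs : ℂ) • pairing (deriv φ₁) - (p.μ / p.κ : ℂ) • pairing (deriv φ₃)).coprod
      (-(1 / p.ρs : ℂ) • pairing (deriv φ₂) - (1 / p.κ : ℂ) • pairing φ₃))

theorem testFun_apply (φ₁ φ₂ φ₃ : ℝ → ℂ) (z : State) :
    testFun φ₁ φ₂ φ₃ z = pairing φ₁ z.1 + (pairing φ₂ z.2.1 + pairing φ₃ z.2.2) := rfl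

theorem testGen_apply (p : Params) (φ₁ φ₂ φ₃ : ℝ → ℂ) (z : State) :
    testGen p φ₁ φ₂ φ₃ z = (p.b : ℂ) * pairing (deriv φ₂) z.1 +
      (((p.ρs : ℂ) * pairing (deriv φ₁) z.2.1 - (p.μ / p.κ : ℂ) * pairing (deriv φ₃) z.2.1) +
      (-(1 / p.ρs : ℂ) * pairing (deriv φ₂) z.2.2 - (1 / p.κ : ℂ) * pairing φ₃ z.2.2)) := rfl

theorem continuous_deriv_of_smooth {φ : ℝ → ℂ} (hφ : ContDiff ℝ ∞ φ) : Continuous (deriv φ) :=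
  hφ.continuous_deriv (by simp)

/-- The sines vanish at both ends, so no boundary condition on `φ` is needed. Against cosines,
below, `φ` itself has to vanish there. This is how the weak formulation encodes `u = 0` at the
boundary. -/
theorem pairing_deriv_sinC {φ : ℝ → ℂ} (hφ : ContDiff ℝ ∞ φ) (n : ℕ) :
    pairing (deriv φ) (toL2 (sinC n)) = -((n : ℂ) * pairing φ (toL2 (cosC n))) := by
  have hφ' := continuous_deriv_of_smooth hφ
  rw [pairing_toL2' hφ' (continuous_sinC n), pairing_toL2' hφ.continuous (continuous_cosC n)]
  have := intervalIntegral.integral_mul_deriv_eq_deriv_mul (a := 0) (b := Real.pi)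
    (u := sinC n) (v := φ) (u' := fun x => n * cosC n x) (v' := deriv φ)
    (fun x _ => hasDerivAt_sinC n x)
    (fun x _ => (hφ.differentiable (by simp) x).hasDerivAt)
    ((continuous_const.mul (continuous_cosC n)).intervalIntegrable _ _)
    (hφ'.intervalIntegrable _ _)
  rw [this, sinC_at_zero, sinC_at_pi, ← intervalIntegral.integral_const_mul]
  simp [mul_assoc]

theorem pairing_deriv_cosC {φ : ℝ → ℂ} (hφ : ContDiff ℝ ∞ φ) (h0 : φ 0 = 0)
    (hπ : φ Real.pi = 0) (n : ℕ) :
    pairing (deriv φ) (toL2 (cosC n)) = (n : ℂ) * pairing φ (toL2 (sinC n)) := by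
  have hφ' := continuous_deriv_of_smooth hφ
  rw [pairing_toL2' hφ' (continuous_cosC n), pairing_toL2' hφ.continuous (continuous_sinC n)]
  have := intervalIntegral.integral_mul_deriv_eq_deriv_mul (a := 0) (b := Real.pi)
    (u := cosC n) (v := φ) (u' := fun x => -(n : ℂ) * sinC n x) (v' := deriv φ)
    (fun x _ => hasDerivAt_cosC n x)
    (fun x _ => (hφ.differentiable (by simp) x).hasDerivAt)
    ((continuous_const.mul (continuous_sinC n)).intervalIntegrable _ _)
    (hφ'.intervalIntegrable _ _)
  rw [this, h0, hπ, ← intervalIntegral.integral_const_mul]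
  simp [mul_assoc]

theorem testFun_inj_modeGen (p : Params) {φ₁ φ₂ φ₃ : ℝ → ℂ} (h₁ : ContDiff ℝ ∞ φ₁)
    (h₂ : ContDiff ℝ ∞ φ₂) (h₃ : ContDiff ℝ ∞ φ₃) (h0 : φ₂ 0 = 0) (hπ : φ₂ Real.pi = 0) (n : ℕ)
    (v : Amp) :
    testFun φ₁ φ₂ φ₃ (inj n (modeGen p n v)) = testGen p φ₁ φ₂ φ₃ (inj n v) := by
  simp only [testFun_apply, testGen_apply, inj_apply, modeGen_apply, map_smul, smul_eq_mul,
    pairing_deriv_sinC h₁, pairing_deriv_sinC h₃, pairing_deriv_cosC h₂ h0 hπ]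
  ring

/-- The weak formulation of the equations, with a continuous forcing `G`. -/
def IsWeak (p : Params) (T : ℝ) (G : ℝ → State) (z₀ : State) (z : ℝ → State) : Prop :=
  ∀ φ₁ φ₂ φ₃ : ℝ → ℂ, ContDiff ℝ ∞ φ₁ → ContDiff ℝ ∞ φ₂ → ContDiff ℝ ∞ φ₃ → φ₂ 0 = 0 →
    φ₂ Real.pi = 0 → ∀ t ∈ Icc 0 T,
      testFun φ₁ φ₂ φ₃ (z t) = testFun φ₁ φ₂ φ₃ z₀ +
        ∫ s in (0 : ℝ)..t, (testGen p φ₁ φ₂ φ₃ (z s) + testFun φ₁ φ₂ φ₃ (G s))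

/-- Each mode satisfies the weak identity by the fundamental theorem of calculus. Sum and integral
are exchanged thanks to the majorant `‖L' ∘ inj n‖ * (K * ‖proj n z₀‖)`, a product of two
square-summable sequences. -/
theorem isWeak_of_hasSum (p : Params) (T : ℝ) (z₀ : State) {W : ℝ → State}
    (hW : ∀ t, 0 ≤ t → HasSum (fun n => inj n (modeFlow p n t (proj n z₀))) (W t)) :
    IsWeak p T 0 z₀ W := by
  intro φ₁ φ₂ φ₃ h₁ h₂ h₃ h0 hπ t ht
  obtain ⟨K, hK, hflow⟩ := exists_norm_modeFlow_le p
  simp only [Pi.zero_apply, map_zero, add_zero]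
  set L := testFun φ₁ φ₂ φ₃
  set L' := testGen p φ₁ φ₂ φ₃ with hL'
  have hcont : ∀ n, Continuous fun s => L' (inj n (modeFlow p n s (proj n z₀))) := fun n =>
    L'.continuous.comp ((inj n).continuous.comp (continuous_modeFlow p n _))
  have hint : HasSum (fun n => ∫ s in (0 : ℝ)..t, L' (inj n (modeFlow p n s (proj n z₀))))
      (∫ s in (0 : ℝ)..t, L' (W s)) := by
    have hsum : Summable fun n => ‖L'.comp (inj n)‖ * (K * ‖proj n z₀‖) := by
      refine Summable.of_nonneg_of_le (fun n => by positivity) (fun n => ?_)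
        ((summable_sq_functional_inj L').add ((summable_sq_proj z₀).mul_left (K ^ 2)))
      nlinarith [sq_nonneg (‖L'.comp (inj n)‖ - K * ‖proj n z₀‖), sq_nonneg ‖L'.comp (inj n)‖,
        sq_nonneg (K * ‖proj n z₀‖)]
    refine intervalIntegral.hasSum_integral_of_dominated_convergence
      (fun n _ => ‖L'.comp (inj n)‖ * (K * ‖proj n z₀‖))
      (fun n => (hcont n).aestronglyMeasurable)
      (fun n => Filter.Eventually.of_forall fun s hs => ?_)
      (Filter.Eventually.of_forall fun _ _ => hsum) (by simp)
      (Filter.Eventually.of_forall fun s hs => ?_)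
    · rw [uIoc_of_le ht.1] at hs
      refine ((L'.comp (inj n)).le_opNorm _).trans ?_
      gcongr
      exact hflow n _ s hs.1.le
    · rw [uIoc_of_le ht.1] at hs
      exact L'.hasSum (hW s hs.1.le)
  have hsum₂ := (L.hasSum (hasSum_inj_proj z₀)).add hint
  refine (L.hasSum (hW t ht.1)).unique ?_
  have e : (fun n => L (inj n (modeFlow p n t (proj n z₀)))) = fun n => L (inj n (proj n z₀)) +
      ∫ s in (0 : ℝ)..t, L' (inj n (modeFlow p n s (proj n z₀))) := by
    ext n
    have hd : ∀ s, HasDerivAt (fun s => L (inj n (modeFlow p n s (proj n z₀))))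
        (L' (inj n (modeFlow p n s (proj n z₀)))) s := by
      intro s
      rw [hL', ← testFun_inj_modeGen p h₁ h₂ h₃ h0 hπ]
      exact (((L.comp (inj n)).restrictScalars ℝ).hasFDerivAt).comp_hasDerivAt s
        (hasDerivAt_modeFlow p n (proj n z₀) s)
    rw [intervalIntegral.integral_eq_sub_of_hasDerivAt (fun s _ => hd s)
      ((hcont n).intervalIntegrable _ _), modeFlow_zero]
    simp
  rw [e]
  exact hsum₂

/-! ### Weak solutions and the solutions of the definition -/

/-- The continuous forcing `G` represents the control `F`. -/
def Represents {O₁ O₂ O₃ : Set ℝ} (G : ℝ → State) (F : Control O₁ O₂ O₃) : Prop :=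
  ∀ φ : ℝ → ℂ, Continuous φ → ∀ s, (∫ x in O₁, F.f₁ s x * φ x) = pairing φ (G s).1 ∧
    (∫ x in O₂, F.f₂ s x * φ x) = pairing φ (G s).2.1 ∧
    (∫ x in O₃, F.f₃ s x * φ x) = pairing φ (G s).2.2

theorem deriv_zero_fun : deriv (0 : ℝ → ℂ) = 0 := by
  ext x; exact deriv_const x (0 : ℂ)

theorem isSolution_of_isWeak {p : Params} {T : ℝ} {O₁ O₂ O₃ : Set ℝ} {F : Control O₁ O₂ O₃}
    {G : ℝ → State} {z₀ : State} {z : ℝ → State} (hG : Represents G F) (hz : Continuous z)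
    (h0 : z 0 = z₀) (h : IsWeak p T G z₀ z) : IsSolution p T F z₀ z where
  continuousOn := hz.continuousOn
  initial := h0
  density := fun φ hφ t ht => by
    have := h φ 0 0 hφ contDiff_const contDiff_const rfl rfl t ht
    simp only [testFun_apply, testGen_apply, deriv_zero_fun, pairing_zero,
      _root_.zero_apply, mul_zero, sub_zero, add_zero, zero_add] at this
    simp only [(hG φ hφ.continuous _).1, ← pairing_apply hφ.continuous,
      ← pairing_apply (continuous_deriv_of_smooth hφ)]
    exact this
  velocity := fun φ hφ hφ0 hφπ t ht => by
    have := h 0 φ 0 contDiff_const hφ contDiff_const hφ0 hφπ t ht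
    simp only [testFun_apply, testGen_apply, deriv_zero_fun, pairing_zero,
      _root_.zero_apply, mul_zero, sub_zero, add_zero, zero_add] at this
    simp only [(hG φ hφ.continuous _).2.1, ← pairing_apply hφ.continuous,
      ← pairing_apply (continuous_deriv_of_smooth hφ)]
    rw [this]
    simp only [neg_mul, ← sub_eq_add_neg]
  stress := fun φ hφ t ht => by
    have := h 0 0 φ contDiff_const contDiff_const hφ rfl rfl t ht
    simp only [testFun_apply, testGen_apply, deriv_zero_fun, pairing_zero,
      _root_.zero_apply, mul_zero, zero_sub, zero_add] at this
    simp only [(hG φ hφ.continuous _).2.2, ← pairing_apply hφ.continuous,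
      ← pairing_apply (continuous_deriv_of_smooth hφ)]
    rw [this]
    congr 2
    ext s
    ring

theorem intervalIntegrable_of_continuousOn_Icc {E : Type*} [NormedAddCommGroup E] {T t : ℝ}
    {g : ℝ → E} (hg : ContinuousOn g (Icc 0 T)) (ht : t ∈ Icc 0 T) :
    IntervalIntegrable g volume 0 t := by
  refine ContinuousOn.intervalIntegrable (hg.mono ?_)
  rw [uIcc_of_le ht.1]
  exact Icc_subset_Icc_right ht.2

theorem isWeak_of_isSolution {p : Params} {T : ℝ} {O₁ O₂ O₃ : Set ℝ} {F : Control O₁ O₂ O₃}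
    {G : ℝ → State} {z₀ : State} {z : ℝ → State} (hG : Represents G F) (hGc : Continuous G)
    (h : IsSolution p T F z₀ z) : IsWeak p T G z₀ z := by
  intro φ₁ φ₂ φ₃ h₁ h₂ h₃ h0 hπ t ht
  have e₁ := h.density φ₁ h₁ t ht
  have e₂ := h.velocity φ₂ h₂ h0 hπ t ht
  have e₃ := h.stress φ₃ h₃ t ht
  simp only [(hG φ₁ h₁.continuous _).1, (hG φ₂ h₂.continuous _).2.1,
    (hG φ₃ h₃.continuous _).2.2, ← pairing_apply h₁.continuous,
    ← pairing_apply h₂.continuous, ← pairing_apply h₃.continuous,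
    ← pairing_apply (continuous_deriv_of_smooth h₁),
    ← pairing_apply (continuous_deriv_of_smooth h₂),
    ← pairing_apply (continuous_deriv_of_smooth h₃)] at e₁ e₂ e₃
  have c₁ : ContinuousOn (fun s => (z s).1) (Icc 0 T) := continuous_fst.comp_continuousOn
    h.continuousOn
  have c₂ : ContinuousOn (fun s => (z s).2.1) (Icc 0 T) :=
    (continuous_fst.comp continuous_snd).comp_continuousOn h.continuousOn
  have c₃ : ContinuousOn (fun s => (z s).2.2) (Icc 0 T) :=
    (continuous_snd.comp continuous_snd).comp_continuousOn h.continuousOn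
  have hL : ∀ {g : ℝ → L2On I} (ψ : ℝ → ℂ), ContinuousOn g (Icc 0 T) →
      ContinuousOn (fun s => pairing ψ (g s)) (Icc 0 T) :=
    fun ψ hg => (pairing ψ).continuous.comp_continuousOn hg
  have hGL : ∀ {g : ℝ → L2On I} (ψ : ℝ → ℂ), Continuous g →
      ContinuousOn (fun s => pairing ψ (g s)) (Icc 0 T) :=
    fun ψ hg => ((pairing ψ).continuous.comp hg).continuousOn
  rw [testFun_apply, testFun_apply, e₁, e₂, e₃]
  have key : ∀ s, testGen p φ₁ φ₂ φ₃ (z s) + testFun φ₁ φ₂ φ₃ (G s) =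
      ((p.ρs : ℂ) * pairing (deriv φ₁) (z s).2.1 + pairing φ₁ (G s).1) +
      (((p.b : ℂ) * pairing (deriv φ₂) (z s).1 - (1 / p.ρs : ℂ) * pairing (deriv φ₂) (z s).2.2 +
        pairing φ₂ (G s).2.1) +
      (-(1 / p.κ : ℂ) * pairing φ₃ (z s).2.2 - (p.μ / p.κ : ℂ) * pairing (deriv φ₃) (z s).2.1 +
        pairing φ₃ (G s).2.2)) := by
    intro s
    rw [testGen_apply, testFun_apply]
    ring
  simp_rw [key]
  have i₁ := intervalIntegrable_of_continuousOn_Icc (((hL (deriv φ₁) c₂).const_mul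
    (p.ρs : ℂ)).fun_add (hGL φ₁ hGc.fst)) ht
  have i₂ := intervalIntegrable_of_continuousOn_Icc ((((hL (deriv φ₂) c₁).const_mul
    (p.b : ℂ)).fun_sub ((hL (deriv φ₂) c₃).const_mul (1 / p.ρs : ℂ))).fun_add
    (hGL φ₂ hGc.snd.fst)) ht
  have i₃ := intervalIntegrable_of_continuousOn_Icc ((((hL φ₃ c₃).const_mul
    (-(1 / p.κ : ℂ))).fun_sub ((hL (deriv φ₃) c₂).const_mul (p.μ / p.κ : ℂ))).fun_add
    (hGL φ₃ hGc.snd.snd)) ht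
  rw [intervalIntegral.integral_add i₁ (i₂.add i₃), intervalIntegral.integral_add i₂ i₃]
  ring

/-! ### Uniqueness -/

/-- The integrand is continuous only on `[0, T]`; extending it by constants makes the fundamental
theorem available at the left endpoint as well. -/
theorem hasDerivWithinAt_of_eq_integral {T : ℝ} {f g : ℝ → ℂ} {c : ℂ}
    (hg : ContinuousOn g (Icc 0 T))
    (h : ∀ t ∈ Icc 0 T, f t = c + ∫ s in (0 : ℝ)..t, g s) {t : ℝ} (ht : t ∈ Ico 0 T) :
    HasDerivWithinAt f (g t) (Ici t) t := by
  have hT : (0 : ℝ) ≤ T := ht.1.trans ht.2.le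
  set g' : ℝ → ℂ := IccExtend hT ((Icc 0 T).domRestrict g) with hg'
  have hc : Continuous g' := (continuousOn_iff_continuous_domRestrict.1 hg).Icc_extend'
  have hgg : ∀ s ∈ Icc 0 T, g' s = g s := fun s hs => by
    rw [hg', IccExtend_of_mem hT _ hs, domRestrict_apply]
  have hd : HasDerivAt (fun t => c + ∫ s in (0 : ℝ)..t, g' s) (g' t) t :=
    (intervalIntegral.integral_hasDerivAt_right (hc.intervalIntegrable _ _)
      (hc.stronglyMeasurableAtFilter _ _) hc.continuousAt).const_add c
  rw [hgg t ⟨ht.1, ht.2.le⟩] at hd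
  have h1 : HasDerivWithinAt f (g t) (Icc 0 T) t := by
    refine hd.hasDerivWithinAt.congr (fun r hr => ?_) ?_
    · rw [h r hr]
      congr 1
      refine intervalIntegral.integral_congr fun s hs => ?_
      rw [uIcc_of_le hr.1] at hs
      exact (hgg s ⟨hs.1, hs.2.trans hr.2⟩).symm
    · have hr : t ∈ Icc 0 T := ⟨ht.1, ht.2.le⟩
      rw [h t hr]
      congr 1
      refine intervalIntegral.integral_congr fun s hs => ?_
      rw [uIcc_of_le hr.1] at hs
      exact (hgg s ⟨hs.1, hs.2.trans hr.2⟩).symm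
  refine h1.mono_of_mem_nhdsWithin ?_
  exact Filter.mem_of_superset (Icc_mem_nhdsGE ht.2) (Icc_subset_Icc_left ht.1)

theorem eqOn_zero_of_linear_ode {E : Type*} [NormedAddCommGroup E] [NormedSpace ℝ E]
    (A : E →L[ℝ] E) {T : ℝ} {f : ℝ → E} (hf : ContinuousOn f (Icc 0 T))
    (hd : ∀ t ∈ Ico 0 T, HasDerivWithinAt f (A (f t)) (Ici t) t) (h0 : f 0 = 0) :
    ∀ t ∈ Icc 0 T, f t = 0 := by
  refine ODE_solution_unique (v := fun _ x => A x) (K := ‖A‖₊) (fun _ => A.lipschitz) hf hd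
    (g := fun _ => 0) continuousOn_const (fun t _ => ?_) h0
  simpa using hasDerivWithinAt_const t (Ici t) (0 : E)

theorem pairing_const_mul (c : ℂ) {φ : ℝ → ℂ} (hφ : Continuous φ) (g : L2On I) :
    pairing (fun x => c * φ x) g = c * pairing φ g := by
  rw [pairing_apply hφ, pairing_apply (by fun_prop), ← integral_const_mul]
  congr 1; ext x; ring

theorem pairing_deriv_cosC_apply (n : ℕ) (g : L2On I) :
    pairing (deriv (cosC n)) g = -(n : ℂ) * pairing (sinC n) g := by
  rw [← pairing_const_mul _ (continuous_sinC n)]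
  congr 2; ext x; exact (hasDerivAt_cosC n x).deriv

theorem pairing_deriv_sinC_apply (n : ℕ) (g : L2On I) :
    pairing (deriv (sinC n)) g = (n : ℂ) * pairing (cosC n) g := by
  rw [← pairing_const_mul _ (continuous_cosC n)]
  congr 2; ext x; exact (hasDerivAt_sinC n x).deriv

/-- Testing with the `n`-th cosine and sine closes the equations for the `n`-th coefficients: they
solve the linear ODE of `modeGen p n` with zero initial value. -/
theorem eq_zero_of_isWeak {p : Params} {T : ℝ} {z : ℝ → State} (hz : ContinuousOn z (Icc 0 T))
    (h : IsWeak p T 0 0 z) : ∀ t ∈ Icc 0 T, z t = 0 := by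
  intro t ht
  refine eq_zero_of_proj _ fun n => ?_
  have hc : ContinuousOn (fun s => proj n (z s)) (Icc 0 T) :=
    (proj n).continuous.comp_continuousOn hz
  have hMc : ContinuousOn (fun s => modeGen p n (proj n (z s))) (Icc 0 T) :=
    (modeGen p n).continuous.comp_continuousOn hc
  have e : ∀ r ∈ Icc 0 T,
      (proj n (z r)).1 = 0 + ∫ s in (0 : ℝ)..r, (modeGen p n (proj n (z s))).1 := by
    intro r hr
    have := h (cosC n) 0 0 (contDiff_cosC n) contDiff_const contDiff_const rfl rfl r hr
    simp only [testFun_apply, testGen_apply, deriv_zero_fun, pairing_zero, Pi.zero_apply, map_zero,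
      _root_.zero_apply, mul_zero, sub_zero, add_zero, zero_add,
      pairing_deriv_cosC_apply] at this
    rw [proj_apply, this, zero_add]
    refine intervalIntegral.integral_congr fun s _ => ?_
    simp only [modeGen_apply, proj_apply]; ring
  have e' : ∀ r ∈ Icc 0 T,
      (proj n (z r)).2.1 = 0 + ∫ s in (0 : ℝ)..r, (modeGen p n (proj n (z s))).2.1 := by
    intro r hr
    have := h 0 (sinC n) 0 contDiff_const (contDiff_sinC n) contDiff_const (sinC_at_zero n)
      (sinC_at_pi n) r hr
    simp only [testFun_apply, testGen_apply, deriv_zero_fun, pairing_zero, Pi.zero_apply, map_zero,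
      _root_.zero_apply, mul_zero, sub_zero, add_zero, zero_add,
      pairing_deriv_sinC_apply] at this
    rw [proj_apply, this, zero_add]
    refine intervalIntegral.integral_congr fun s _ => ?_
    simp only [modeGen_apply, proj_apply]; ring
  have e'' : ∀ r ∈ Icc 0 T,
      (proj n (z r)).2.2 = 0 + ∫ s in (0 : ℝ)..r, (modeGen p n (proj n (z s))).2.2 := by
    intro r hr
    have := h 0 0 (cosC n) contDiff_const contDiff_const (contDiff_cosC n) rfl rfl r hr
    simp only [testFun_apply, testGen_apply, deriv_zero_fun, pairing_zero, Pi.zero_apply, map_zero,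
      _root_.zero_apply, mul_zero, zero_sub, add_zero, zero_add,
      pairing_deriv_cosC_apply] at this
    rw [proj_apply, this, zero_add]
    refine intervalIntegral.integral_congr fun s _ => ?_
    simp only [modeGen_apply, proj_apply]; ring
  have h00 : (0 : ℝ) ∈ Icc 0 T := ⟨le_rfl, ht.1.trans ht.2⟩
  refine eqOn_zero_of_linear_ode ((modeGen p n).restrictScalars ℝ) hc (fun r hr => ?_) ?_ t ht
  · exact (hasDerivWithinAt_of_eq_integral (continuous_fst.comp_continuousOn hMc) e hr).prodMk
      ((hasDerivWithinAt_of_eq_integral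
        ((continuous_fst.comp continuous_snd).comp_continuousOn hMc) e' hr).prodMk
      (hasDerivWithinAt_of_eq_integral
        ((continuous_snd.comp continuous_snd).comp_continuousOn hMc) e'' hr))
  · refine Prod.ext ?_ (Prod.ext ?_ ?_)
    · rw [e 0 h00]; simp
    · rw [e' 0 h00]; simp
    · rw [e'' 0 h00]; simp

theorem continuousOn_weak_integrand {p : Params} {T : ℝ} {G z : ℝ → State} (hG : Continuous G)
    (hz : ContinuousOn z (Icc 0 T)) (φ₁ φ₂ φ₃ : ℝ → ℂ) :
    ContinuousOn (fun s => testGen p φ₁ φ₂ φ₃ (z s) + testFun φ₁ φ₂ φ₃ (G s)) (Icc 0 T) :=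
  ((testGen p φ₁ φ₂ φ₃).continuous.comp_continuousOn hz).add
    ((testFun φ₁ φ₂ φ₃).continuous.comp hG).continuousOn

theorem IsWeak.add_smul {p : Params} {T : ℝ} {G H z w : ℝ → State} {z₀ w₀ : State} (c : ℂ)
    (hG : Continuous G) (hH : Continuous H) (hzc : ContinuousOn z (Icc 0 T))
    (hwc : ContinuousOn w (Icc 0 T)) (hz : IsWeak p T G z₀ z) (hw : IsWeak p T H w₀ w) :
    IsWeak p T (G + c • H) (z₀ + c • w₀) (z + c • w) := by
  intro φ₁ φ₂ φ₃ h₁ h₂ h₃ h0 hπ t ht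
  have i₁ := intervalIntegrable_of_continuousOn_Icc
    (continuousOn_weak_integrand (p := p) hG hzc φ₁ φ₂ φ₃) ht
  have i₂ := intervalIntegrable_of_continuousOn_Icc
    (continuousOn_weak_integrand (p := p) hH hwc φ₁ φ₂ φ₃) ht
  have i₃ : IntervalIntegrable
      (fun s => c • (testGen p φ₁ φ₂ φ₃ (w s) + testFun φ₁ φ₂ φ₃ (H s))) volume 0 t := i₂.smul c
  simp only [Pi.add_apply, Pi.smul_apply, map_add, map_smul]
  rw [hz φ₁ φ₂ φ₃ h₁ h₂ h₃ h0 hπ t ht, hw φ₁ φ₂ φ₃ h₁ h₂ h₃ h0 hπ t ht, smul_add,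
    ← intervalIntegral.integral_smul, add_add_add_comm,
    ← intervalIntegral.integral_add i₁ i₃]
  congr 2
  ext s
  simp only [smul_eq_mul]
  ring

theorem IsWeak.unique {p : Params} {T : ℝ} {G z w : ℝ → State} {z₀ : State} (hG : Continuous G)
    (hzc : ContinuousOn z (Icc 0 T)) (hwc : ContinuousOn w (Icc 0 T)) (hz : IsWeak p T G z₀ z)
    (hw : IsWeak p T G z₀ w) : ∀ t ∈ Icc 0 T, z t = w t := by
  intro t ht
  have h := hz.add_smul (-1) hG hG hzc hwc hw
  have h1 : z₀ + (-1 : ℂ) • z₀ = 0 := by simp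
  have h2 : G + (-1 : ℂ) • G = 0 := by simp
  rw [h1, h2] at h
  have := eq_zero_of_isWeak (hzc.add (hwc.const_smul (-1 : ℂ))) h t ht
  simpa [add_neg_eq_zero] using this

/-! ### Conservation of zero mean -/

theorem zero_coe_integral {O : Set ℝ} (φ : ℝ → ℂ) : ∫ x in O, (0 : L2On O) x * φ x = 0 := by
  rw [integral_eq_zero_of_ae]
  filter_upwards [Lp.coeFn_zero ℂ 2 (volume.restrict O)] with x hx
  rw [hx]
  simp

theorem zero_coe_integral' {O : Set ℝ} : ∫ x in O, (0 : L2On O) x = 0 := by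
  simpa using zero_coe_integral (O := O) fun _ => 1

theorem integral_eq_pairing_one (g : L2On I) : ∫ x in I, g x = pairing (fun _ => 1) g := by
  rw [pairing_apply continuous_const]; simp

theorem density_mem_L2m {p : Params} {T : ℝ} {O₁ O₂ O₃ : Set ℝ} {F : Control O₁ O₂ O₃}
    {z₀ : State} {z : ℝ → State} (h : IsSolution p T F z₀ z) (hF : F.f₁ = 0) (h0 : z₀.1 ∈ L2m) :
    ∀ t ∈ Icc 0 T, (z t).1 ∈ L2m := by
  intro t ht
  have := h.density (fun _ => 1) contDiff_const t ht
  have h0' : ∫ x in I, z₀.1 x = 0 := h0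
  simp only [hF, Pi.zero_apply, zero_coe_integral', deriv_const', mul_zero, integral_zero, mul_one,
    add_zero, intervalIntegral.integral_zero, h0'] at this
  exact this

/-- Tested against `1`, the equation says that the mean `m` of the stress satisfies `m' = -m/κ`, so
it stays zero if it starts at zero. -/
theorem stress_mem_L2m {p : Params} {T : ℝ} {O₁ O₂ O₃ : Set ℝ} {F : Control O₁ O₂ O₃}
    {z₀ : State} {z : ℝ → State} (h : IsSolution p T F z₀ z) (hF : F.f₃ = 0)
    (h0 : z₀.2.2 ∈ L2m) : ∀ t ∈ Icc 0 T, (z t).2.2 ∈ L2m := by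
  intro t ht
  have h0' : ∫ x in I, z₀.2.2 x = 0 := h0
  have hm : ∀ r ∈ Icc 0 T, pairing (fun _ => 1) (z r).2.2 =
      0 + ∫ s in (0 : ℝ)..r, -(1 / p.κ : ℂ) * pairing (fun _ => 1) (z s).2.2 := by
    intro r hr
    have := h.stress (fun _ => 1) contDiff_const r hr
    simp only [hF, Pi.zero_apply, zero_coe_integral', deriv_const', mul_zero, integral_zero,
      mul_one, add_zero, sub_zero, h0', integral_eq_pairing_one] at this
    simpa using this
  have hc : ContinuousOn (fun r => pairing (fun _ => 1) (z r).2.2) (Icc 0 T) :=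
    ((pairing _).continuous.comp (continuous_snd.comp continuous_snd)).comp_continuousOn
      h.continuousOn
  have := eqOn_zero_of_linear_ode (ContinuousLinearMap.mul ℝ ℂ (-(1 / p.κ : ℂ))) hc
    (fun r hr => hasDerivWithinAt_of_eq_integral (hc.const_mul _) hm hr)
    (by rw [hm 0 ⟨le_rfl, ht.1.trans ht.2⟩]; simp) t ht
  rw [← integral_eq_pairing_one] at this
  exact this

/-! ### The reachable set -/

/-- A class of controls that is closed under linear combinations. -/
structure IsLinearClass {O₁ O₂ O₃ : Set ℝ} (U : Set (Control O₁ O₂ O₃)) : Prop where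
  zero_mem : (⟨0, 0, 0⟩ : Control O₁ O₂ O₃) ∈ U
  add_smul_mem : ∀ F ∈ U, ∀ F' ∈ U, ∀ c : ℂ,
    (⟨F.f₁ + c • F'.f₁, F.f₂ + c • F'.f₂, F.f₃ + c • F'.f₃⟩ : Control O₁ O₂ O₃) ∈ U

theorem isLinearClass_density (O₁ O₂ O₃ : Set ℝ) : IsLinearClass (densityControls O₁ O₂ O₃) :=
  ⟨⟨rfl, rfl⟩, fun F hF F' hF' c => ⟨by simp [hF.1, hF'.1], by simp [hF.2, hF'.2]⟩⟩

theorem isLinearClass_velocity (O₁ O₂ O₃ : Set ℝ) : IsLinearClass (velocityControls O₁ O₂ O₃) :=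
  ⟨⟨rfl, rfl⟩, fun F hF F' hF' c => ⟨by simp [hF.1, hF'.1], by simp [hF.2, hF'.2]⟩⟩

theorem isLinearClass_stress (O₁ O₂ O₃ : Set ℝ) : IsLinearClass (stressControls O₁ O₂ O₃) :=
  ⟨⟨rfl, rfl⟩, fun F hF F' hF' c => ⟨by simp [hF.1, hF'.1], by simp [hF.2, hF'.2]⟩⟩

theorem integrable_mul_restrict {O : Set ℝ} (hO : MeasurableSet O) (hOI : O ⊆ I) (g : L2On O)
    {φ : ℝ → ℂ} (hφ : Continuous φ) : Integrable (fun x => g x * φ x) (volume.restrict O) :=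
  (Lp.memLp g).integrable_mul (memLp_of_continuous hφ O hO hOI)

theorem integral_add_smul_mul {O : Set ℝ} (hO : MeasurableSet O) (hOI : O ⊆ I) (g h : L2On O)
    (c : ℂ) {φ : ℝ → ℂ} (hφ : Continuous φ) :
    ∫ x in O, (g + c • h) x * φ x = (∫ x in O, g x * φ x) + c * ∫ x in O, h x * φ x := by
  rw [← integral_const_mul, ← integral_add (integrable_mul_restrict hO hOI g hφ)
    ((integrable_mul_restrict hO hOI h hφ).const_mul c)]
  refine integral_congr_ae ?_
  filter_upwards [Lp.coeFn_add g (c • h), Lp.coeFn_smul c h] with x h1 h2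
  rw [h1, Pi.add_apply, h2, Pi.smul_apply, smul_eq_mul]
  ring

/-- The states that can be reached from `0` at time `T` by controls of the class `U` that are
represented by a continuous forcing. -/
def reachable (p : Params) (T : ℝ) {O₁ O₂ O₃ : Set ℝ} (hO₁ : IsOpen O₁) (hO₂ : IsOpen O₂)
    (hO₃ : IsOpen O₃) (h₁ : O₁ ⊆ I) (h₂ : O₂ ⊆ I) (h₃ : O₃ ⊆ I) {U : Set (Control O₁ O₂ O₃)}
    (hU : IsLinearClass U) : Submodule ℂ State where
  carrier := {r | ∃ F ∈ U, F.SquareIntegrable T ∧ ∃ G, Continuous G ∧ Represents G F ∧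
    ∃ z, Continuous z ∧ z 0 = 0 ∧ IsWeak p T G 0 z ∧ z T = r}
  zero_mem' := by
    refine ⟨⟨0, 0, 0⟩, hU.zero_mem, ⟨MemLp.zero, MemLp.zero, MemLp.zero⟩, 0, continuous_zero,
      fun φ hφ s => ?_, 0, continuous_zero, rfl, ?_, rfl⟩
    · simp only [Pi.zero_apply, zero_coe_integral]
      simp
    · intro φ₁ φ₂ φ₃ _ _ _ _ _ t _
      simp
  add_mem' := by
    rintro r r' ⟨F, hF, hFs, G, hG, hGF, z, hz, hz0, hzw, rfl⟩
      ⟨F', hF', hFs', G', hG', hGF', z', hz', hz0', hzw', rfl⟩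
    refine ⟨_, hU.add_smul_mem F hF F' hF' 1, ⟨hFs.1.add (hFs'.1.const_smul _),
      hFs.2.1.add (hFs'.2.1.const_smul _), hFs.2.2.add (hFs'.2.2.const_smul _)⟩,
      G + (1 : ℂ) • G', hG.add (hG'.const_smul _), fun φ hφ s => ⟨?_, ?_, ?_⟩, z + (1 : ℂ) • z',
      hz.add (hz'.const_smul _), by simp [hz0, hz0'], ?_, by simp⟩
    · simp only [Pi.add_apply, Pi.smul_apply]
      rw [integral_add_smul_mul hO₁.measurableSet h₁ _ _ _ hφ, (hGF φ hφ s).1, (hGF' φ hφ s).1]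
      simp
    · simp only [Pi.add_apply, Pi.smul_apply]
      rw [integral_add_smul_mul hO₂.measurableSet h₂ _ _ _ hφ, (hGF φ hφ s).2.1,
        (hGF' φ hφ s).2.1]
      simp
    · simp only [Pi.add_apply, Pi.smul_apply]
      rw [integral_add_smul_mul hO₃.measurableSet h₃ _ _ _ hφ, (hGF φ hφ s).2.2,
        (hGF' φ hφ s).2.2]
      simp
    · have := hzw.add_smul 1 hG hG' hz.continuousOn hz'.continuousOn hzw'
      simpa using this
  smul_mem' := by
    rintro c r ⟨F, hF, hFs, G, hG, hGF, z, hz, hz0, hzw, rfl⟩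
    have hw0 : IsWeak p T 0 0 (0 : ℝ → State) := by
      intro φ₁ φ₂ φ₃ _ _ _ _ _ t _
      simp
    refine ⟨_, hU.add_smul_mem _ hU.zero_mem F hF c, ⟨MemLp.zero.add (hFs.1.const_smul _),
      MemLp.zero.add (hFs.2.1.const_smul _), MemLp.zero.add (hFs.2.2.const_smul _)⟩,
      0 + c • G, continuous_zero.add (hG.const_smul _), fun φ hφ s => ⟨?_, ?_, ?_⟩, 0 + c • z,
      continuous_zero.add (hz.const_smul _), by simp [hz0], ?_, by simp⟩
    · simp only [Pi.add_apply, Pi.smul_apply]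
      rw [integral_add_smul_mul hO₁.measurableSet h₁ _ _ _ hφ, (hGF φ hφ s).1, Pi.zero_apply,
        zero_coe_integral]
      simp
    · simp only [Pi.add_apply, Pi.smul_apply]
      rw [integral_add_smul_mul hO₂.measurableSet h₂ _ _ _ hφ, (hGF φ hφ s).2.1, Pi.zero_apply,
        zero_coe_integral]
      simp
    · simp only [Pi.add_apply, Pi.smul_apply]
      rw [integral_add_smul_mul hO₃.measurableSet h₃ _ _ _ hφ, (hGF φ hφ s).2.2, Pi.zero_apply,
        zero_coe_integral]
      simp
    · have := hw0.add_smul c continuous_zero hG continuousOn_const hz.continuousOn hzw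
      rwa [smul_zero, add_zero] at this

/-! ### Density of the reachable set implies approximate controllability -/

theorem l2Norm_le (z : State) : l2Norm z ≤ 2 * ‖z‖ := by
  have h1 : ‖z.1‖ ^ 2 ≤ ‖z‖ ^ 2 := by gcongr; exact norm_fst_le z
  have h2 : ‖z.2.1‖ ^ 2 ≤ ‖z‖ ^ 2 := by
    gcongr; exact (norm_fst_le z.2).trans (norm_snd_le z)
  have h3 : ‖z.2.2‖ ^ 2 ≤ ‖z‖ ^ 2 := by
    gcongr; exact (norm_snd_le z.2).trans (norm_snd_le z)
  refine Real.sqrt_le_iff.2 ⟨by positivity, ?_⟩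
  nlinarith [sq_nonneg ‖z‖]

/-- Hahn–Banach separation: a functional whose real part is bounded below on a subspace vanishes on
it. -/
theorem exists_dual_of_notMem_closure {E : Type*} [NormedAddCommGroup E] [NormedSpace ℂ E]
    (R : Submodule ℂ E) {x : E} (hx : x ∉ closure (R : Set E)) :
    ∃ f : E →L[ℂ] ℂ, (∀ r ∈ R, f r = 0) ∧ f x ≠ 0 := by
  let _ : NormedSpace ℝ E := NormedSpace.restrictScalars ℝ ℂ E
  have hconv : Convex ℝ (closure (R : Set E)) :=
    ((R.restrictScalars ℝ).convex).closure
  obtain ⟨f, u, hfx, hfu⟩ := RCLike.geometric_hahn_banach_point_closed (𝕜 := ℂ) hconv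
    isClosed_closure hx
  have hu : u < 0 := by
    have := hfu 0 (subset_closure R.zero_mem)
    simpa using this
  have hf0 : ∀ r ∈ R, f r = 0 := by
    intro r hr
    by_contra hne
    -- This multiple of `r` is sent by `f` to `u - 1`, below the bound `u`.
    have := hfu ((((u - 1 : ℝ) : ℂ) / f r) • r) (subset_closure (R.smul_mem _ hr))
    rw [map_smul, smul_eq_mul, div_mul_cancel₀ _ hne] at this
    have h2 : RCLike.re ((u - 1 : ℝ) : ℂ) = u - 1 := Complex.ofReal_re _
    rw [h2] at this
    linarith
  refine ⟨f, hf0, fun h => ?_⟩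
  rw [h] at hfx
  simp only [map_zero] at hfx
  linarith

theorem represents_zero {O₁ O₂ O₃ : Set ℝ} :
    Represents 0 (⟨0, 0, 0⟩ : Control O₁ O₂ O₃) := by
  intro φ _ s
  simp only [Pi.zero_apply, zero_coe_integral]
  simp

/-- By linearity every controlled solution is the free one `W` plus a solution starting from `0`, so
the second summand must approximate `zT - W T`. Invariance under the zero control puts this
difference in `X`, where `hdual` excludes a separating functional. -/
theorem approxControllable_of_reachable {p : Params} {T : ℝ} (hT : 0 < T) {O₁ O₂ O₃ : Set ℝ}
    (hO₁ : IsOpen O₁) (hO₂ : IsOpen O₂) (hO₃ : IsOpen O₃) (h₁ : O₁ ⊆ I) (h₂ : O₂ ⊆ I)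
    (h₃ : O₃ ⊆ I) {U : Set (Control O₁ O₂ O₃)} (hU : IsLinearClass U) (X : Set State)
    (hsub : ∀ x ∈ X, ∀ y ∈ X, x - y ∈ X)
    (hinv : ∀ F ∈ U, ∀ z₀ ∈ X, ∀ z, IsSolution p T F z₀ z → ∀ t ∈ Icc 0 T, z t ∈ X)
    (hdual : ∀ f : State →L[ℂ] ℂ,
      (∀ r ∈ reachable p T hO₁ hO₂ hO₃ h₁ h₂ h₃ hU, f r = 0) → ∀ x ∈ X, f x = 0) :
    ApproxControllable p T X U := by
  intro z₀ hz₀ zT hzT ε hε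
  have hTT : T ∈ Icc 0 T := ⟨hT.le, le_rfl⟩
  obtain ⟨W, hWc, hWs⟩ := exists_semigroup_orbit p z₀
  have hWw := isWeak_of_hasSum p T z₀ hWs
  have hW0 : W 0 = z₀ := by
    have h := hWs 0 le_rfl
    simp only [modeFlow_zero, one_apply_eq_self] at h
    exact h.unique (hasSum_inj_proj z₀)
  have hWT : W T ∈ X := hinv _ hU.zero_mem z₀ hz₀ W
    (isSolution_of_isWeak represents_zero hWc hW0 hWw) T hTT
  have hmem : zT - W T ∈ closure
      (reachable p T hO₁ hO₂ hO₃ h₁ h₂ h₃ hU : Set State) := by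
    by_contra hx
    obtain ⟨f, hf, hfx⟩ := exists_dual_of_notMem_closure _ hx
    exact hfx (hdual f hf _ (hsub _ hzT _ hWT))
  -- Precision `ε / 2` in the sup norm of the product absorbs the factor `2` of `l2Norm_le`.
  obtain ⟨r, ⟨F, hF, hFs, G, hG, hGF, z, hz, hz0, hzw, hzT'⟩, hr⟩ :=
    Metric.mem_closure_iff.1 hmem (ε / 2) (by positivity)
  have hsum : IsWeak p T G z₀ (W + z) := by
    have := hWw.add_smul 1 continuous_zero hG hWc.continuousOn hz.continuousOn hzw
    simpa using this
  refine ⟨F, hF, hFs, ⟨W + z, isSolution_of_isWeak hGF (hWc.add hz) (by simp [hW0, hz0]) hsum⟩,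
    fun w hw => ⟨hinv F hF z₀ hz₀ w hw, ?_⟩⟩
  have hwT : w T = W T + z T :=
    (isWeak_of_isSolution hGF hG hw).unique hG hw.continuousOn (hWc.add hz).continuousOn hsum T hTT
  rw [dist_eq_norm] at hr
  calc l2Norm (w T - zT) ≤ 2 * ‖w T - zT‖ := l2Norm_le _
    _ = 2 * ‖zT - W T - r‖ := by
        rw [hwT, hzT', ← norm_neg]
        congr 2
        abel
    _ < ε := by linarith

/-! ### Iterated time integrals -/

/-- The primitive vanishing at `0`. -/
def primitive {E : Type*} [NormedAddCommGroup E] [NormedSpace ℝ E] (y : ℝ → E) (t : ℝ) : E :=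
  ∫ s in (0 : ℝ)..t, y s

theorem hasDerivAt_primitive {E : Type*} [NormedAddCommGroup E] [NormedSpace ℝ E]
    [CompleteSpace E] {y : ℝ → E} (hy : Continuous y) (t : ℝ) :
    HasDerivAt (primitive y) (y t) t :=
  intervalIntegral.integral_hasDerivAt_right (hy.intervalIntegrable _ _)
    (hy.stronglyMeasurableAtFilter _ _) hy.continuousAt

theorem continuous_primitive_of_continuous {E : Type*} [NormedAddCommGroup E] [NormedSpace ℝ E]
    [CompleteSpace E] {y : ℝ → E} (hy : Continuous y) : Continuous (primitive y) :=
  continuous_iff_continuousAt.2 fun t => (hasDerivAt_primitive hy t).continuousAt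

theorem continuous_primitive_iterate {E : Type*} [NormedAddCommGroup E] [NormedSpace ℝ E]
    [CompleteSpace E] {y : ℝ → E} (hy : Continuous y) (k : ℕ) : Continuous (primitive^[k] y) := by
  induction k with
  | zero => exact hy
  | succ k ih =>
    rw [Function.iterate_succ_apply']
    exact continuous_primitive_of_continuous ih

theorem primitive_zero {E : Type*} [NormedAddCommGroup E] [NormedSpace ℝ E] (y : ℝ → E) :
    primitive y 0 = 0 := intervalIntegral.integral_same

theorem map_primitive {E : Type*} [NormedAddCommGroup E] [NormedSpace ℂ E] [NormedSpace ℝ E]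
    [CompleteSpace E] (f : E →L[ℂ] ℂ) {y : ℝ → E} (hy : Continuous y) (t : ℝ) :
    f (primitive y t) = primitive (fun s => f (y s)) t :=
  (f.intervalIntegral_comp_comm (hy.intervalIntegrable _ _)).symm

theorem map_primitive_iterate {E : Type*} [NormedAddCommGroup E] [NormedSpace ℂ E]
    [NormedSpace ℝ E] [CompleteSpace E] (f : E →L[ℂ] ℂ) {y : ℝ → E} (hy : Continuous y) (k : ℕ) :
    (fun t => f (primitive^[k] y t)) = primitive^[k] fun s => f (y s) := by
  induction k with
  | zero => rfl
  | succ k ih =>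
    rw [Function.iterate_succ_apply', Function.iterate_succ_apply', ← ih]
    ext t
    exact map_primitive f (continuous_primitive_iterate hy k) t

/-- Each integration by parts lowers the degree of `P` and raises `k`; the boundary term vanishes at
`T` by hypothesis and at `0` because primitives vanish there. -/
theorem integral_polynomial_mul_primitive_iterate_eq_zero {y : ℝ → ℂ} (hy : Continuous y) {T : ℝ}
    (h : ∀ k, primitive^[k + 1] y T = 0) (d : ℕ) :
    ∀ P : Polynomial ℝ, P.natDegree ≤ d → ∀ k,
      ∫ s in (0 : ℝ)..T, ((P.eval s : ℝ) : ℂ) * primitive^[k] y s = 0 := by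
  have hparts : ∀ (P : Polynomial ℝ) (k : ℕ),
      ∫ s in (0 : ℝ)..T, ((P.eval s : ℝ) : ℂ) * primitive^[k] y s =
        -∫ s in (0 : ℝ)..T, ((P.derivative.eval s : ℝ) : ℂ) * primitive^[k + 1] y s := by
    intro P k
    have := intervalIntegral.integral_mul_deriv_eq_deriv_mul (a := 0) (b := T)
      (u := fun s => ((P.eval s : ℝ) : ℂ)) (v := primitive^[k + 1] y)
      (u' := fun s => ((P.derivative.eval s : ℝ) : ℂ)) (v' := primitive^[k] y)
      (fun s _ => (P.hasDerivAt s).ofReal_comp)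
      (fun s _ => by
        rw [Function.iterate_succ_apply']
        exact hasDerivAt_primitive (continuous_primitive_iterate hy k) s)
      (by apply Continuous.intervalIntegrable; fun_prop)
      ((continuous_primitive_iterate hy k).intervalIntegrable _ _)
    rw [this, h k, Function.iterate_succ_apply', primitive_zero]
    simp
  induction d with
  | zero =>
    intro P hP k
    rw [hparts, Polynomial.derivative_of_natDegree_zero (Nat.le_zero.1 hP)]
    simp
  | succ d ih =>
    intro P hP k
    rw [hparts, ih P.derivative ((Polynomial.natDegree_derivative_le P).trans (by omega)), neg_zero]

theorem eqOn_zero_of_integral_polynomial_mul_real {u : ℝ → ℝ} (hu : Continuous u) {T : ℝ}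
    (hT : 0 < T) (h : ∀ P : Polynomial ℝ, ∫ s in (0 : ℝ)..T, P.eval s * u s = 0) :
    ∀ t ∈ Icc 0 T, u t = 0 := by
  set C := ∫ s in (0 : ℝ)..T, |u s| with hC
  have hC0 : 0 ≤ C := intervalIntegral.integral_nonneg hT.le fun _ _ => abs_nonneg _
  have h2 : ∫ s in (0 : ℝ)..T, u s * u s = 0 := by
    refine le_antisymm (le_of_forall_pos_le_add fun ε hε => ?_)
      (intervalIntegral.integral_nonneg hT.le fun _ _ => mul_self_nonneg _)
    obtain ⟨P, hP⟩ := exists_polynomial_near_of_continuousOn 0 T u hu.continuousOn (ε / (C + 1))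
      (by positivity)
    have hsub := intervalIntegral.integral_sub (a := 0) (b := T) (μ := volume)
      (f := fun s => u s * u s) (g := fun s => P.eval s * u s)
      (by apply Continuous.intervalIntegrable; fun_prop)
      (by apply Continuous.intervalIntegrable; fun_prop)
    rw [h P, sub_zero] at hsub
    rw [← hsub, zero_add]
    calc ∫ s in (0 : ℝ)..T, (u s * u s - P.eval s * u s)
        ≤ ∫ s in (0 : ℝ)..T, ε / (C + 1) * |u s| := by
          refine intervalIntegral.integral_mono_on hT.le
            (by apply Continuous.intervalIntegrable; fun_prop)
            (by apply Continuous.intervalIntegrable; fun_prop) fun s hs => ?_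
          rw [← sub_mul]
          refine (le_abs_self _).trans ?_
          rw [abs_mul, abs_sub_comm]
          exact mul_le_mul_of_nonneg_right (hP s hs).le (abs_nonneg _)
      _ = ε / (C + 1) * C := by rw [intervalIntegral.integral_const_mul]
      _ ≤ ε := by
          rw [div_mul_eq_mul_div, div_le_iff₀ (by positivity)]
          nlinarith
  rw [intervalIntegral.integral_eq_zero_iff_of_le_of_nonneg_ae hT.le
    (Filter.Eventually.of_forall fun s => mul_self_nonneg (u s))
    (by apply Continuous.intervalIntegrable; fun_prop)] at h2
  have h3 : (fun s => u s * u s) =ᵐ[volume.restrict (Icc 0 T)] fun _ => 0 := by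
    rw [← restrict_Ioc_eq_restrict_Icc]
    exact h2
  have h4 := Measure.eqOn_Icc_of_ae_eq volume hT.ne h3 (by fun_prop) continuousOn_const
  intro t ht
  exact mul_self_eq_zero.1 (h4 ht)

theorem eqOn_zero_of_primitive_iterate_eq_zero {y : ℝ → ℂ} (hy : Continuous y) {T : ℝ}
    (hT : 0 < T) (h : ∀ k, primitive^[k + 1] y T = 0) : ∀ t ∈ Icc 0 T, y t = 0 := by
  have key : ∀ P : Polynomial ℝ, ∫ s in (0 : ℝ)..T, ((P.eval s : ℝ) : ℂ) * y s = 0 := fun P =>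
    integral_polynomial_mul_primitive_iterate_eq_zero hy h _ P le_rfl 0
  have hre : ∀ t ∈ Icc 0 T, (y t).re = 0 := by
    refine eqOn_zero_of_integral_polynomial_mul_real (by fun_prop) hT fun P => ?_
    have h1 := congrArg Complex.reCLM (key P)
    rw [← Complex.reCLM.intervalIntegral_comp_comm
      (by apply Continuous.intervalIntegrable; fun_prop)] at h1
    simpa using h1
  have him : ∀ t ∈ Icc 0 T, (y t).im = 0 := by
    refine eqOn_zero_of_integral_polynomial_mul_real (by fun_prop) hT fun P => ?_
    have h1 := congrArg Complex.imCLM (key P)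
    rw [← Complex.imCLM.intervalIntegral_comp_comm
      (by apply Continuous.intervalIntegrable; fun_prop)] at h1
    simpa using h1
  exact fun t ht => Complex.ext (hre t ht) (him t ht)

/-! ### Solutions driven by a fixed profile -/

/-- Integrating the equations in time turns the initial state into a forcing: the primitive starts
at `0` and is driven by `z₀ + ∫ G`. -/
theorem IsWeak.primitive {p : Params} {T : ℝ} {G z : ℝ → State} {z₀ : State} (hG : Continuous G)
    (hz : Continuous z) (h : IsWeak p T G z₀ z) :
    IsWeak p T (fun t => z₀ + primitive G t) 0 (primitive z) := by
  intro φ₁ φ₂ φ₃ h₁ h₂ h₃ h0 hπ t ht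
  rw [map_primitive _ hz, map_zero, zero_add, MaxwellNS.primitive]
  refine intervalIntegral.integral_congr fun s hs => ?_
  rw [uIcc_of_le ht.1] at hs
  have hs' : s ∈ Icc 0 T := ⟨hs.1, hs.2.trans ht.2⟩
  have hadd := intervalIntegral.integral_add
    (((testGen p φ₁ φ₂ φ₃).continuous.comp hz).intervalIntegrable (μ := volume) 0 s)
    (((testFun φ₁ φ₂ φ₃).continuous.comp hG).intervalIntegrable 0 s)
  simp only [Function.comp_apply] at hadd
  simp only
  rw [h φ₁ φ₂ φ₃ h₁ h₂ h₃ h0 hπ s hs', map_add, map_primitive _ hz, map_primitive _ hG,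
    MaxwellNS.primitive, MaxwellNS.primitive, hadd]
  ring

/-- Here `θ t = t ^ k / k!`. Every iterated primitive of a free orbit is thus a solution from rest
whose forcing keeps the fixed spatial profile `w`. -/
theorem IsWeak.primitive_iterate {p : Params} {T : ℝ} {w : State} {W : ℝ → State}
    (hW : Continuous W) (h : IsWeak p T 0 w W) (k : ℕ) :
    ∃ θ : ℝ → ℂ, Continuous θ ∧
      IsWeak p T (fun t => θ t • w) 0 (MaxwellNS.primitive^[k + 1] W) := by
  induction k with
  | zero =>
    refine ⟨fun _ => 1, continuous_const, ?_⟩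
    have := h.primitive continuous_zero hW
    have e : (fun t => w + MaxwellNS.primitive (0 : ℝ → State) t) = fun _ => (1 : ℂ) • w := by
      ext1 t; simp [MaxwellNS.primitive]
    rw [e] at this
    exact this
  | succ k ih =>
    obtain ⟨θ, hθ, hk⟩ := ih
    refine ⟨MaxwellNS.primitive θ, continuous_primitive_of_continuous hθ, ?_⟩
    have := hk.primitive (by fun_prop) (continuous_primitive_iterate hW (k + 1))
    have e : (fun t => (0 : State) + MaxwellNS.primitive (fun t => θ t • w) t) =
        fun t => MaxwellNS.primitive θ t • w := by
      ext1 t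
      rw [zero_add, MaxwellNS.primitive, MaxwellNS.primitive, intervalIntegral.integral_smul_const]
    rw [e] at this
    rw [Function.iterate_succ_apply']
    exact this

/-- The profile `w` is available to the class `U`: the forcings `θ(t) w` represent controls. -/
def IsProfile (T : ℝ) {O₁ O₂ O₃ : Set ℝ} (U : Set (Control O₁ O₂ O₃)) (w : State) : Prop :=
  ∀ θ : ℝ → ℂ, Continuous θ → ∃ F ∈ U, F.SquareIntegrable T ∧ Represents (fun t => θ t • w) F

/-- The iterated primitives of `W` at time `T` are reachable, so `f` kills them all. These values
are the moments of `f ∘ W` on `[0, T]`, which therefore vanishes there. -/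
theorem dual_orbit_eq_zero {p : Params} {T : ℝ} (hT : 0 < T) {O₁ O₂ O₃ : Set ℝ}
    {hO₁ : IsOpen O₁} {hO₂ : IsOpen O₂} {hO₃ : IsOpen O₃} {h₁ : O₁ ⊆ I} {h₂ : O₂ ⊆ I}
    {h₃ : O₃ ⊆ I} {U : Set (Control O₁ O₂ O₃)} {hU : IsLinearClass U} {f : State →L[ℂ] ℂ}
    (hf : ∀ r ∈ reachable p T hO₁ hO₂ hO₃ h₁ h₂ h₃ hU, f r = 0) {w : State}
    (hw : IsProfile T U w) :
    ∀ t ∈ Icc 0 T, HasSum (fun n => f (inj n (modeFlow p n t (proj n w)))) 0 := by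
  obtain ⟨W, hWc, hWs⟩ := exists_semigroup_orbit p w
  have hWw := isWeak_of_hasSum p T w hWs
  have hzero : ∀ t ∈ Icc 0 T, f (W t) = 0 := by
    refine eqOn_zero_of_primitive_iterate_eq_zero (f.continuous.comp hWc) hT fun k => ?_
    have e := congrFun (map_primitive_iterate f hWc (k + 1)) T
    refine e.symm.trans (hf _ ?_)
    obtain ⟨θ, hθ, hk⟩ := hWw.primitive_iterate hWc k
    obtain ⟨F, hF, hFs, hFr⟩ := hw θ hθ
    refine ⟨F, hF, hFs, _, by fun_prop, hFr, _, continuous_primitive_iterate hWc (k + 1), ?_, hk,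
      rfl⟩
    rw [Function.iterate_succ_apply', primitive_zero]
  intro t ht
  rw [← hzero t ht]
  exact f.hasSum (hWs t ht.1)

/-- The class in `L²(O)` of a continuous function. -/
def toL2On {φ : ℝ → ℂ} (hφ : Continuous φ) {O : Set ℝ} (hO : IsOpen O) (hOI : O ⊆ I) : L2On O :=
  (memLp_of_continuous hφ O hO.measurableSet hOI).toLp φ

theorem memLp_smul_const {E : Type*} [NormedAddCommGroup E] [NormedSpace ℂ E] {θ : ℝ → ℂ}
    (hθ : Continuous θ) (g : E) (T : ℝ) :
    MemLp (fun t => θ t • g) 2 (volume.restrict (Ioo 0 T)) := by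
  obtain ⟨C, hC⟩ := (isCompact_Icc (a := (0 : ℝ)) (b := T)).exists_bound_of_continuousOn
    (f := fun t => θ t • g) (by fun_prop)
  refine MemLp.of_bound ((Continuous.smul hθ continuous_const).aestronglyMeasurable) C ?_
  filter_upwards [ae_restrict_mem measurableSet_Ioo] with x hx
  exact hC x (Ioo_subset_Icc_self hx)

theorem integral_smul_toL2On {φ ψ : ℝ → ℂ} (hφ : Continuous φ) (hψ : Continuous ψ) {O : Set ℝ}
    (hO : IsOpen O) (hOI : O ⊆ I) (hsupp : ∀ x ∈ I, x ∉ O → φ x = 0) (c : ℂ) :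
    ∫ x in O, (c • toL2On hφ hO hOI) x * ψ x = pairing ψ (c • toL2 φ) := by
  rw [map_smul, pairing_toL2 hψ hφ]
  have h1 : ∫ x in O, (c • toL2On hφ hO hOI) x * ψ x = ∫ x in O, c * (φ x * ψ x) := by
    refine integral_congr_ae ?_
    filter_upwards [Lp.coeFn_smul c (toL2On hφ hO hOI),
      (memLp_of_continuous hφ O hO.measurableSet hOI).coeFn_toLp] with x hx hx'
    rw [hx, Pi.smul_apply, toL2On, hx', smul_eq_mul, mul_assoc]
  rw [h1, integral_const_mul, smul_eq_mul, setIntegral_eq_of_subset_of_forall_sdiff_eq_zero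
    measurableSet_Ioo hOI]
  intro x hx
  rw [hsupp x hx.1 hx.2, zero_mul]

theorem isProfile_density {φ : ℝ → ℂ} (hφ : Continuous φ) (T : ℝ) {O₁ : Set ℝ} (O₂ O₃ : Set ℝ)
    (hO : IsOpen O₁) (hOI : O₁ ⊆ I) (hsupp : ∀ x ∈ I, x ∉ O₁ → φ x = 0) :
    IsProfile T (densityControls O₁ O₂ O₃) (toL2 φ, 0, 0) := by
  intro θ hθ
  refine ⟨⟨fun t => θ t • toL2On hφ hO hOI, 0, 0⟩, ⟨rfl, rfl⟩,
    ⟨memLp_smul_const hθ _ T, MemLp.zero, MemLp.zero⟩, fun ψ hψ s => ⟨?_, ?_, ?_⟩⟩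
  · exact integral_smul_toL2On hφ hψ hO hOI hsupp _
  · simp only [Pi.zero_apply, zero_coe_integral]; simp
  · simp only [Pi.zero_apply, zero_coe_integral]; simp

theorem isProfile_velocity {φ : ℝ → ℂ} (hφ : Continuous φ) (T : ℝ) {O₂ : Set ℝ} (O₁ O₃ : Set ℝ)
    (hO : IsOpen O₂) (hOI : O₂ ⊆ I) (hsupp : ∀ x ∈ I, x ∉ O₂ → φ x = 0) :
    IsProfile T (velocityControls O₁ O₂ O₃) (0, toL2 φ, 0) := by
  intro θ hθ
  refine ⟨⟨0, fun t => θ t • toL2On hφ hO hOI, 0⟩, ⟨rfl, rfl⟩,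
    ⟨MemLp.zero, memLp_smul_const hθ _ T, MemLp.zero⟩, fun ψ hψ s => ⟨?_, ?_, ?_⟩⟩
  · simp only [Pi.zero_apply, zero_coe_integral]; simp
  · exact integral_smul_toL2On hφ hψ hO hOI hsupp _
  · simp only [Pi.zero_apply, zero_coe_integral]; simp

theorem isProfile_stress {φ : ℝ → ℂ} (hφ : Continuous φ) (T : ℝ) {O₃ : Set ℝ} (O₁ O₂ : Set ℝ)
    (hO : IsOpen O₃) (hOI : O₃ ⊆ I) (hsupp : ∀ x ∈ I, x ∉ O₃ → φ x = 0) :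
    IsProfile T (stressControls O₁ O₂ O₃) (0, 0, toL2 φ) := by
  intro θ hθ
  refine ⟨⟨0, 0, fun t => θ t • toL2On hφ hO hOI⟩, ⟨rfl, rfl⟩,
    ⟨MemLp.zero, MemLp.zero, memLp_smul_const hθ _ T⟩, fun ψ hψ s => ⟨?_, ?_, ?_⟩⟩
  · simp only [Pi.zero_apply, zero_coe_integral]; simp
  · simp only [Pi.zero_apply, zero_coe_integral]; simp
  · exact integral_smul_toL2On hφ hψ hO hOI hsupp _

/-! ### Perturbed harmonic exponentials -/

theorem summable_inv_sq_int : Summable fun j : ℤ => ((j : ℝ) ^ 2)⁻¹ := by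
  simpa using Real.summable_one_div_int_pow.2 (by norm_num : 1 < 2)

theorem exists_tail_inv_sq_le {δ : ℝ} (hδ : 0 < δ) :
    ∃ N : ℕ, 1 ≤ N ∧ ∀ M : ℕ, N ≤ M →
      ∑' j : ℤ, (if (M : ℤ) < |j| then ((j : ℝ) ^ 2)⁻¹ else 0) ≤ δ := by
  have h : Filter.Tendsto
      (fun M : ℕ => ∑' j : ℤ, (if (M : ℤ) < |j| then ((j : ℝ) ^ 2)⁻¹ else 0))
      Filter.atTop (nhds (∑' _ : ℤ, (0 : ℝ))) := by
    refine tendsto_tsum_of_dominated_convergence summable_inv_sq_int (fun j => ?_)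
      (Filter.Eventually.of_forall fun M j => ?_)
    · refine tendsto_const_nhds.congr' ?_
      filter_upwards [Filter.eventually_ge_atTop j.natAbs] with M hM
      rw [if_neg]
      rw [Int.abs_eq_natAbs]
      omega
    · split_ifs
      · rw [Real.norm_eq_abs, abs_of_nonneg (by positivity)]
      · simp; positivity
  rw [tsum_zero] at h
  obtain ⟨N, hN⟩ := Filter.eventually_atTop.1 (h.eventually (ge_mem_nhds hδ))
  exact ⟨max N 1, le_max_right _ _, fun M hM => hN M ((le_max_left _ _).trans hM)⟩

theorem integral_exp_mul {z : ℂ} (hz : z ≠ 0) (τ : ℝ) :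
    ∫ t in (0 : ℝ)..τ, Complex.exp (z * t) = (Complex.exp (z * τ) - 1) / z := by
  rw [integral_exp_mul_complex hz]
  simp

/-- The matrix of the perturbed exponentials in the basis of harmonic ones is close to the
identity. -/
theorem norm_integral_perturbed_exp_le {c : ℝ} (hc : 0 < c) {ε : ℂ} (h1 : ‖ε‖ ≤ c / 2)
    (h2 : ‖ε‖ * (2 * Real.pi / c) ≤ 1) (k : ℤ) (hk : k ≠ 0) :
    ‖∫ t in (0 : ℝ)..(2 * Real.pi / c), Complex.exp ((Complex.I * c * k + ε) * t)‖ ≤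
      (2 * Real.pi / c) * (4 / c * (‖ε‖ / |(k : ℝ)|)) := by
  set τ := 2 * Real.pi / c with hτ
  have hτ0 : 0 < τ := by have := Real.pi_pos; positivity
  have hk1 : (1 : ℝ) ≤ |(k : ℝ)| := by exact_mod_cast Int.one_le_abs hk
  have hn : ‖Complex.I * c * k‖ = c * |(k : ℝ)| := by
    simp [abs_of_pos hc]
  have hlow : c * |(k : ℝ)| / 2 ≤ ‖Complex.I * c * k + ε‖ := by
    have := norm_sub_le (Complex.I * c * k + ε) ε
    rw [add_sub_cancel_right, hn] at this
    nlinarith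
  have hpos : 0 < c * |(k : ℝ)| / 2 := by positivity
  have hne : Complex.I * c * k + ε ≠ 0 := norm_pos_iff.1 (hpos.trans_le hlow)
  rw [integral_exp_mul hne, norm_div]
  -- The harmonic factor has period `τ`, so only the perturbation survives at the endpoint and the
  -- numerator is `O(‖ε‖)`.
  have he : Complex.exp ((Complex.I * c * k + ε) * τ) = Complex.exp (ε * τ) := by
    rw [add_mul, Complex.exp_add]
    have : Complex.I * c * k * (τ : ℂ) = k * (2 * Real.pi * Complex.I) := by
      rw [hτ]
      have : (c : ℂ) ≠ 0 := by exact_mod_cast hc.ne'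
      push_cast
      field_simp
    rw [this, Complex.exp_int_mul_two_pi_mul_I, one_mul]
  rw [he]
  have hετ : ‖ε * τ‖ = ‖ε‖ * τ := by
    rw [norm_mul, Complex.norm_real, Real.norm_eq_abs, abs_of_pos hτ0]
  have h3 : ‖Complex.exp (ε * τ) - 1‖ ≤ 2 * (‖ε‖ * τ) := by
    rw [← hετ]
    exact Complex.norm_exp_sub_one_le (by rw [hετ]; exact h2)
  calc ‖Complex.exp (ε * τ) - 1‖ / ‖Complex.I * c * k + ε‖
      ≤ 2 * (‖ε‖ * τ) / (c * |(k : ℝ)| / 2) := by gcongr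
    _ = _ := by field_simp; ring

theorem norm_integral_perturbed_exp_sub_le {c : ℝ} (hc : 0 < c) {ε : ℂ}
    (h2 : ‖ε‖ * (2 * Real.pi / c) ≤ 1) :
    ‖(∫ t in (0 : ℝ)..(2 * Real.pi / c), Complex.exp (ε * t)) - (2 * Real.pi / c : ℝ)‖ ≤
      (2 * Real.pi / c) * (2 * (‖ε‖ * (2 * Real.pi / c))) := by
  set τ := 2 * Real.pi / c with hτ
  have hτ0 : 0 < τ := by have := Real.pi_pos; positivity
  have h1 : ((τ : ℝ) : ℂ) = ∫ t in (0 : ℝ)..τ, (1 : ℂ) := by simp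
  rw [h1, ← intervalIntegral.integral_sub (by apply Continuous.intervalIntegrable; fun_prop)
    (by apply Continuous.intervalIntegrable; fun_prop)]
  have := intervalIntegral.norm_integral_le_of_norm_le_const (a := 0) (b := τ)
    (f := fun t : ℝ => Complex.exp (ε * t) - 1) (C := 2 * (‖ε‖ * τ)) (fun t ht => by
      rw [uIoc_of_le hτ0.le] at ht
      have hεt : ‖ε * t‖ ≤ ‖ε‖ * τ := by
        rw [norm_mul, Complex.norm_real, Real.norm_eq_abs, abs_of_pos ht.1]
        gcongr
        exact ht.2
      exact (Complex.norm_exp_sub_one_le (hεt.trans h2)).trans (by gcongr))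
  rw [sub_zero, abs_of_pos hτ0] at this
  linarith

/-- Summable bounds for the rows of the matrix of perturbed exponentials. -/
def rieszWeight (κ θ : ℝ) (N : ℕ) (m j : ℤ) : ℝ :=
  (if j = m then 1 / 4 else 0) +
    κ * (θ * (if (N : ℤ) < |j| then ((j : ℝ) ^ 2)⁻¹ else 0) + θ⁻¹ * (((j - m : ℤ) : ℝ) ^ 2)⁻¹)

theorem rieszWeight_nonneg {κ θ : ℝ} (hκ : 0 ≤ κ) (hθ : 0 < θ) (N : ℕ) (m j : ℤ) :
    0 ≤ rieszWeight κ θ N m j := by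
  have h1 : (0 : ℝ) ≤ if j = m then 1 / 4 else 0 := by split_ifs <;> norm_num
  have h2 : (0 : ℝ) ≤ if (N : ℤ) < |j| then ((j : ℝ) ^ 2)⁻¹ else 0 := by
    split_ifs <;> positivity
  rw [rieszWeight]
  positivity

/-- An off-diagonal entry is `O(1 / (|j| |j - m|))`. The inequality `2 x y ≤ θ x² + θ⁻¹ y²` splits
it into a part with small tail in `j` and a part depending on `j - m` only, made small by taking `θ`
large. -/
theorem norm_integral_perturbed_exp_sub_le_rieszWeight {c K θ : ℝ} (hc : 0 < c) (hK : 0 ≤ K)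
    (hθ : 0 < θ) {N : ℕ} {m j : ℤ} {ε : ℂ} (hj : (N : ℤ) < |j|) (hε : ‖ε‖ ≤ K / |(j : ℝ)|)
    (hε1 : ‖ε‖ ≤ c / 2) (hε2 : ‖ε‖ * (2 * Real.pi / c) ≤ 1 / 8) :
    ‖(∫ t in (0 : ℝ)..(2 * Real.pi / c),
        Complex.exp ((Complex.I * c * (j - m : ℤ) + ε) * t)) -
          if j = m then ((2 * Real.pi / c : ℝ) : ℂ) else 0‖ ≤
      (2 * Real.pi / c) * rieszWeight (2 * K / c) θ N m j := by
  have hτ0 : 0 < 2 * Real.pi / c := by have := Real.pi_pos; positivity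
  have hκ0 : 0 ≤ 2 * K / c := by positivity
  by_cases hjm : j = m
  · subst hjm
    have h4 := norm_integral_perturbed_exp_sub_le hc (hε2.trans (by norm_num))
    simp only [if_true, sub_self, Int.cast_zero, mul_zero, zero_add]
    refine h4.trans ?_
    gcongr
    have h5 : 2 * (‖ε‖ * (2 * Real.pi / c)) ≤ 1 / 4 := by linarith
    refine h5.trans ?_
    simp only [rieszWeight, if_true, hj]
    have : 0 ≤ 2 * K / c * (θ * ((j : ℝ) ^ 2)⁻¹ + θ⁻¹ * (((j - j : ℤ) : ℝ) ^ 2)⁻¹) := by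
      positivity
    linarith
  · have hjm' : j - m ≠ 0 := sub_ne_zero.2 hjm
    have h4 := norm_integral_perturbed_exp_le hc hε1 (hε2.trans (by norm_num)) (j - m) hjm'
    simp only [hjm, if_false, sub_zero]
    refine h4.trans ?_
    gcongr
    simp only [rieszWeight, hjm, hj, if_true, if_false, zero_add]
    have hj0 : (0 : ℝ) < |(j : ℝ)| := by
      have : 0 < |j| := by omega
      exact_mod_cast this
    have hjm0 : (0 : ℝ) < |((j - m : ℤ) : ℝ)| := by
      have : 0 < |j - m| := abs_pos.2 hjm'
      exact_mod_cast this
    have hx : ((j : ℝ) ^ 2)⁻¹ = (|(j : ℝ)|⁻¹) ^ 2 := by rw [inv_pow, sq_abs]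
    have hy : (((j - m : ℤ) : ℝ) ^ 2)⁻¹ = (|((j - m : ℤ) : ℝ)|⁻¹) ^ 2 := by rw [inv_pow, sq_abs]
    rw [hx, hy, div_eq_mul_inv ‖ε‖]
    rw [div_eq_mul_inv] at hε
    set x := |(j : ℝ)|⁻¹
    set y := |((j - m : ℤ) : ℝ)|⁻¹
    have hy0 : 0 < y := by positivity
    have hx0 : 0 < x := by positivity
    have h7 : θ * x ^ 2 + θ⁻¹ * y ^ 2 - 2 * (x * y) = θ⁻¹ * (θ * x - y) ^ 2 := by
      field_simp
      ring
    have h8 : 0 ≤ θ⁻¹ * (θ * x - y) ^ 2 := by positivity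
    calc 4 / c * (‖ε‖ * y) ≤ 4 / c * ((K * x) * y) := by gcongr
      _ = 2 * K / c * (2 * (x * y)) := by ring
      _ ≤ 2 * K / c * (θ * x ^ 2 + θ⁻¹ * y ^ 2) := by
        gcongr
        linarith

/-- This is the `m`-th Fourier coefficient of the perturbed series over an interval of length `τ`,
computed term by term. -/
theorem hasSum_integral_exp_series {c τ : ℝ} (hτ0 : 0 < τ) {ε b : ℤ → ℂ}
    (hε : ∀ j, b j ≠ 0 → ‖ε j‖ * τ ≤ 1) (hbs : Summable fun j => ‖b j‖) (m : ℤ) :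
    HasSum (fun j => b j * ∫ t in (0 : ℝ)..τ,
        Complex.exp ((Complex.I * c * (j - m : ℤ) + ε j) * t))
      (∫ t in (0 : ℝ)..τ, Complex.exp (-(Complex.I * c * m) * t) *
        ∑' j : ℤ, b j * Complex.exp ((Complex.I * c * j + ε j) * t)) := by
  have hbound : ∀ t ∈ Ioc 0 τ, ∀ j, ‖b j * Complex.exp ((Complex.I * c * j + ε j) * t)‖ ≤
      ‖b j‖ * Real.exp 1 := by
    intro t ht j
    by_cases hj : b j = 0
    · rw [hj]; simp
    rw [norm_mul, Complex.norm_exp]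
    gcongr
    have h8 : ((Complex.I * c * j + ε j) * t).re = (ε j).re * t := by
      simp
    rw [h8]
    calc (ε j).re * t ≤ ‖ε j‖ * τ := by
          refine mul_le_mul (Complex.re_le_norm _) ht.2 ht.1.le (norm_nonneg _)
      _ ≤ 1 := hε j hj
  have := intervalIntegral.hasSum_integral_of_dominated_convergence (μ := volume) (a := 0)
    (b := τ) (F := fun (j : ℤ) (t : ℝ) => Complex.exp (-(Complex.I * c * m) * t) *
      (b j * Complex.exp ((Complex.I * c * j + ε j) * t)))
    (f := fun t : ℝ => Complex.exp (-(Complex.I * c * m) * t) *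
      ∑' j : ℤ, b j * Complex.exp ((Complex.I * c * j + ε j) * t))
    (fun j _ => ‖b j‖ * Real.exp 1) (fun j => by
      apply Continuous.aestronglyMeasurable; fun_prop)
    (fun j => Filter.Eventually.of_forall fun t ht => by
      rw [uIoc_of_le hτ0.le] at ht
      rw [norm_mul, Complex.norm_exp]
      simpa using hbound t ht j)
    (Filter.Eventually.of_forall fun t ht => hbs.mul_right _) (by simp)
    (Filter.Eventually.of_forall fun t ht => by
      rw [uIoc_of_le hτ0.le] at ht
      exact (Summable.of_norm_bounded (hbs.mul_right _) (hbound t ht)).hasSum.mul_left _)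
  have e : (fun j => b j * ∫ t in (0 : ℝ)..τ,
      Complex.exp ((Complex.I * c * (j - m : ℤ) + ε j) * t)) = fun j => ∫ t in (0 : ℝ)..τ,
        Complex.exp (-(Complex.I * c * m) * t) *
          (b j * Complex.exp ((Complex.I * c * j + ε j) * t)) := by
    ext1 j
    rw [← intervalIntegral.integral_const_mul]
    refine intervalIntegral.integral_congr fun t _ => ?_
    rw [mul_left_comm, ← Complex.exp_add]
    congr 2
    push_cast
    ring
  rw [e]
  exact this

/-- A Riesz-type estimate: the coefficients of a series of slightly perturbed high-frequency
harmonic exponentials are bounded by its supremum over one period. -/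
theorem exists_norm_coeff_le {c K : ℝ} (hc : 0 < c) (hK : 0 ≤ K) :
    ∃ N₀ : ℕ, ∀ N : ℕ, N₀ ≤ N → ∀ ε b : ℤ → ℂ,
      (∀ j : ℤ, (N : ℤ) < |j| → ‖ε j‖ ≤ K / |(j : ℝ)|) → (∀ j : ℤ, |j| ≤ (N : ℤ) → b j = 0) →
      Summable (fun j => ‖b j‖) → ∀ S : ℝ,
      (∀ t ∈ Ioc 0 (2 * Real.pi / c),
        ‖∑' j : ℤ, b j * Complex.exp ((Complex.I * c * j + ε j) * t)‖ ≤ S) →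
      ∀ m, ‖b m‖ ≤ 2 * S := by
  set τ := 2 * Real.pi / c with hτ
  have hτ0 : 0 < τ := by have := Real.pi_pos; positivity
  set Z := ∑' j : ℤ, ((j : ℝ) ^ 2)⁻¹ with hZ
  have hZ0 : 0 ≤ Z := tsum_nonneg fun j => by positivity
  set κ := 2 * K / c with hκ
  have hκ0 : 0 ≤ κ := by positivity
  -- `θ` makes the convolution part of a row sum at most `1/8`; the tail beyond `N₁` then does the
  -- same for the other part. With the diagonal `1/4`, every row sums to at most `1/2`.
  set θ := 8 * κ * Z + 1 with hθ
  have hθ0 : 0 < θ := by positivity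
  obtain ⟨N₁, hN₁, htail⟩ := exists_tail_inv_sq_le (δ := 1 / (8 * κ * θ + 1)) (by positivity)
  -- Beyond `N₂` the perturbations satisfy `‖ε j‖ ≤ c / 2` and `‖ε j‖ * τ ≤ 1 / 8`.
  obtain ⟨N₂, hN₂⟩ := exists_nat_ge (2 * K / c + 8 * K * τ)
  refine ⟨max N₁ N₂, fun N hN ε b hε hb hbs S hS => ?_⟩
  have hNN₁ : N₁ ≤ N := (le_max_left _ _).trans hN
  have hNN₂ : N₂ ≤ N := (le_max_right _ _).trans hN
  have hN0 : (0 : ℝ) < N := by exact_mod_cast (by omega : 0 < N)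
  have hNge : 2 * K / c + 8 * K * τ ≤ N := hN₂.trans (by exact_mod_cast hNN₂)
  have hεN : ∀ j : ℤ, (N : ℤ) < |j| → ‖ε j‖ ≤ K / N := by
    intro j hj
    refine (hε j hj).trans ?_
    gcongr
    exact_mod_cast hj.le
  have hp1 : 0 ≤ 2 * K / c := by positivity
  have hp2 : 0 ≤ 8 * K * τ := by positivity
  have hε1 : ∀ j : ℤ, (N : ℤ) < |j| → ‖ε j‖ ≤ c / 2 := by
    intro j hj
    refine (hεN j hj).trans ?_
    rw [div_le_iff₀ hN0]
    have : 2 * K / c ≤ N := by linarith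
    rw [div_le_iff₀ hc] at this
    linarith
  have hε2 : ∀ j : ℤ, (N : ℤ) < |j| → ‖ε j‖ * τ ≤ 1 / 8 := by
    intro j hj
    have h1 : ‖ε j‖ * τ ≤ K / N * τ := by gcongr; exact hεN j hj
    refine h1.trans ?_
    rw [div_mul_eq_mul_div, div_le_iff₀ hN0]
    linarith
  have hS0 : 0 ≤ S := (norm_nonneg _).trans (hS τ ⟨hτ0, le_rfl⟩)
  have hbdd : BddAbove (range fun j => ‖b j‖) := by
    refine ⟨∑' j, ‖b j‖, ?_⟩
    rintro _ ⟨j, rfl⟩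
    exact hbs.le_tsum j fun i _ => norm_nonneg _
  set B := ⨆ j, ‖b j‖ with hB
  have hbB : ∀ j, ‖b j‖ ≤ B := fun j => le_ciSup hbdd j
  have hB0 : 0 ≤ B := (norm_nonneg _).trans (hbB 0)
  -- Absorption: the supremum `B` of the coefficients is finite, and `B ≤ S + B / 2` gives `B ≤ 2
  -- S`.
  suffices hmain : ∀ m, ‖b m‖ ≤ S + B / 2 by
    have : B ≤ S + B / 2 := ciSup_le hmain
    intro m
    linarith [hbB m]
  intro m
  by_cases hm : |m| ≤ (N : ℤ)
  · rw [hb m hm, norm_zero]; positivity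
  push Not at hm
  set w : ℤ → ℝ := fun j => rieszWeight κ θ N m j with hw'
  have hsu : Summable fun j : ℤ => if (N : ℤ) < |j| then ((j : ℝ) ^ 2)⁻¹ else 0 := by
    refine Summable.of_nonneg_of_le (fun j => ?_) (fun j => ?_) summable_inv_sq_int
    · split_ifs <;> positivity
    · split_ifs
      · exact le_rfl
      · positivity
  have hsq : HasSum (fun j : ℤ => (((j - m : ℤ) : ℝ) ^ 2)⁻¹) Z :=
    (Equiv.subRight m).hasSum_iff.2 summable_inv_sq_int.hasSum
  have hw : ∃ s ≤ (1 / 2 : ℝ), HasSum w s := by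
    refine ⟨_, ?_, (hasSum_ite_eq m (1 / 4 : ℝ)).add
      (((hsu.hasSum.mul_left θ).add (hsq.mul_left θ⁻¹)).mul_left κ)⟩
    have h1 := htail N hNN₁
    have h2 : κ * (θ * (∑' j : ℤ, if (N : ℤ) < |j| then ((j : ℝ) ^ 2)⁻¹ else 0)) ≤ 1 / 8 := by
      calc _ ≤ κ * (θ * (1 / (8 * κ * θ + 1))) := by gcongr
        _ = κ * θ / (8 * κ * θ + 1) := by ring
        _ ≤ 1 / 8 := by
          rw [div_le_iff₀ (by positivity)]
          linarith
    have h3 : κ * (θ⁻¹ * Z) ≤ 1 / 8 := by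
      have : κ * (θ⁻¹ * Z) = κ * Z / θ := by field_simp
      rw [this, div_le_iff₀ hθ0, hθ]
      linarith
    linarith
  obtain ⟨s, hs, hws⟩ := hw
  set J : ℤ → ℂ := fun j => ∫ t in (0 : ℝ)..τ,
    Complex.exp ((Complex.I * c * (j - m : ℤ) + ε j) * t) with hJdef
  have hJ : ∀ j, ‖b j * (J j - if j = m then (τ : ℂ) else 0)‖ ≤ B * (τ * w j) := by
    intro j
    have hw0 : 0 ≤ w j := rieszWeight_nonneg hκ0 hθ0 N m j
    by_cases hj : |j| ≤ (N : ℤ)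
    · rw [hb j hj, zero_mul, norm_zero]; positivity
    push Not at hj
    rw [norm_mul]
    exact mul_le_mul (hbB j) (norm_integral_perturbed_exp_sub_le_rieszWeight hc hK hθ0 hj
      (hε j hj) (hε1 j hj) (hε2 j hj)) (norm_nonneg _) hB0
  have hF := hasSum_integral_exp_series (c := c) hτ0 (fun j hj => by
    refine (hε2 j ?_).trans (by norm_num)
    by_contra hcon
    exact hj (hb j (not_lt.1 hcon))) hbs m
  have hFn : ‖∫ t in (0 : ℝ)..τ, Complex.exp (-(Complex.I * c * m) * t) *
      ∑' j : ℤ, b j * Complex.exp ((Complex.I * c * j + ε j) * t)‖ ≤ S * τ := by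
    have := intervalIntegral.norm_integral_le_of_norm_le_const (a := 0) (b := τ)
      (f := fun t : ℝ => Complex.exp (-(Complex.I * c * m) * t) *
        ∑' j : ℤ, b j * Complex.exp ((Complex.I * c * j + ε j) * t)) (C := S) (fun t ht => by
        rw [uIoc_of_le hτ0.le] at ht
        rw [norm_mul, Complex.norm_exp]
        simpa using hS t ht)
    rwa [sub_zero, abs_of_pos hτ0] at this
  have hdiff : HasSum (fun j => b j * (J j - if j = m then (τ : ℂ) else 0))
      ((∫ t in (0 : ℝ)..τ, Complex.exp (-(Complex.I * c * m) * t) *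
        ∑' j : ℤ, b j * Complex.exp ((Complex.I * c * j + ε j) * t)) - b m * τ) := by
    have e : (fun j => b j * (J j - if j = m then (τ : ℂ) else 0)) =
        fun j => b j * J j - if j = m then b m * (τ : ℂ) else 0 := by
      ext1 j
      split_ifs with hj
      · rw [hj]; ring
      · ring
    rw [e]
    exact hF.sub (hasSum_ite_eq m (b m * (τ : ℂ)))
  have hle : ‖(∫ t in (0 : ℝ)..τ, Complex.exp (-(Complex.I * c * m) * t) *
        ∑' j : ℤ, b j * Complex.exp ((Complex.I * c * j + ε j) * t)) - b m * τ‖ ≤ B * (τ * s) :=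
    hdiff.norm_le_of_bounded ((hws.mul_left τ).mul_left B) hJ
  have hfin : ‖b m‖ * τ ≤ S * τ + B * (τ * s) := by
    have h9 : ‖b m * (τ : ℂ)‖ = ‖b m‖ * τ := by
      rw [norm_mul, Complex.norm_real, Real.norm_eq_abs, abs_of_pos hτ0]
    rw [← h9]
    have := norm_sub_norm_le (b m * (τ : ℂ)) (∫ t in (0 : ℝ)..τ,
      Complex.exp (-(Complex.I * c * m) * t) *
        ∑' j : ℤ, b j * Complex.exp ((Complex.I * c * j + ε j) * t))
    rw [norm_sub_rev] at this
    linarith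
  have h10 : B * (τ * s) ≤ B / 2 * τ := by
    have : B * τ * s ≤ B * τ * (1 / 2) := by gcongr
    linarith
  have : ‖b m‖ * τ ≤ (S + B / 2) * τ := by linarith
  exact le_of_mul_le_mul_right this hτ0

/-! ### Exponential series -/

/-- Termwise differentiation, legitimate because the coefficients decay faster than any power of the
exponents. Real parts are controlled only where `a j ≠ 0`, as the low exponents carry no
information. -/
theorem hasDerivAt_tsum_exp {α : Type*} {a z : α → ℂ} {R : ℝ} (hR : ∀ j, a j ≠ 0 → (z j).re ≤ R)
    (hs : ∀ k : ℕ, Summable fun j => ‖a j‖ * ‖z j‖ ^ k) (k : ℕ) {t : ℝ} (ht : 0 < t) :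
    HasDerivAt (fun t : ℝ => ∑' j, a j * z j ^ k * Complex.exp (z j * t))
      (∑' j, a j * z j ^ (k + 1) * Complex.exp (z j * t)) t := by
  have hb : ∀ (k : ℕ) (j : α) (y : ℝ), y ∈ Ioo 0 (t + 1) →
      ‖a j * z j ^ k * Complex.exp (z j * y)‖ ≤
        ‖a j‖ * ‖z j‖ ^ k * Real.exp (|R| * (t + 1)) := by
    intro k j y hy
    rcases eq_or_ne (a j) 0 with h | h
    · simp [h]
    rw [norm_mul, norm_mul, norm_pow, Complex.norm_exp]
    gcongr
    rw [Complex.re_mul_ofReal]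
    calc (z j).re * y ≤ |R| * y := by
          have := hy.1.le
          gcongr
          exact (hR j h).trans (le_abs_self R)
      _ ≤ |R| * (t + 1) := by
          gcongr
          exact hy.2.le
  refine hasDerivAt_tsum_of_isPreconnected (t := Ioo 0 (t + 1)) (y₀ := t)
    (g := fun j (t : ℝ) => a j * z j ^ k * Complex.exp (z j * t))
    (g' := fun j (t : ℝ) => a j * z j ^ (k + 1) * Complex.exp (z j * t))
    ((hs (k + 1)).mul_right (Real.exp (|R| * (t + 1)))) isOpen_Ioo isPreconnected_Ioo
    (fun j y hy => ?_) (hb (k + 1)) ⟨ht, by linarith⟩ ?_ ⟨ht, by linarith⟩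
  · have h1 : HasDerivAt (fun y : ℝ => z j * (y : ℂ)) (z j) y := by
      simpa using (Complex.ofRealCLM.hasDerivAt (x := y)).const_mul (z j)
    refine (h1.cexp.const_mul (a j * z j ^ k)).congr_deriv ?_
    ring
  · exact Summable.of_norm_bounded ((hs k).mul_right (Real.exp (|R| * (t + 1))))
      fun j => hb k j t ⟨ht, by linarith⟩

/-- Divide the `k`-th moment by `x n ^ k`, where `x n` is the largest value still present. As `k →
∞` all other terms tend to `0` and `D n` remains. -/
theorem eq_zero_of_moments_eq_zero {N : ℕ} {D : ℕ → ℂ} {x : ℕ → ℝ} (hD : Summable fun n => ‖D n‖)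
    (hD0 : ∀ n ≤ N, D n = 0) (hx : ∀ n, N < n → 0 < x n)
    (hanti : ∀ m n, N < m → m < n → x n < x m) (h : ∀ k : ℕ, ∑' n, D n * (x n : ℂ) ^ k = 0) :
    ∀ n, D n = 0 := by
  intro n
  induction n using Nat.strong_induction_on with
  | _ n ih =>
    rcases le_or_gt n N with hn | hn
    · exact hD0 n hn
    have hxn := hx n hn
    have hratio : ∀ j, N < j → n ≤ j → 0 ≤ x j / x n ∧ x j / x n ≤ 1 := by
      intro j hj hnj
      refine ⟨(div_pos (hx j hj) hxn).le, (div_le_one hxn).2 ?_⟩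
      rcases hnj.eq_or_lt with rfl | h
      · exact le_rfl
      · exact (hanti n j hn h).le
    have hlim : Filter.Tendsto (fun k : ℕ => ∑' j, D j * ((x j / x n : ℝ) : ℂ) ^ k) Filter.atTop
        (nhds (∑' j, if j = n then D n else 0)) := by
      refine tendsto_tsum_of_dominated_convergence hD (fun j => ?_)
        (Filter.Eventually.of_forall fun k j => ?_)
      · rcases lt_trichotomy j n with hj | rfl | hj
        · simp [ih j hj, hj.ne]
        · simp [div_self hxn.ne']
        · have hr := hratio j (hn.trans hj) hj.le
          have h1 : x j / x n < 1 := (div_lt_one hxn).2 (hanti n j hn hj)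
          have h2 : ‖((x j / x n : ℝ) : ℂ)‖ < 1 := by
            rw [Complex.norm_real, Real.norm_eq_abs, abs_of_nonneg hr.1]
            exact h1
          simpa [hj.ne'] using (tendsto_pow_atTop_nhds_zero_of_norm_lt_one h2).const_mul (D j)
      · rcases lt_or_ge j n with hj | hj
        · simp [ih j hj]
        · have hr := hratio j (hn.trans_le hj) hj
          rw [norm_mul, norm_pow, Complex.norm_real, Real.norm_eq_abs, abs_of_nonneg hr.1]
          exact mul_le_of_le_one_right (norm_nonneg _) (pow_le_one₀ hr.1 hr.2)
    have hzero : ∀ k : ℕ, ∑' j, D j * ((x j / x n : ℝ) : ℂ) ^ k = 0 := by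
      intro k
      have : ∀ j, D j * ((x j / x n : ℝ) : ℂ) ^ k = (D j * (x j : ℂ) ^ k) * ((x n : ℂ) ^ k)⁻¹ := by
        intro j
        push_cast
        rw [div_pow, div_eq_mul_inv, mul_assoc]
      simp_rw [this]
      rw [tsum_mul_right, h k, zero_mul]
    simp_rw [hzero] at hlim
    have := tendsto_nhds_unique hlim tendsto_const_nhds
    rwa [tsum_ite_eq] at this

/-- Uniqueness for the sum of a series of perturbed high-frequency harmonic exponentials and of a
series of real exponentials whose exponents decrease to `0`. -/
theorem exists_exp_series_unique {c K : ℝ} (hc : 0 < c) (hK : 0 ≤ K) :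
    ∃ N₀ : ℕ, ∀ N : ℕ, N₀ ≤ N → ∀ (β : ℝ) (ε a : ℤ → ℂ) (x : ℕ → ℝ) (d : ℕ → ℂ) (T : ℝ),
      2 * Real.pi / c < T →
      (∀ j : ℤ, (N : ℤ) < |j| → ‖ε j‖ ≤ K / |(j : ℝ)|) →
      (∀ j : ℤ, (N : ℤ) < |j| → 1 ≤ ‖(β + Complex.I * c * j + ε j : ℂ)‖) →
      (∀ n, N < n → 0 < x n) → (∀ n, N < n → x n ≤ 1 / 2) →
      (∀ m n, N < m → m < n → x n < x m) →
      (∀ j : ℤ, |j| ≤ (N : ℤ) → a j = 0) → (∀ n ≤ N, d n = 0) →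
      (∀ k : ℕ, Summable fun j => ‖a j‖ * ‖(β + Complex.I * c * j + ε j : ℂ)‖ ^ k) →
      Summable (fun n => ‖d n‖) →
      (∀ t ∈ Ioo 0 T, ∑' j, a j * Complex.exp ((β + Complex.I * c * j + ε j) * t) +
        ∑' n, d n * Complex.exp (-(x n : ℂ) * t) = 0) →
      (∀ j, a j = 0) ∧ ∀ n, d n = 0 := by
  obtain ⟨N₀, hN₀⟩ := exists_norm_coeff_le hc hK
  refine ⟨max N₀ 1, fun N hN β ε a x d T hT hε hζ hx hx2 hanti ha hd has hds hsum => ?_⟩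
  have hN1 : 1 ≤ N := (le_max_right _ _).trans hN
  set τ := 2 * Real.pi / c with hτ
  have hτ0 : 0 < τ := by have := Real.pi_pos; positivity
  set ζ : ℤ → ℂ := fun j => β + Complex.I * c * j + ε j with hζdef
  set ξ : ℕ → ℂ := fun n => -(x n : ℂ) with hξ
  have hds' : ∀ k : ℕ, ∀ n, ‖d n‖ * ‖ξ n‖ ^ k ≤ ‖d n‖ * (1 / 2) ^ k := by
    intro k n
    rcases le_or_gt n N with hn | hn
    · simp [hd n hn]
    · gcongr
      rw [hξ, norm_neg, Complex.norm_real, Real.norm_eq_abs, abs_of_pos (hx n hn)]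
      exact hx2 n hn
  have hdsum : ∀ k : ℕ, Summable fun n => ‖d n‖ * ‖ξ n‖ ^ k := fun k =>
    Summable.of_nonneg_of_le (fun n => by positivity) (hds' k) (hds.mul_right _)
  -- Differentiating the identity `k` times multiplies each coefficient by the `k`-th power of its
  -- exponent.
  have hall : ∀ k : ℕ, ∀ t ∈ Ioo 0 T, ∑' j, a j * ζ j ^ k * Complex.exp (ζ j * t) +
      ∑' n, d n * ξ n ^ k * Complex.exp (ξ n * t) = 0 := by
    intro k
    induction k with
    | zero => 
      intro t ht
      simp only [pow_zero, mul_one]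
      exact hsum t ht
    | succ k ih =>
      intro t ht
      have h1 := hasDerivAt_tsum_exp (R := β + K) (a := a) (z := ζ) (fun j hj => by
        have hj' : (N : ℤ) < |j| := by
          by_contra hcon
          exact hj (ha j (not_lt.1 hcon))
        have h2 : (ζ j).re = β + (ε j).re := by simp [hζdef]
        rw [h2]
        have h3 : (1 : ℝ) ≤ |(j : ℝ)| := by
          have : 1 ≤ |j| := by omega
          exact_mod_cast this
        have h4 : K / |(j : ℝ)| ≤ K := div_le_self hK h3
        linarith [Complex.re_le_norm (ε j), hε j hj']) has k ht.1
      have h2 := hasDerivAt_tsum_exp (R := 0) (a := d) (z := ξ) (fun n hn => by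
        have hn' : N < n := by
          by_contra hcon
          exact hn (hd n (not_lt.1 hcon))
        simpa [hξ] using (hx n hn').le) hdsum k ht.1
      have h3 : HasDerivAt (fun _ : ℝ => (0 : ℂ)) _ t := (h1.add h2).congr_of_eventuallyEq (by
        filter_upwards [isOpen_Ioo.mem_nhds ht] with s hs
        exact (ih s hs).symm)
      exact h3.unique (hasDerivAt_const t 0)
  set D := ∑' n, ‖d n‖ with hD
  have hD0 : 0 ≤ D := tsum_nonneg fun n => norm_nonneg _
  have hRbound : ∀ k : ℕ, ∀ t ∈ Ioo 0 T,
      ‖∑' n, d n * ξ n ^ k * Complex.exp (ξ n * t)‖ ≤ D * (1 / 2) ^ k := by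
    intro k t ht
    refine tsum_of_norm_bounded (hds.hasSum.mul_right _) fun n => ?_
    refine le_trans ?_ (hds' k n)
    rw [norm_mul, norm_mul, norm_pow, Complex.norm_exp]
    rcases le_or_gt n N with hn | hn
    · simp [hd n hn]
    · refine mul_le_of_le_one_right (by positivity) (Real.exp_le_one_iff.2 ?_)
      rw [Complex.re_mul_ofReal]
      have h1 : (ξ n).re ≤ 0 := by simpa [hξ] using (hx n hn).le
      exact mul_nonpos_of_nonpos_of_nonneg h1 ht.1.le
  have ha0 : ∀ m, a m = 0 := by
    intro m
    by_cases hm : |m| ≤ (N : ℤ)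
    · exact ha m hm
    push Not at hm
    -- The `k`-th derivative of the oscillating part equals that of the real part up to sign, hence
    -- is `O(2⁻ᵏ)`. The Riesz-type bound, after removal of the factor `exp (β t)`, transfers this to
    -- `‖a m‖ * ‖ζ m‖ ^ k`, and `‖ζ m‖ ≥ 1`.
    have hest : ∀ k : ℕ, ‖a m‖ ≤ 2 * (Real.exp (|β| * τ) * D) * (1 / 2) ^ k := by
      intro k
      have hb := hN₀ N ((le_max_left _ _).trans hN) ε (fun j => a j * ζ j ^ k) hε
        (fun j hj => by simp [ha j hj]) (by simpa only [norm_mul, norm_pow] using has k)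
        (Real.exp (|β| * τ) * (D * (1 / 2) ^ k)) (fun t ht => by
          have htT : t ∈ Ioo 0 T := ⟨ht.1, ht.2.trans_lt hT⟩
          have h1 : ∑' j : ℤ, a j * ζ j ^ k * Complex.exp ((Complex.I * c * j + ε j) * t) =
              Complex.exp (-(β : ℂ) * t) *
                ∑' j, a j * ζ j ^ k * Complex.exp (ζ j * t) := by
            rw [← tsum_mul_left]
            congr 1
            ext j
            rw [mul_left_comm, ← Complex.exp_add]
            congr 2
            simp only [hζdef]
            ring
          rw [h1, eq_neg_of_add_eq_zero_left (hall k t htT), norm_mul, norm_neg, Complex.norm_exp]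
          have h2 : (-(β : ℂ) * t).re ≤ |β| * τ := by
            rw [Complex.re_mul_ofReal]
            simp only [Complex.neg_re, Complex.ofReal_re]
            calc -β * t ≤ |β| * t := mul_le_mul_of_nonneg_right (neg_le_abs β) ht.1.le
              _ ≤ |β| * τ := by
                gcongr
                exact ht.2
          gcongr
          exact hRbound k t htT) m
      rw [norm_mul, norm_pow] at hb
      have h3 : ‖a m‖ * 1 ≤ ‖a m‖ * ‖ζ m‖ ^ k := by
        gcongr
        exact one_le_pow₀ (hζ m hm)
      linarith
    have hlim : Filter.Tendsto (fun k : ℕ => 2 * (Real.exp (|β| * τ) * D) * (1 / 2 : ℝ) ^ k)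
        Filter.atTop (nhds 0) := by
      simpa using (tendsto_pow_atTop_nhds_zero_of_lt_one (by norm_num : (0 : ℝ) ≤ 1 / 2)
        (by norm_num)).const_mul (2 * (Real.exp (|β| * τ) * D))
    have := ge_of_tendsto' hlim hest
    exact norm_eq_zero.1 (le_antisymm this (norm_nonneg _))
  refine ⟨ha0, ?_⟩
  -- With the oscillating part gone, the derivatives at a single interior time are, up to sign, the
  -- moments of `d n * exp (ξ n * t₀)`.
  set t₀ := τ / 2 with ht₀
  have ht₀T : t₀ ∈ Ioo 0 T := ⟨by positivity, by linarith⟩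
  have hDz := eq_zero_of_moments_eq_zero (N := N) (D := fun n => d n * Complex.exp (ξ n * t₀))
    (x := x) (Summable.of_norm_bounded (hds.mul_right 1) fun n => by
      rw [norm_norm, norm_mul, Complex.norm_exp]
      rcases le_or_gt n N with hn | hn
      · simp [hd n hn]
      · gcongr
        refine Real.exp_le_one_iff.2 ?_
        rw [Complex.re_mul_ofReal]
        have h1 : (ξ n).re ≤ 0 := by simpa [hξ] using (hx n hn).le
        exact mul_nonpos_of_nonpos_of_nonneg h1 ht₀T.1.le)
    (fun n hn => by simp [hd n hn]) hx hanti (fun k => by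
      have h1 := hall k t₀ ht₀T
      simp only [ha0, zero_mul, tsum_zero, zero_add] at h1
      have h2 : ∀ n, d n * Complex.exp (ξ n * t₀) * (x n : ℂ) ^ k =
          (-1) ^ k * (d n * ξ n ^ k * Complex.exp (ξ n * t₀)) := by
        intro n
        have : (x n : ℂ) = -1 * ξ n := by simp [hξ]
        rw [this, mul_pow]
        ring
      simp_rw [h2]
      rw [tsum_mul_left, h1, mul_zero])
  intro n
  exact (mul_eq_zero.1 (hDz n)).resolve_right (Complex.exp_ne_zero _)

/-! ### Roots of the characteristic polynomials -/

/-- The roots of `r² (r + k) + c² n² (r + w)` for large `n`: a real root `-(w + xₙ)` with `xₙ`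
decreasing to `0`, and a pair of complex roots with imaginary parts `± νₙ`, `νₙ ≈ c n`. -/
theorem exists_cubic_roots {k w c : ℝ} (hw : 0 < w) (hwk : w < k) (hc : 0 < c) :
    ∃ N : ℕ, 1 ≤ N ∧ ∃ K : ℝ, 0 ≤ K ∧ ∃ x ν : ℕ → ℝ,
      (∀ n, N ≤ n → 0 < x n ∧ x n ≤ 1 / 2 ∧ x n ≤ K / n ∧ 1 ≤ ν n ∧ |ν n - c * n| ≤ K / n ∧
        (w + x n) ^ 2 * (k - w - x n) = c ^ 2 * n ^ 2 * x n ∧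
        ((k - w - x n) / 2) ^ 2 + ν n ^ 2 = c ^ 2 * n ^ 2 - (w + x n) * (k - w - x n)) ∧
      ∀ m n, N ≤ m → m < n → x n < x m := by
  have hk : 0 < k := hw.trans hwk
  -- The equation is the characteristic one at `r = -(w + x)`; its two sides change order between `x
  -- = 0` and `x = k - w`.
  have hroot : ∀ n : ℕ, 1 ≤ n → ∃ x : ℝ, 0 < x ∧ x < k - w ∧
      (w + x) ^ 2 * (k - w - x) = c ^ 2 * n ^ 2 * x := by
    intro n hn
    have hn0 : (0 : ℝ) < n := by exact_mod_cast hn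
    have hcont : ContinuousOn (fun x : ℝ => c ^ 2 * n ^ 2 * x - (w + x) ^ 2 * (k - w - x))
        (Icc 0 (k - w)) := by fun_prop
    have h0 : c ^ 2 * (n : ℝ) ^ 2 * 0 - (w + 0) ^ 2 * (k - w - 0) < 0 := by
      have : 0 < w ^ 2 * (k - w) := mul_pos (by positivity) (by linarith)
      linarith
    have h1 : 0 < c ^ 2 * (n : ℝ) ^ 2 * (k - w) - (w + (k - w)) ^ 2 * (k - w - (k - w)) := by
      have : 0 < c ^ 2 * (n : ℝ) ^ 2 * (k - w) := mul_pos (by positivity) (by linarith)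
      linarith
    obtain ⟨x, hx, hx0⟩ := intermediate_value_Ioo (by linarith) hcont ⟨h0, h1⟩
    exact ⟨x, hx.1, hx.2, by linarith⟩
  choose! x hx0 hx1 hx2 using hroot
  -- `M` bounds both the correction `P` to `c² n²` under the square root and the difference
  -- quotients of `x ↦ (w + x)² (k - w - x)` used for monotonicity. The condition `M + 1 ≤ c² n²`
  -- makes the imaginary part at least `1`.
  set M := 2 * k ^ 2 with hM
  set K := M / c + k ^ 3 / c ^ 2 with hK
  have hM0 : 0 ≤ M := by positivity
  have hK1 : 0 ≤ M / c := by positivity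
  have hK2 : 0 ≤ k ^ 3 / c ^ 2 := by positivity
  obtain ⟨N₁, hN₁⟩ := exists_nat_ge ((M + 1) / c ^ 2 + 2 * (k ^ 3 / c ^ 2))
  have hbig : ∀ n : ℕ, max N₁ 1 ≤ n → M + 1 ≤ c ^ 2 * n ^ 2 ∧ 2 * (k ^ 3 / c ^ 2) ≤ n := by
    intro n hn
    have h1 : (1 : ℝ) ≤ n := by exact_mod_cast (le_max_right _ _).trans hn
    have h2 : (N₁ : ℝ) ≤ n := by exact_mod_cast (le_max_left _ _).trans hn
    have h3 : 0 ≤ (M + 1) / c ^ 2 := by positivity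
    have h4 : (M + 1) / c ^ 2 ≤ n := by linarith
    rw [div_le_iff₀ (by positivity)] at h4
    have h5 : (n : ℝ) * c ^ 2 ≤ n ^ 2 * c ^ 2 := by
      gcongr
      nlinarith
    exact ⟨by linarith, by linarith⟩
  refine ⟨max N₁ 1, le_max_right _ _, K, by positivity, x,
    fun n => √(c ^ 2 * n ^ 2 - (w + x n) * (k - w - x n) - ((k - w - x n) / 2) ^ 2),
    fun n hn => ?_, fun m n hm hmn => ?_⟩
  · have hn1 : 1 ≤ n := (le_max_right _ _).trans hn
    have hn1' : (1 : ℝ) ≤ n := by exact_mod_cast hn1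
    have hn0 : (0 : ℝ) < n := by linarith
    have e0 := hx0 n hn1
    have e1 := hx1 n hn1
    have e2 := hx2 n hn1
    obtain ⟨b1, b2⟩ := hbig n hn
    have hx3 : x n ≤ k ^ 3 / c ^ 2 / n := by
      rw [div_div, le_div_iff₀ (by positivity)]
      have h1 : c ^ 2 * n ^ 2 * x n ≤ k ^ 3 := by
        rw [← e2]
        have h2 : (w + x n) ^ 2 ≤ k ^ 2 := by
          have : w + x n ≤ k := by linarith
          gcongr
        calc (w + x n) ^ 2 * (k - w - x n) ≤ k ^ 2 * k := by
              apply mul_le_mul h2 (by linarith) (by linarith) (by positivity)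
          _ = k ^ 3 := by ring
      have h3 : x n * (c ^ 2 * n) ≤ x n * (c ^ 2 * n ^ 2) := by
        gcongr
        nlinarith
      linarith
    have hP0 : 0 ≤ (w + x n) * (k - w - x n) + ((k - w - x n) / 2) ^ 2 :=
      add_nonneg (mul_nonneg (by linarith) (by linarith)) (sq_nonneg _)
    have hPM : (w + x n) * (k - w - x n) + ((k - w - x n) / 2) ^ 2 ≤ M := by
      have h1 : (w + x n) * (k - w - x n) ≤ k * k :=
        mul_le_mul (by linarith) (by linarith) (by linarith) hk.le
      have h2 : ((k - w - x n) / 2) ^ 2 ≤ k ^ 2 := by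
        have : (k - w - x n) / 2 ≤ k := by linarith
        have : 0 ≤ (k - w - x n) / 2 := by linarith
        gcongr
      rw [hM]
      linarith
    set P := (w + x n) * (k - w - x n) + ((k - w - x n) / 2) ^ 2 with hP
    have hrw : c ^ 2 * (n : ℝ) ^ 2 - (w + x n) * (k - w - x n) - ((k - w - x n) / 2) ^ 2 =
        c ^ 2 * n ^ 2 - P := by rw [hP]; ring
    simp only [hrw]
    have hsq := Real.sq_sqrt (show 0 ≤ c ^ 2 * (n : ℝ) ^ 2 - P by linarith)
    set v := √(c ^ 2 * (n : ℝ) ^ 2 - P) with hv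
    have hv0 : 0 ≤ v := Real.sqrt_nonneg _
    refine ⟨e0, ?_, ?_, ?_, ?_, e2, ?_⟩
    · refine hx3.trans ?_
      rw [div_le_iff₀ hn0]
      linarith
    · refine hx3.trans ?_
      gcongr
      linarith
    · nlinarith
    · have h1 : |v - c * n| * (v + c * n) = P := by
        have h2 : v - c * n ≤ 0 := by
          have : v ^ 2 ≤ (c * n) ^ 2 := by rw [hsq, mul_pow]; linarith
          have := abs_le_of_sq_le_sq this (by positivity)
          linarith [le_abs_self v]
        rw [abs_of_nonpos h2]
        linear_combination -hsq
      have h3 : |v - c * n| ≤ M / c / n := by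
        rw [div_div, le_div_iff₀ (by positivity)]
        have : |v - c * n| * (c * n) ≤ |v - c * n| * (v + c * n) := by
          gcongr
          linarith
        linarith
      refine h3.trans ?_
      gcongr
      linarith
    · rw [hsq, hP]; ring
  · have hm1 : 1 ≤ m := (le_max_right _ _).trans hm
    have hn1 : 1 ≤ n := hm1.trans hmn.le
    -- If `x m ≤ x n`, subtracting the two equations bounds `c² n² (x n - x m)` strictly by the
    -- increment of a function whose difference quotient is at most `M ≤ c² n²`.
    by_contra! hcon
    have hmn' : (m : ℝ) < n := by exact_mod_cast hmn
    have hm0 : (0 : ℝ) ≤ m := by positivity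
    obtain ⟨b1, -⟩ := hbig n (hm.trans hmn.le)
    have em0 := hx0 m hm1
    have em1 := hx1 m hm1
    have em2 := hx2 m hm1
    have en1 := hx1 n hn1
    have en2 := hx2 n hn1
    have h1 : c ^ 2 * m ^ 2 * x m < c ^ 2 * n ^ 2 * x m := by gcongr
    have h2 : (w + x m) ^ 2 * (k - w - x m) - (w + x n) ^ 2 * (k - w - x n) =
        (x n - x m) * ((w + x n) ^ 2 + (w + x n) * (w + x m) + (w + x m) ^ 2 -
          k * ((w + x n) + (w + x m))) := by ring
    have h3 : c ^ 2 * n ^ 2 * (x n - x m) <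
        (x n - x m) * -((w + x n) ^ 2 + (w + x n) * (w + x m) + (w + x m) ^ 2 -
          k * ((w + x n) + (w + x m))) := by linarith
    have h4 : -((w + x n) ^ 2 + (w + x n) * (w + x m) + (w + x m) ^ 2 -
          k * ((w + x n) + (w + x m))) ≤ c ^ 2 * n ^ 2 := by
      have h5 : k * ((w + x n) + (w + x m)) ≤ k * (k + k) := by
        gcongr <;> linarith
      have h6 : 0 ≤ (w + x n) * (w + x m) := by
        have := hx0 n hn1
        positivity
      rw [hM] at b1
      nlinarith [sq_nonneg (w + x n), sq_nonneg (w + x m)]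
    have h7 : (x n - x m) * -((w + x n) ^ 2 + (w + x n) * (w + x m) + (w + x m) ^ 2 -
          k * ((w + x n) + (w + x m))) ≤ (x n - x m) * (c ^ 2 * n ^ 2) :=
      mul_le_mul_of_nonneg_left h4 (by linarith)
    linarith

/-! ### Spectral expansion of the flow in one mode -/

/-- The unnormalized spectral projection for a cubic characteristic equation whose other two
roots are `r₂` and `r₃`. -/
def spectralVec {E : Type*} [NormedAddCommGroup E] [NormedSpace ℂ E] (A : E →L[ℂ] E)
    (r₂ r₃ : ℂ) (v : E) : E := A (A v) - (r₂ + r₃) • A v + (r₂ * r₃) • v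

/-- `spectralVec` is `(A - r₂)(A - r₃) v`, and applying `A - r₁` gives the characteristic polynomial
of `A` at `v`, which is zero. -/
theorem map_spectralVec {E : Type*} [NormedAddCommGroup E] [NormedSpace ℂ E] {A : E →L[ℂ] E}
    {r₁ r₂ r₃ : ℂ} {v : E}
    (hA : A (A (A v)) = (r₁ + r₂ + r₃) • A (A v) - (r₁ * r₂ + r₁ * r₃ + r₂ * r₃) • A v +
      (r₁ * r₂ * r₃) • v) :
    A (spectralVec A r₂ r₃ v) = r₁ • spectralVec A r₂ r₃ v := by
  simp only [spectralVec, map_add, map_sub, map_smul, hA]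
  module

theorem norm_spectralVec_le {E : Type*} [NormedAddCommGroup E] [NormedSpace ℂ E] {A : E →L[ℂ] E}
    {r₂ r₃ : ℂ} {R : ℝ} (hR : 0 ≤ R) (hA : ‖A‖ ≤ R) (h₂ : ‖r₂‖ ≤ R) (h₃ : ‖r₃‖ ≤ R) (v : E) :
    ‖spectralVec A r₂ r₃ v‖ ≤ 4 * R ^ 2 * ‖v‖ := by
  have h1 : ‖A v‖ ≤ R * ‖v‖ := (A.le_opNorm v).trans (by gcongr)
  have h2 : ‖A (A v)‖ ≤ R * (R * ‖v‖) := (A.le_opNorm _).trans (by gcongr)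
  have h3 : ‖(r₂ + r₃) • A v‖ ≤ (R + R) * (R * ‖v‖) := by
    rw [norm_smul]
    gcongr
    exact (norm_add_le _ _).trans (add_le_add h₂ h₃)
  have h4 : ‖(r₂ * r₃) • v‖ ≤ (R * R) * ‖v‖ := by
    rw [norm_smul, norm_mul]
    gcongr
  calc ‖spectralVec A r₂ r₃ v‖ ≤ ‖A (A v)‖ + ‖(r₂ + r₃) • A v‖ + ‖(r₂ * r₃) • v‖ :=
        (norm_add_le _ _).trans (by gcongr; exact norm_sub_le _ _)
    _ ≤ R * (R * ‖v‖) + (R + R) * (R * ‖v‖) + (R * R) * ‖v‖ := by gcongr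
    _ = 4 * R ^ 2 * ‖v‖ := by ring

/-- Lagrange interpolation of the constant polynomial `1` at the three roots. -/
theorem sum_spectralVec {E : Type*} [NormedAddCommGroup E] [NormedSpace ℂ E] (A : E →L[ℂ] E)
    {r₁ r₂ r₃ : ℂ} (h₁₂ : r₁ ≠ r₂) (h₁₃ : r₁ ≠ r₃) (h₂₃ : r₂ ≠ r₃) (v : E) :
    ((r₁ - r₂) * (r₁ - r₃))⁻¹ • spectralVec A r₂ r₃ v +
      ((r₂ - r₁) * (r₂ - r₃))⁻¹ • spectralVec A r₁ r₃ v +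
      ((r₃ - r₁) * (r₃ - r₂))⁻¹ • spectralVec A r₁ r₂ v = v := by
  have e₁ : r₁ - r₂ ≠ 0 := sub_ne_zero.2 h₁₂
  have e₂ : r₁ - r₃ ≠ 0 := sub_ne_zero.2 h₁₃
  have e₃ : r₂ - r₃ ≠ 0 := sub_ne_zero.2 h₂₃
  have e₁' : r₂ - r₁ = -(r₁ - r₂) := by ring
  have e₂' : r₃ - r₁ = -(r₁ - r₃) := by ring
  have e₃' : r₃ - r₂ = -(r₂ - r₃) := by ring
  simp only [spectralVec, e₁', e₂', e₃']
  match_scalars <;> field_simp <;> ring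

/-- Both sides solve the same linear ODE, since the spectral vectors are eigenvectors, and they
agree at `t = 0`. -/
theorem modeFlow_eq_spectral (p : Params) (n : ℕ) {r₁ r₂ r₃ : ℂ} (h₁₂ : r₁ ≠ r₂) (h₁₃ : r₁ ≠ r₃)
    (h₂₃ : r₂ ≠ r₃)
    (hA : ∀ v, modeGen p n (modeGen p n (modeGen p n v)) =
      (r₁ + r₂ + r₃) • modeGen p n (modeGen p n v) -
        (r₁ * r₂ + r₁ * r₃ + r₂ * r₃) • modeGen p n v + (r₁ * r₂ * r₃) • v)
    (v : Amp) {t : ℝ} (ht : 0 ≤ t) :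
    modeFlow p n t v =
      Complex.exp (r₁ * t) • ((r₁ - r₂) * (r₁ - r₃))⁻¹ • spectralVec (modeGen p n) r₂ r₃ v +
      Complex.exp (r₂ * t) • ((r₂ - r₁) * (r₂ - r₃))⁻¹ • spectralVec (modeGen p n) r₁ r₃ v +
      Complex.exp (r₃ * t) • ((r₃ - r₁) * (r₃ - r₂))⁻¹ • spectralVec (modeGen p n) r₁ r₂ v := by
  set A := modeGen p n with hAdef
  set P₁ := ((r₁ - r₂) * (r₁ - r₃))⁻¹ • spectralVec A r₂ r₃ v with hP₁
  set P₂ := ((r₂ - r₁) * (r₂ - r₃))⁻¹ • spectralVec A r₁ r₃ v with hP₂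
  set P₃ := ((r₃ - r₁) * (r₃ - r₂))⁻¹ • spectralVec A r₁ r₂ v with hP₃
  have a₁ : A P₁ = r₁ • P₁ := by rw [hP₁, map_smul, map_spectralVec (hA v), smul_comm]
  have a₂ : A P₂ = r₂ • P₂ := by
    rw [hP₂, map_smul, map_spectralVec (r₁ := r₂) (by rw [hA v]; module), smul_comm]
  have a₃ : A P₃ = r₃ • P₃ := by
    rw [hP₃, map_smul, map_spectralVec (r₁ := r₃) (by rw [hA v]; module), smul_comm]
  clear_value P₁ P₂ P₃
  have hexp : ∀ (r : ℂ) (P : Amp) (s : ℝ),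
      HasDerivAt (fun s : ℝ => Complex.exp (r * s) • P) ((Complex.exp (r * s) * r) • P) s := by
    intro r P s
    have h1 : HasDerivAt (fun y : ℝ => r * (y : ℂ)) r s := by
      simpa using (Complex.ofRealCLM.hasDerivAt (x := s)).const_mul r
    exact h1.cexp.smul_const P
  have hd : ∀ s : ℝ, HasDerivAt (fun s : ℝ => modeFlow p n s v - (Complex.exp (r₁ * s) • P₁ +
      Complex.exp (r₂ * s) • P₂ + Complex.exp (r₃ * s) • P₃))
      (A (modeFlow p n s v - (Complex.exp (r₁ * s) • P₁ +
      Complex.exp (r₂ * s) • P₂ + Complex.exp (r₃ * s) • P₃))) s := by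
    intro s
    refine ((hasDerivAt_modeFlow p n v s).sub
      (((hexp r₁ P₁ s).add (hexp r₂ P₂ s)).add (hexp r₃ P₃ s))).congr_deriv ?_
    rw [map_sub, map_add, map_add, map_smul, map_smul, map_smul, a₁, a₂, a₃, smul_smul, smul_smul,
      smul_smul]
  have := eqOn_zero_of_linear_ode (A.restrictScalars ℝ) (T := t)
    (fun s _ => (hd s).continuousAt.continuousWithinAt)
    (fun s _ => (hd s).hasDerivWithinAt) (by
      simp only [modeFlow_zero, Complex.ofReal_zero, mul_zero, Complex.exp_zero, one_smul]
      rw [hP₁, hP₂, hP₃, sum_spectralVec A h₁₂ h₁₃ h₂₃]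
      simp) t ⟨ht, le_rfl⟩
  exact sub_eq_zero.1 this

/-! ### The characteristic polynomial of the system -/

/-- The speed of propagation. -/
def Params.speed (p : Params) : ℝ := √(p.a * p.γ * p.ρs ^ (p.γ - 1) + p.μ / (p.κ * p.ρs))

/-- The limit of the real eigenvalues, up to sign. -/
def Params.limitRate (p : Params) : ℝ := p.b * p.ρs / p.κ / p.speed ^ 2

theorem Params.speed_sq (p : Params) : p.speed ^ 2 = p.b * p.ρs + p.μ / (p.κ * p.ρs) := by
  have hρ := p.ρs_pos
  have hμ := p.μ_pos
  have hκ := p.κ_pos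
  have hb := p.b_pos
  have h : p.a * p.γ * p.ρs ^ (p.γ - 1) = p.b * p.ρs := by
    rw [Params.b, show p.γ - 1 = (p.γ - 2) + 1 by ring, Real.rpow_add_one hρ.ne']
    ring
  rw [Params.speed, h, Real.sq_sqrt (by positivity)]

theorem Params.speed_pos (p : Params) : 0 < p.speed := by
  have hρ := p.ρs_pos
  have hμ := p.μ_pos
  have hκ := p.κ_pos
  have hb := p.b_pos
  have h : 0 < p.speed ^ 2 := by rw [p.speed_sq]; positivity
  have h0 : 0 ≤ p.speed := Real.sqrt_nonneg _
  exact lt_of_le_of_ne h0 fun h1 => by rw [← h1] at h; simp at h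

theorem Params.limitRate_pos (p : Params) : 0 < p.limitRate := by
  have hρ := p.ρs_pos
  have hκ := p.κ_pos
  have hb := p.b_pos
  have hs := p.speed_pos
  unfold Params.limitRate
  positivity

theorem Params.limitRate_lt (p : Params) : p.limitRate < 1 / p.κ := by
  have hρ := p.ρs_pos
  have hκ := p.κ_pos
  have hμ := p.μ_pos
  have hs := p.speed_pos
  rw [Params.limitRate, div_lt_iff₀ (by positivity), p.speed_sq]
  have : 0 < 1 / p.κ * (p.μ / (p.κ * p.ρs)) := by positivity
  have h2 : 1 / p.κ * (p.b * p.ρs + p.μ / (p.κ * p.ρs)) =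
    p.b * p.ρs / p.κ + 1 / p.κ * (p.μ / (p.κ * p.ρs)) := by ring
  linarith

theorem Params.speed_sq_mul_limitRate (p : Params) :
    p.speed ^ 2 * p.limitRate = p.b * p.ρs / p.κ := by
  have hs := p.speed_pos
  rw [Params.limitRate]
  field_simp

/-- Cayley–Hamilton, with characteristic polynomial `r² (r + 1/κ) + c² n² (r + w)`: the form treated
by `exists_cubic_roots`, with `k = 1/κ`. -/
theorem modeGen_cubed (p : Params) (n : ℕ) (v : Amp) :
    modeGen p n (modeGen p n (modeGen p n v)) =
      (-(1 / p.κ : ℝ) : ℂ) • modeGen p n (modeGen p n v) -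
        ((p.speed ^ 2 * n ^ 2 : ℝ) : ℂ) • modeGen p n v +
        (-(p.speed ^ 2 * n ^ 2 * p.limitRate : ℝ) : ℂ) • v := by
  have h1 : p.speed ^ 2 * n ^ 2 * p.limitRate = p.b * p.ρs / p.κ * n ^ 2 := by
    rw [← p.speed_sq_mul_limitRate]; ring
  have hρ : (p.ρs : ℂ) ≠ 0 := by exact_mod_cast p.ρs_pos.ne'
  have hκ : (p.κ : ℂ) ≠ 0 := by exact_mod_cast p.κ_pos.ne'
  rw [h1, p.speed_sq]
  push_cast
  refine Prod.ext ?_ (Prod.ext ?_ ?_) <;>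
  simp only [modeGen_apply, Prod.fst_add, Prod.snd_add, Prod.fst_sub, Prod.snd_sub, Prod.smul_fst,
    Prod.smul_snd, smul_eq_mul] <;>
  field_simp <;> ring

theorem exists_norm_modeGen_le (p : Params) :
    ∃ C : ℝ, 0 ≤ C ∧ ∀ n : ℕ, 1 ≤ n → ‖modeGen p n‖ ≤ C * n := by
  have hρ := p.ρs_pos
  have hμ := p.μ_pos
  have hκ := p.κ_pos
  have hb := p.b_pos
  have q1 : 0 < 1 / p.ρs := by positivity
  have q2 : 0 < 1 / p.κ := by positivity
  have q3 : 0 < p.μ / p.κ := by positivity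
  refine ⟨p.ρs + p.b + 1 / p.ρs + 1 / p.κ + p.μ / p.κ, by positivity, fun n hn => ?_⟩
  have hn' : (1 : ℝ) ≤ n := by exact_mod_cast hn
  refine ContinuousLinearMap.opNorm_le_bound _ (by positivity) fun v => ?_
  have v1 : ‖v.1‖ ≤ ‖v‖ := norm_fst_le v
  have v2 : ‖v.2.1‖ ≤ ‖v‖ := (norm_fst_le v.2).trans (norm_snd_le v)
  have v3 : ‖v.2.2‖ ≤ ‖v‖ := (norm_snd_le v.2).trans (norm_snd_le v)
  have n1 : ‖(1 / p.ρs : ℂ)‖ = 1 / p.ρs := by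
    rw [norm_div, norm_one, Complex.norm_real, Real.norm_eq_abs, abs_of_pos hρ]
  have n2 : ‖(1 / p.κ : ℂ)‖ = 1 / p.κ := by
    rw [norm_div, norm_one, Complex.norm_real, Real.norm_eq_abs, abs_of_pos hκ]
  have n3 : ‖(p.μ / p.κ : ℂ)‖ = p.μ / p.κ := by
    rw [norm_div, Complex.norm_real, Complex.norm_real, Real.norm_eq_abs, Real.norm_eq_abs,
      abs_of_pos hκ, abs_of_pos hμ]
  have t1 : p.ρs * n * ‖v.2.1‖ ≤ p.ρs * n * ‖v‖ := by gcongr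
  have t2 : p.b * n * ‖v.1‖ ≤ p.b * n * ‖v‖ := by gcongr
  have t3 : 1 / p.ρs * n * ‖v.2.2‖ ≤ 1 / p.ρs * n * ‖v‖ := by gcongr
  have t4 : 1 / p.κ * ‖v.2.2‖ ≤ 1 / p.κ * n * ‖v‖ := by
    gcongr
    nlinarith
  have t5 : p.μ / p.κ * n * ‖v.2.1‖ ≤ p.μ / p.κ * n * ‖v‖ := by gcongr
  have s1 : 0 ≤ p.ρs * n * ‖v‖ := by positivity
  have s2 : 0 ≤ p.b * n * ‖v‖ := by positivity
  have s3 : 0 ≤ 1 / p.ρs * n * ‖v‖ := by positivity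
  have s4 : 0 ≤ 1 / p.κ * n * ‖v‖ := by positivity
  have s5 : 0 ≤ p.μ / p.κ * n * ‖v‖ := by positivity
  have expand : (p.ρs + p.b + 1 / p.ρs + 1 / p.κ + p.μ / p.κ) * n * ‖v‖ = p.ρs * n * ‖v‖ +
    p.b * n * ‖v‖ + 1 / p.ρs * n * ‖v‖ + 1 / p.κ * n * ‖v‖ + p.μ / p.κ * n * ‖v‖ := by ring
  rw [expand, modeGen_apply, norm_prod_le_iff, norm_prod_le_iff]
  refine ⟨?_, ?_, ?_⟩
  · simp only [norm_neg, norm_mul, Complex.norm_real, Real.norm_eq_abs, abs_of_pos hρ,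
      Complex.norm_natCast]
    linarith
  · refine (norm_sub_le _ _).trans ?_
    simp only [norm_mul, Complex.norm_real, Real.norm_eq_abs, abs_of_pos hb, n1,
      Complex.norm_natCast]
    linarith
  · refine (norm_add_le _ _).trans ?_
    simp only [norm_mul, norm_neg, n2, n3, Complex.norm_natCast]
    linarith

/-- For large `n` the flow in the `n`-th mode is the superposition of two damped oscillations with
exponents `λₙ`, `λ₋ₙ`, close to `± i c n`, and of a real exponential with exponent `-(w + xₙ)`. -/
theorem exists_mode_expansion (p : Params) :
    ∃ N : ℕ, 1 ≤ N ∧ ∃ K : ℝ, 0 ≤ K ∧ ∃ R : ℝ, 0 ≤ R ∧ ∃ (x : ℕ → ℝ) (lam : ℤ → ℂ)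
      (P : ℤ → Amp → Amp) (P₀ : ℕ → Amp → Amp),
      (∀ n, N ≤ n → 0 < x n ∧ x n ≤ 1 / 2) ∧ (∀ m n, N ≤ m → m < n → x n < x m) ∧
      (∀ j : ℤ, N ≤ j.natAbs → 1 ≤ ‖lam j + p.limitRate‖ ∧
        ‖lam j + p.limitRate‖ ≤ R * j.natAbs ∧
        ‖lam j - (-((1 / p.κ - p.limitRate) / 2 : ℝ) + Complex.I * p.speed * j)‖ ≤
          K / |(j : ℝ)| ∧ ∀ v, ‖P j v‖ ≤ R * j.natAbs ^ 2 * ‖v‖) ∧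
      (∀ n v, N ≤ n → ‖P₀ n v‖ ≤ R * n ^ 2 * ‖v‖) ∧
      ∀ n v t, N ≤ n → 0 ≤ t → modeFlow p n t v =
        Complex.exp (lam n * t) • P n v + Complex.exp (lam (-n) * t) • P (-n) v +
          Complex.exp (-(p.limitRate + x n : ℝ) * t) • P₀ n v := by
  obtain ⟨N, hN1, K, hK, x, ν, hroots, hanti⟩ :=
    exists_cubic_roots p.limitRate_pos p.limitRate_lt p.speed_pos
  obtain ⟨C, hC, hgen⟩ := exists_norm_modeGen_le p
  set k := 1 / p.κ with hk
  set w := p.limitRate with hw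
  set c := p.speed with hc
  have hk0 : 0 < k := p.limitRate_pos.trans p.limitRate_lt
  have hw0 : 0 < w := p.limitRate_pos
  have hwk : w < k := p.limitRate_lt
  have hc0 : 0 < c := p.speed_pos
  -- The real part is forced by the trace: the three roots sum to `-k`, and the real one is `-(w +
  -- x)`. The sign of `j` selects the member of the conjugate pair.
  let lam : ℤ → ℂ := fun j =>
    ((-((k - w - x j.natAbs) / 2) : ℝ) : ℂ) + ((j.sign * ν j.natAbs : ℝ) : ℂ) * Complex.I
  let r : ℕ → ℂ := fun n => -((w + x n : ℝ) : ℂ)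
  set R₀ := k + c + K + w + 1 + C with hR₀
  have hR₀0 : 0 ≤ R₀ := by positivity
  have hre : ∀ j, (lam j).re = -((k - w - x j.natAbs) / 2) := fun j => by simp [lam]
  have him : ∀ j, (lam j).im = j.sign * ν j.natAbs := fun j => by simp [lam]
  have hsgn : ∀ j : ℤ, N ≤ j.natAbs → |(j.sign : ℝ)| = 1 := by
    intro j hj
    have : j ≠ 0 := by omega
    rcases lt_or_gt_of_ne this with h | h
    · rw [Int.sign_eq_neg_one_of_neg h]; simp
    · rw [Int.sign_eq_one_of_pos h]; simp
  have hsabs : ∀ j : ℤ, (j : ℝ) = j.sign * (j.natAbs : ℝ) := by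
    intro j
    have := congrArg (Int.cast : ℤ → ℝ) (Int.sign_mul_natAbs j)
    rw [Int.cast_mul, Int.cast_natCast] at this
    exact this.symm
  have hxlt : ∀ n, N ≤ n → x n < k - w := by
    intro n hn
    obtain ⟨h1, -, -, -, -, h2, -⟩ := hroots n hn
    have hn0 : (0 : ℝ) < n := by exact_mod_cast hN1.trans hn
    have h3 : 0 < c ^ 2 * n ^ 2 * x n := by positivity
    rw [← h2] at h3
    have := pos_of_mul_pos_right h3 (sq_nonneg _)
    linarith
  have hνn : ∀ n, N ≤ n → ν n ≤ (c + K) * n := by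
    intro n hn
    obtain ⟨-, -, -, -, h1, -, -⟩ := hroots n hn
    have hn1 : (1 : ℝ) ≤ n := by exact_mod_cast hN1.trans hn
    have h2 : K / n ≤ K := div_le_self hK hn1
    have h3 := (abs_le.1 h1).2
    nlinarith
  have hlamR : ∀ j : ℤ, N ≤ j.natAbs → ‖lam j‖ ≤ R₀ * j.natAbs := by
    intro j hj
    have hn1 : (1 : ℝ) ≤ j.natAbs := by exact_mod_cast hN1.trans hj
    have h1 := Complex.norm_le_abs_re_add_abs_im (lam j)
    have h2 := hroots _ hj
    have h3 := hxlt _ hj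
    rw [hre, him, abs_mul, hsgn j hj, one_mul, abs_neg, abs_of_nonneg (by linarith),
      abs_of_nonneg (by linarith)] at h1
    have h4 := hνn _ hj
    have h5 : (k - w - x j.natAbs) / 2 ≤ k := by linarith
    have h6 : k ≤ k * j.natAbs := by nlinarith
    have h7 : 0 ≤ (w + 1 + C) * j.natAbs := by positivity
    rw [hR₀]
    nlinarith
  have hrR : ∀ n, N ≤ n → ‖r n‖ ≤ R₀ * n := by
    intro n hn
    have hn1 : (1 : ℝ) ≤ n := by exact_mod_cast hN1.trans hn
    have h2 := hroots _ hn
    have h3 := hxlt _ hn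
    simp only [r]
    rw [norm_neg, Complex.norm_real, Real.norm_eq_abs, abs_of_nonneg (by linarith)]
    have h6 : k ≤ k * n := by nlinarith
    have h7 : 0 ≤ (c + K + w + 1 + C) * n := by positivity
    rw [hR₀]
    nlinarith
  have hgenR : ∀ n, N ≤ n → ‖modeGen p n‖ ≤ R₀ * n := by
    intro n hn
    refine (hgen n (hN1.trans hn)).trans ?_
    gcongr
    rw [hR₀]
    have : 0 ≤ k + c + K + w + 1 := by positivity
    linarith
  have hneg : ∀ j : ℤ, (-j).natAbs = j.natAbs := Int.natAbs_neg
  -- Since `ν ≥ 1`, distinct roots are at distance at least `1`, so the normalizing factors of the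
  -- spectral projections are at most `1`.
  have hlr : ∀ j : ℤ, N ≤ j.natAbs → 1 ≤ ‖lam j - r j.natAbs‖ := by
    intro j hj
    refine le_trans ?_ (Complex.abs_im_le_norm _)
    have : (lam j - r j.natAbs).im = j.sign * ν j.natAbs := by
      rw [Complex.sub_im, him]; simp [r]
    rw [this, abs_mul, hsgn j hj, one_mul]
    exact (hroots _ hj).2.2.2.1.trans (le_abs_self _)
  have hll : ∀ j : ℤ, N ≤ j.natAbs → 1 ≤ ‖lam j - lam (-j)‖ := by
    intro j hj
    refine le_trans ?_ (Complex.abs_im_le_norm _)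
    have : (lam j - lam (-j)).im = j.sign * (2 * ν j.natAbs) := by
      rw [Complex.sub_im, him, him, hneg, Int.sign_neg]; push_cast; ring
    rw [this, abs_mul, hsgn j hj, one_mul]
    have := (hroots _ hj).2.2.2.1
    rw [abs_of_nonneg (by linarith)]
    linarith
  refine ⟨N, hN1, 2 * K, by positivity, R₀ + w + 4 * R₀ ^ 2, by positivity, x, lam,
    fun j v => ((lam j - lam (-j)) * (lam j - r j.natAbs))⁻¹ •
      spectralVec (modeGen p j.natAbs) (lam (-j)) (r j.natAbs) v,
    fun n v => ((r n - lam n) * (r n - lam (-n)))⁻¹ •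
      spectralVec (modeGen p n) (lam n) (lam (-n)) v,
    fun n hn => ⟨(hroots n hn).1, (hroots n hn).2.1⟩, hanti, fun j hj => ⟨?_, ?_, ?_, fun v => ?_⟩,
    fun n v hn => ?_, fun n v t hn ht => ?_⟩
  · refine le_trans ?_ (Complex.abs_im_le_norm _)
    rw [Complex.add_im, Complex.ofReal_im, add_zero, him, abs_mul, hsgn j hj, one_mul]
    exact (hroots _ hj).2.2.2.1.trans (le_abs_self _)
  · have hn1 : (1 : ℝ) ≤ j.natAbs := by exact_mod_cast hN1.trans hj
    refine (norm_add_le _ _).trans ?_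
    rw [Complex.norm_real, Real.norm_eq_abs, abs_of_pos hw0]
    have h1 := hlamR j hj
    have h2 : 0 ≤ 4 * R₀ ^ 2 * j.natAbs := by positivity
    nlinarith
  · have h0 : lam j - (-((k - w) / 2 : ℝ) + Complex.I * c * j) =
        ((x j.natAbs / 2 : ℝ) : ℂ) + ((j.sign * (ν j.natAbs - c * j.natAbs) : ℝ) : ℂ) *
          Complex.I := by
      have : ((j : ℤ) : ℂ) = ((j.sign * (j.natAbs : ℝ) : ℝ) : ℂ) := by
        rw [← hsabs]; simp
      rw [this]
      simp only [lam]
      push_cast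
      ring
    rw [h0]
    refine (norm_add_le _ _).trans ?_
    rw [norm_mul, Complex.norm_I, mul_one, Complex.norm_real, Complex.norm_real,
      Real.norm_eq_abs, Real.norm_eq_abs, abs_mul, hsgn j hj, one_mul]
    obtain ⟨h1, -, h2, -, h3, -, -⟩ := hroots _ hj
    have h4 : |(j : ℝ)| = j.natAbs := by rw [hsabs j, abs_mul, hsgn j hj, one_mul]; simp
    rw [h4, abs_of_pos (by linarith)]
    have h5 : 2 * K / j.natAbs = K / j.natAbs + K / j.natAbs := by ring
    rw [h5]
    linarith
  · rw [norm_smul, norm_inv, norm_mul]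
    have h1 : (‖lam j - lam (-j)‖ * ‖lam j - r j.natAbs‖)⁻¹ ≤ 1 := by
      refine inv_le_one_of_one_le₀ ?_
      nlinarith [hlr j hj, hll j hj]
    have h2 := norm_spectralVec_le (by positivity) (hgenR _ hj)
      ((hlamR (-j) (by rwa [hneg])).trans_eq (by rw [hneg])) (hrR _ hj) v
    calc _ ≤ 1 * (4 * (R₀ * j.natAbs) ^ 2 * ‖v‖) := by gcongr
      _ = (4 * R₀ ^ 2) * j.natAbs ^ 2 * ‖v‖ := by ring
      _ ≤ _ := by
        gcongr
        linarith
  · rw [norm_smul, norm_inv, norm_mul]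
    have h1 : (‖r n - lam n‖ * ‖r n - lam (-n)‖)⁻¹ ≤ 1 := by
      refine inv_le_one_of_one_le₀ ?_
      have e1 := hlr n (by simpa using hn)
      have e2 := hlr (-n) (by simpa using hn)
      simp only [hneg, Int.natAbs_natCast] at e1 e2
      rw [norm_sub_rev] at e1 e2
      nlinarith
    have h2 := norm_spectralVec_le (by positivity) (hgenR _ hn)
      (by simpa using hlamR n (by simpa using hn))
      (by simpa using hlamR (-n) (by simpa using hn)) v
    calc _ ≤ 1 * (4 * (R₀ * n) ^ 2 * ‖v‖) := by gcongr
      _ = (4 * R₀ ^ 2) * n ^ 2 * ‖v‖ := by ring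
      _ ≤ _ := by
        gcongr
        linarith
  · have e1 := hlr n (by simpa using hn)
    have e2 := hlr (-n) (by simpa using hn)
    have e3 := hll n (by simpa using hn)
    simp only [hneg, Int.natAbs_natCast] at e1 e2 e3
    have n1 : lam n ≠ r n := by
      intro h; rw [h, sub_self, norm_zero] at e1; linarith
    have n2 : lam (-n) ≠ r n := by
      intro h; rw [h, sub_self, norm_zero] at e2; linarith
    have n3 : lam n ≠ lam (-n) := by
      intro h; rw [h, sub_self, norm_zero] at e3; linarith
    obtain ⟨-, -, -, -, -, c1, c2⟩ := hroots n hn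
    have hn0 : (n : ℤ).sign = 1 := Int.sign_eq_one_of_pos (by omega)
    have hlp : lam n = ((-((k - w - x n) / 2) : ℝ) : ℂ) + (ν n : ℂ) * Complex.I := by
      simp only [lam, Int.natAbs_natCast, hn0]; simp
    have hlm : lam (-n) = ((-((k - w - x n) / 2) : ℝ) : ℂ) - (ν n : ℂ) * Complex.I := by
      simp only [lam, Int.natAbs_neg, Int.natAbs_natCast, Int.sign_neg, hn0]
      push_cast
      ring
    have hsum : lam n + lam (-n) = ((-(k - w - x n) : ℝ) : ℂ) := by
      rw [hlp, hlm]; push_cast; ring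
    have hprod : lam n * lam (-n) =
        ((c ^ 2 * n ^ 2 - (w + x n) * (k - w - x n) : ℝ) : ℂ) := by
      rw [← c2, hlp, hlm]
      push_cast
      linear_combination (-(ν n : ℂ) ^ 2) * Complex.I_sq
    have c1' : ((w + x n) ^ 2 * (k - w - x n) : ℂ) = c ^ 2 * n ^ 2 * x n := by exact_mod_cast c1
    -- Vieta's formulas match the roots with the coefficients in `modeGen_cubed`.
    have q1 : lam n + lam (-n) + r n = (-(1 / p.κ : ℝ) : ℂ) := by
      rw [hsum, ← hk]
      simp only [r]
      push_cast
      ring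
    have q2 : lam n * lam (-n) + lam n * r n + lam (-n) * r n =
        ((p.speed ^ 2 * n ^ 2 : ℝ) : ℂ) := by
      rw [add_assoc, ← add_mul, hsum, hprod]
      simp only [r]
      push_cast
      ring
    have q3 : lam n * lam (-n) * r n = (-(p.speed ^ 2 * n ^ 2 * p.limitRate : ℝ) : ℂ) := by
      rw [hprod]
      simp only [r]
      push_cast
      linear_combination c1'
    have hA : ∀ v, modeGen p n (modeGen p n (modeGen p n v)) =
        (lam n + lam (-n) + r n) • modeGen p n (modeGen p n v) -
        (lam n * lam (-n) + lam n * r n + lam (-n) * r n) • modeGen p n v +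
          (lam n * lam (-n) * r n) • v := by
      intro v
      rw [modeGen_cubed, q1, q2, q3]
    simpa only [Int.natAbs_natCast, hneg, neg_neg] using
      modeFlow_eq_spectral p n n3 n1 n2 hA v ht

/-! ### Unique continuation -/

theorem summable_natAbs {h : ℕ → ℝ} (hh : Summable h) : Summable fun j : ℤ => h j.natAbs :=
  Summable.of_nat_of_neg (by simpa using hh) (by simpa using hh)

/-- Unique continuation for the high modes. -/
theorem exists_high_modes_unique (p : Params) :
    ∃ N : ℕ, ∀ (T : ℝ), 2 * Real.pi / p.speed < T → ∀ (L : ℕ → Amp →L[ℂ] ℂ) (C : ℝ),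
      (∀ n, ‖L n‖ ≤ C) → ∀ (e : Amp) (q : ℕ → ℂ), (∀ k : ℕ, Summable fun n => ‖q n‖ * n ^ k) →
      (∀ n ≤ N, q n = 0) →
      (∀ t ∈ Ioo 0 T, HasSum (fun n => q n * L n (modeFlow p n t e)) 0) →
      ∀ n t, 0 ≤ t → q n * L n (modeFlow p n t e) = 0 := by
  obtain ⟨N₁, hN₁, K, hK, R, hR, x, lam, P, P₀, hx, hanti, hlam, hP₀, hflow⟩ :=
    exists_mode_expansion p
  obtain ⟨N₂, huniq⟩ := exists_exp_series_unique p.speed_pos hK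
  refine ⟨max N₁ N₂, fun T hT L C hL e q hq hqN hsum => ?_⟩
  set N := max N₁ N₂ with hN
  set w := p.limitRate with hw
  set b := -((1 / p.κ - w) / 2) with hb
  have hC : 0 ≤ C := (norm_nonneg _).trans (hL 0)
  set ε : ℤ → ℂ := fun j =>
    lam j - (-((1 / p.κ - w) / 2 : ℝ) + Complex.I * p.speed * j) with hε
  set a : ℤ → ℂ := fun j => q j.natAbs * L j.natAbs (P j e) with ha
  set d : ℕ → ℂ := fun n => q n * L n (P₀ n e) with hd
  -- The identity will be multiplied by `exp (w t)`: the real exponents become `-x n` and the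
  -- oscillating ones `lam j + w`, as `exists_exp_series_unique` requires.
  have hζ : ∀ j : ℤ, (((b + w : ℝ) : ℂ) + Complex.I * p.speed * j + ε j) = lam j + w := by
    intro j
    simp only [hε, hb]
    push_cast
    ring
  have hN₁N : N₁ ≤ N := le_max_left _ _
  have hnat : ∀ j : ℤ, (N : ℤ) < |j| → N < j.natAbs := by
    intro j hj
    rw [Int.abs_eq_natAbs] at hj
    exact_mod_cast hj
  have ha0 : ∀ j : ℤ, j.natAbs ≤ N → a j = 0 := fun j hj => by
    simp only [ha, hqN _ hj, zero_mul]
  have haN : ∀ j : ℤ, ‖a j‖ ≤ C * R * ‖e‖ * (‖q j.natAbs‖ * j.natAbs ^ 2) := by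
    intro j
    rcases le_or_gt j.natAbs N with hj | hj
    · rw [ha0 j hj, norm_zero]; positivity
    · have h1 := (hlam j (hN₁N.trans hj.le)).2.2.2 e
      simp only [ha]
      rw [norm_mul]
      calc ‖q j.natAbs‖ * ‖L j.natAbs (P j e)‖
          ≤ ‖q j.natAbs‖ * (C * (R * j.natAbs ^ 2 * ‖e‖)) := by
            gcongr
            exact ((L _).le_opNorm _).trans (by gcongr; exact hL _)
        _ = _ := by ring
  have hdN : ∀ n : ℕ, ‖d n‖ ≤ C * R * ‖e‖ * (‖q n‖ * n ^ 2) := by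
    intro n
    rcases le_or_gt n N with hj | hj
    · simp only [hd, hqN n hj, zero_mul, norm_zero]; positivity
    · have h1 := hP₀ n e (hN₁N.trans hj.le)
      simp only [hd]
      rw [norm_mul]
      calc ‖q n‖ * ‖L n (P₀ n e)‖ ≤ ‖q n‖ * (C * (R * n ^ 2 * ‖e‖)) := by
            gcongr
            exact ((L _).le_opNorm _).trans (by gcongr; exact hL _)
        _ = _ := by ring
  have hasum : ∀ k : ℕ, Summable fun j : ℤ => ‖a j‖ * ‖lam j + w‖ ^ k := by
    intro k
    refine Summable.of_nonneg_of_le (fun j => by positivity) (fun j => ?_)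
      (summable_natAbs ((hq (2 + k)).mul_left (C * R * ‖e‖ * R ^ k)))
    rcases le_or_gt j.natAbs N with hj | hj
    · rw [ha0 j hj, norm_zero, zero_mul]; positivity
    · have h1 := (hlam j (hN₁N.trans hj.le)).2.1
      calc ‖a j‖ * ‖lam j + w‖ ^ k
          ≤ C * R * ‖e‖ * (‖q j.natAbs‖ * j.natAbs ^ 2) * (R * j.natAbs) ^ k := by
            gcongr
            exact haN j
        _ = _ := by ring
  have hdsum : Summable fun n => ‖d n‖ :=
    Summable.of_nonneg_of_le (fun n => norm_nonneg _) hdN ((hq 2).mul_left _)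
  have hexpand : ∀ n t, 0 ≤ t → q n * L n (modeFlow p n t e) =
      a n * Complex.exp (lam n * t) + a (-n) * Complex.exp (lam (-n) * t) +
        d n * Complex.exp (-(w + x n : ℝ) * t) := by
    intro n t ht
    rcases le_or_gt n N with hn | hn
    · rw [ha0 n (by simpa using hn), ha0 (-n) (by simpa using hn)]
      simp [hd, hqN n hn]
    · rw [hflow n e t (hN₁N.trans hn.le) ht]
      simp only [ha, hd, map_add, map_smul, smul_eq_mul, Int.natAbs_neg, Int.natAbs_natCast]
      ring
  obtain ⟨hares, hdres⟩ := huniq N (le_max_right _ _) (b + w) ε a x d T hT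
    (fun j hj => (hlam j (hN₁N.trans (hnat j hj).le)).2.2.1)
    (fun j hj => by rw [hζ]; exact (hlam j (hN₁N.trans (hnat j hj).le)).1)
    (fun n hn => (hx n (hN₁N.trans hn.le)).1) (fun n hn => (hx n (hN₁N.trans hn.le)).2)
    (fun m n hm hmn => hanti m n (hN₁N.trans hm.le) hmn)
    (fun j hj => ha0 j (by rw [Int.abs_eq_natAbs] at hj; exact_mod_cast hj))
    (fun n hn => by simp only [hd, hqN n hn, zero_mul])
    (fun k => by simpa only [hζ] using hasum k) hdsum (fun t ht => by
      simp only [hζ]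
      have hbd : ∀ j : ℤ, ‖a j * Complex.exp ((lam j + w) * t)‖ ≤
          ‖a j‖ * ‖lam j + w‖ ^ 0 * Real.exp ((|b + w| + K) * t) := by
        intro j
        rcases le_or_gt j.natAbs N with hj | hj
        · rw [ha0 j hj]; simp
        rw [norm_mul, pow_zero, mul_one, Complex.norm_exp]
        gcongr
        rw [Complex.re_mul_ofReal]
        have h1 : ((lam j + w : ℂ)).re = (b + w) + (ε j).re := by
          rw [← hζ]; simp
        have h2 := (hlam j (hN₁N.trans hj.le)).2.2.1
        have h3 : (1 : ℝ) ≤ |(j : ℝ)| := by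
          have : 1 ≤ |j| := Int.one_le_abs (by omega)
          exact_mod_cast this
        have h4 : K / |(j : ℝ)| ≤ K := div_le_self hK h3
        have h5 := ht.1.le
        gcongr
        rw [h1]
        have h6 : (ε j).re ≤ ‖ε j‖ := Complex.re_le_norm _
        have h7 : ‖ε j‖ ≤ K / |(j : ℝ)| := h2
        linarith [le_abs_self (b + w)]
      have hs : Summable fun j : ℤ => a j * Complex.exp ((lam j + w) * t) :=
        Summable.of_norm_bounded ((hasum 0).mul_right _) hbd
      have hs₁ : Summable fun n : ℕ => a n * Complex.exp ((lam n + w) * t) :=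
        hs.comp_injective (i := fun n : ℕ => (n : ℤ)) Nat.cast_injective
      have hs₂ : Summable fun n : ℕ => a (-n) * Complex.exp ((lam (-n) + w) * t) :=
        hs.comp_injective (i := fun n : ℕ => -(n : ℤ))
          (neg_injective.comp Nat.cast_injective)
      have hs₃ : Summable fun n : ℕ => d n * Complex.exp (-(x n : ℂ) * t) := by
        refine Summable.of_norm_bounded hdsum fun n => ?_
        rcases le_or_gt n N with hn | hn
        · simp [hd, hqN n hn]
        · rw [norm_mul, Complex.norm_exp]
          refine mul_le_of_le_one_right (norm_nonneg _) (Real.exp_le_one_iff.2 ?_)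
          rw [Complex.re_mul_ofReal]
          have := mul_pos (hx n (hN₁N.trans hn.le)).1 ht.1
          simp only [Complex.neg_re, Complex.ofReal_re]
          linarith
      have hZ := HasSum.of_nat_of_neg (f := fun j : ℤ => a j * Complex.exp ((lam j + w) * t))
        hs₁.hasSum hs₂.hasSum
      -- Summing over `n` and `-n` counts the index `0` twice, harmlessly since its coefficient is
      -- zero.
      have ha00 : a 0 = 0 := ha0 0 (Nat.zero_le N)
      simp only [ha00, zero_mul, sub_zero] at hZ
      rw [hZ.tsum_eq]
      have htot := (hs₁.hasSum.add hs₂.hasSum).add hs₃.hasSum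
      have hmul := (hsum t ht).mul_left (Complex.exp (w * t))
      rw [mul_zero] at hmul
      refine htot.unique ?_
      refine (congrArg (fun F => HasSum F (0 : ℂ)) (funext fun n => ?_)).mp hmul
      rw [hexpand n t ht.1.le]
      have e1 : ∀ z : ℂ, Complex.exp ((z + w) * t) =
          Complex.exp (w * t) * Complex.exp (z * t) := by
        intro z; rw [← Complex.exp_add]; congr 1; ring
      have e2 : Complex.exp (-(x n : ℂ) * t) =
          Complex.exp (w * t) * Complex.exp (-(w + x n : ℝ) * t) := by
        rw [← Complex.exp_add]; congr 1; push_cast; ring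
      rw [e1, e1, e2]
      ring)
  intro n t ht
  rw [hexpand n t ht, hares, hares, hdres]
  ring

/-- Taking `j = 0` repeatedly keeps `n ^ (2 * m) * ‖q n‖` bounded for every `m`, so members of the
family decay rapidly; `m = k + 1` leaves the summable factor `1 / n²`. -/
theorem summable_of_bounded_family {Φ : Set (ℕ → ℂ)} (hbdd : ∀ q ∈ Φ, ∃ C : ℝ, ∀ n, ‖q n‖ ≤ C)
    (hmul : ∀ q ∈ Φ, ∀ j : ℕ, (fun n : ℕ => ((j : ℂ) ^ 2 - (n : ℂ) ^ 2) * q n) ∈ Φ) {q : ℕ → ℂ}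
    (hq : q ∈ Φ) (k : ℕ) : Summable fun n => ‖q n‖ * (n : ℝ) ^ k := by
  have hiter : ∀ m : ℕ, ∃ C : ℝ, ∀ n : ℕ, ‖q n‖ * (n : ℝ) ^ (2 * m) ≤ C := by
    intro m
    have : ∃ q' ∈ Φ, ∀ n : ℕ, ‖q' n‖ = ‖q n‖ * (n : ℝ) ^ (2 * m) := by
      induction m with
      | zero => exact ⟨q, hq, fun n => by simp⟩
      | succ m ih =>
        obtain ⟨q', hq', h⟩ := ih
        refine ⟨_, hmul q' hq' 0, fun n => ?_⟩
        rw [norm_mul, h]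
        simp
        ring
    obtain ⟨q', hq', h⟩ := this
    obtain ⟨C, hC⟩ := hbdd q' hq'
    exact ⟨C, fun n => (h n).symm.trans_le (hC n)⟩
  obtain ⟨C, hC⟩ := hiter (k + 1)
  rw [← summable_nat_add_iff 1]
  have hs : Summable fun n : ℕ => C * (1 / ((n + 1 : ℕ) : ℝ) ^ 2) :=
    ((summable_nat_add_iff 1).2 (Real.summable_one_div_nat_pow.2 (by norm_num : 1 < 2))).mul_left C
  refine Summable.of_nonneg_of_le (fun n => by positivity) (fun n => ?_) hs
  have hn : (1 : ℝ) ≤ ((n + 1 : ℕ) : ℝ) := by exact_mod_cast Nat.succ_le_succ (Nat.zero_le n)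
  rw [mul_one_div, le_div_iff₀ (by positivity)]
  refine le_trans ?_ (hC (n + 1))
  rw [mul_assoc, ← pow_add]
  gcongr
  omega

/-- Unique continuation: if the observation of the orbit of an amplitude vanishes for all profiles
with coefficients in `Φ`, then it vanishes in every mode that is seen by `Φ`. -/
theorem unique_continuation (p : Params) {T : ℝ} (hT : 2 * Real.pi / p.speed < T)
    (L : ℕ → Amp →L[ℂ] ℂ) {C : ℝ} (hL : ∀ n, ‖L n‖ ≤ C) (e : Amp) (Φ : Set (ℕ → ℂ))
    (hbdd : ∀ q ∈ Φ, ∃ C : ℝ, ∀ n, ‖q n‖ ≤ C)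
    (hmul : ∀ q ∈ Φ, ∀ j : ℕ, (fun n : ℕ => ((j : ℂ) ^ 2 - (n : ℂ) ^ 2) * q n) ∈ Φ)
    (hsum : ∀ q ∈ Φ, ∀ t ∈ Icc 0 T, HasSum (fun n => q n * L n (modeFlow p n t e)) 0)
    {n : ℕ} (hn : ∃ q ∈ Φ, q n ≠ 0) : ∀ t ∈ Icc 0 T, L n (modeFlow p n t e) = 0 := by
  obtain ⟨N, hN⟩ := exists_high_modes_unique p
  -- These products annihilate exactly the modes in `s`.
  have hprod : ∀ (s : Finset ℕ), ∀ q ∈ Φ,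
      (fun n : ℕ => (∏ j ∈ s, ((j : ℂ) ^ 2 - (n : ℂ) ^ 2)) * q n) ∈ Φ := by
    intro s q hq
    induction s using Finset.induction_on with
    | empty => simpa using hq
    | insert j s hj ih =>
      have := hmul _ ih j
      simpa only [Finset.prod_insert hj, mul_assoc] using this
  have hne : ∀ i j : ℕ, i ≠ j → ((i : ℂ) ^ 2 - (j : ℂ) ^ 2) ≠ 0 := by
    intro i j hij h
    rw [sub_eq_zero] at h
    have : i ^ 2 = j ^ 2 := by exact_mod_cast h
    exact hij (Nat.pow_left_injective (by norm_num : 2 ≠ 0) this)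
  have hhigh : ∀ q ∈ Φ, ∀ m, N < m → ∀ t ∈ Icc 0 T, q m * L m (modeFlow p m t e) = 0 := by
    intro q hq m hm t ht
    have hq' := hprod (Finset.range (N + 1)) q hq
    have h1 := hN T hT L C hL e _ (summable_of_bounded_family hbdd hmul hq') (fun i hi => by
      rw [Finset.prod_eq_zero (Finset.mem_range.2 (Nat.lt_succ_of_le hi)) (sub_self _), zero_mul])
      (fun t ht => hsum _ hq' t (Ioo_subset_Icc_self ht)) m t ht.1
    rw [mul_assoc] at h1
    refine (mul_eq_zero.1 h1).resolve_left (Finset.prod_ne_zero_iff.2 fun j hj => hne j m ?_)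
    have := Finset.mem_range.1 hj
    omega
  obtain ⟨q, hq, hqn⟩ := hn
  intro t ht
  rcases lt_or_ge N n with hNn | hnN
  · exact (mul_eq_zero.1 (hhigh q hq n hNn t ht)).resolve_left hqn
  -- All low modes except `n` are annihilated and the high ones already vanish, so the series
  -- reduces to its `n`-th term.
  · have hq' := hprod ((Finset.range (N + 1)).erase n) q hq
    have h1 := hsum _ hq' t ht
    have h2 := hasSum_single n (f := fun m : ℕ => (∏ j ∈ (Finset.range (N + 1)).erase n,
      ((j : ℂ) ^ 2 - (m : ℂ) ^ 2)) * q m * L m (modeFlow p m t e)) (fun m hm => by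
        rcases lt_or_ge N m with hNm | hmN
        · rw [mul_assoc, hhigh q hq m hNm t ht, mul_zero]
        · rw [Finset.prod_eq_zero (Finset.mem_erase.2
            ⟨hm, Finset.mem_range.2 (Nat.lt_succ_of_le hmN)⟩) (sub_self _), zero_mul, zero_mul])
    have h3 := h2.unique h1
    rw [mul_assoc] at h3
    have h4 := (mul_eq_zero.1 h3).resolve_left
      (Finset.prod_ne_zero_iff.2 fun j hj => hne j n (Finset.ne_of_mem_erase hj))
    exact (mul_eq_zero.1 h4).resolve_left hqn

/-! ### Coefficients of test functions -/

/-- The smooth functions with compact support in `O`. -/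
def testFunctions (O : Set ℝ) : Set (ℝ → ℂ) :=
  {φ | ContDiff ℝ ∞ φ ∧ HasCompactSupport φ ∧ tsupport φ ⊆ O}

theorem eq_zero_of_mem_testFunctions {O : Set ℝ} {φ : ℝ → ℂ} (hφ : φ ∈ testFunctions O) {x : ℝ}
    (hx : x ∉ O) : φ x = 0 :=
  image_eq_zero_of_notMem_tsupport fun h => hx (hφ.2.2 h)

theorem deriv_mem_testFunctions {O : Set ℝ} {φ : ℝ → ℂ} (hφ : φ ∈ testFunctions O) :
    deriv φ ∈ testFunctions O :=
  ⟨(contDiff_infty_iff_deriv.1 hφ.1).2, hφ.2.1.deriv,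
    (closure_minimal support_deriv_subset (isClosed_tsupport φ)).trans hφ.2.2⟩

theorem add_const_mul_mem_testFunctions {O : Set ℝ} {φ ψ : ℝ → ℂ} (hφ : φ ∈ testFunctions O)
    (hψ : ψ ∈ testFunctions O) (c : ℂ) : (fun x => φ x + c * ψ x) ∈ testFunctions O :=
  ⟨hφ.1.add (contDiff_const.mul hψ.1), hφ.2.1.add (hψ.2.1.mul_left (f := fun _ => c)),
    (tsupport_add φ _).trans (union_subset hφ.2.2
      ((tsupport_mul_subset_right (f := fun _ => c)).trans hψ.2.2))⟩

theorem pairing_comm {φ ψ : ℝ → ℂ} (hφ : Continuous φ) (hψ : Continuous ψ) :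
    pairing φ (toL2 ψ) = pairing ψ (toL2 φ) := by
  rw [pairing_toL2 hφ hψ, pairing_toL2 hψ hφ]
  simp only [mul_comm]

theorem pairing_add {φ ψ : ℝ → ℂ} (hφ : Continuous φ) (hψ : Continuous ψ) (g : L2On I) :
    pairing (fun x => φ x + ψ x) g = pairing φ g + pairing ψ g := by
  rw [pairing_apply hφ, pairing_apply hψ, pairing_apply (by fun_prop), ← integral_add
    (integrable_mul_of_continuous (integrable_L2On g) hφ)
    (integrable_mul_of_continuous (integrable_L2On g) hψ)]
  simp only [mul_add]

/-- Hence `φ'' + j² φ`, supported where `φ` is, has coefficients multiplied by `j² - n²`. The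
boundary terms vanish because `φ'` is zero at the ends. -/
theorem pairing_deriv_deriv_cosC {φ : ℝ → ℂ} (hφ : φ ∈ testFunctions I) (n : ℕ) :
    pairing (deriv (deriv φ)) (toL2 (cosC n)) = -((n : ℂ) ^ 2 * pairing φ (toL2 (cosC n))) := by
  have h := deriv_mem_testFunctions hφ
  rw [pairing_deriv_cosC h.1 (eq_zero_of_mem_testFunctions h (by simp [I]))
    (eq_zero_of_mem_testFunctions h (by simp [I])), pairing_deriv_sinC hφ.1]
  ring

theorem pairing_deriv_deriv_sinC {φ : ℝ → ℂ} (hφ : φ ∈ testFunctions I) (n : ℕ) :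
    pairing (deriv (deriv φ)) (toL2 (sinC n)) = -((n : ℂ) ^ 2 * pairing φ (toL2 (sinC n))) := by
  have h := deriv_mem_testFunctions hφ
  rw [pairing_deriv_sinC h.1, pairing_deriv_cosC hφ.1
    (eq_zero_of_mem_testFunctions hφ (by simp [I]))
    (eq_zero_of_mem_testFunctions hφ (by simp [I]))]
  ring

theorem exists_pairing_ne_zero {O : Set ℝ} (hO : IsOpen O) (hOI : O ⊆ I) {u : ℝ → ℂ}
    (hu : Continuous u) {x : ℝ} (hx : x ∈ O) (hux : u x ≠ 0) :
    ∃ φ ∈ testFunctions O, pairing φ (toL2 u) ≠ 0 := by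
  by_contra! h
  have hae : ∀ᵐ y, y ∈ O → u y = 0 := by
    refine hO.ae_eq_zero_of_integral_contDiff_smul_eq_zero (hu.locallyIntegrable.locallyIntegrableOn O)
      fun g hg hgc hgs => ?_
    have hmem : (fun y => (g y : ℂ)) ∈ testFunctions O :=
      ⟨Complex.ofRealCLM.contDiff.comp hg, hgc.comp_left Complex.ofReal_zero,
        (closure_mono (Function.support_comp_subset Complex.ofReal_zero g)).trans hgs⟩
    have h1 := h _ hmem
    rw [pairing_toL2 hmem.1.continuous hu, setIntegral_eq_integral_of_forall_compl_eq_zero] at h1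
    · rw [← h1]
      congr 1
      ext y
      rw [Complex.real_smul, mul_comm]
    · intro y hy
      rw [eq_zero_of_mem_testFunctions hmem fun hyO => hy (hOI hyO), mul_zero]
  have := Measure.eqOn_open_of_ae_eq (μ := volume) (f := u) (g := 0)
    ((ae_restrict_iff' hO.measurableSet).2 hae) hO hu.continuousOn continuousOn_const
  exact hux (this hx)

theorem cosC_zero_ne (x : ℝ) : cosC 0 x ≠ 0 := by
  have := Real.pi_pos
  simp only [cosC, cosMode, if_true, Nat.cast_zero, zero_mul, Real.cos_zero, mul_one]
  exact_mod_cast (by positivity : (√Real.pi)⁻¹ ≠ 0)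

theorem cosC_ne_or_sinC_ne {n : ℕ} (hn : n ≠ 0) (x : ℝ) : cosC n x ≠ 0 ∨ sinC n x ≠ 0 := by
  by_contra! h
  have hne : √(2 / Real.pi) ≠ 0 := by
    have := Real.pi_pos
    positivity
  have h1 : Real.cos (n * x) = 0 := by
    have := Complex.ofReal_eq_zero.1 h.1
    rw [cosMode, if_neg hn] at this
    exact (mul_eq_zero.1 this).resolve_left hne
  have h2 : Real.sin (n * x) = 0 :=
    (mul_eq_zero.1 (Complex.ofReal_eq_zero.1 h.2)).resolve_left hne
  have := Real.sin_sq_add_cos_sq (n * x)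
  simp [h1, h2] at this

theorem hasDerivAt_eq_zero_of_eqOn {O : Set ℝ} (hO : IsOpen O) {u : ℝ → ℂ} (h : ∀ x ∈ O, u x = 0)
    {x : ℝ} (hx : x ∈ O) {u' : ℂ} (hu : HasDerivAt u u' x) : u' = 0 :=
  hu.unique ((hasDerivAt_const x (0 : ℂ)).congr_of_eventuallyEq
    (Filter.eventually_of_mem (hO.mem_nhds hx) h))

theorem exists_cosC_ne {O : Set ℝ} (hO : IsOpen O) (hne : O.Nonempty) (n : ℕ) :
    ∃ x ∈ O, cosC n x ≠ 0 := by
  obtain ⟨x, hx⟩ := hne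
  rcases eq_or_ne n 0 with rfl | hn
  · exact ⟨x, hx, cosC_zero_ne x⟩
  by_contra! h
  have h1 := hasDerivAt_eq_zero_of_eqOn hO h hx (hasDerivAt_cosC n x)
  have h2 := (mul_eq_zero.1 h1).resolve_left (neg_ne_zero.2 (Nat.cast_ne_zero.2 hn))
  exact (cosC_ne_or_sinC_ne hn x).elim (fun h3 => h3 (h x hx)) fun h3 => h3 h2

theorem exists_sinC_ne {O : Set ℝ} (hO : IsOpen O) (hne : O.Nonempty) {n : ℕ} (hn : n ≠ 0) :
    ∃ x ∈ O, sinC n x ≠ 0 := by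
  obtain ⟨x, hx⟩ := hne
  by_contra! h
  have h1 := hasDerivAt_eq_zero_of_eqOn hO h hx (hasDerivAt_sinC n x)
  have h2 := (mul_eq_zero.1 h1).resolve_left (Nat.cast_ne_zero.2 hn)
  exact (cosC_ne_or_sinC_ne hn x).elim (fun h3 => h3 h2) fun h3 => h3 (h x hx)

theorem norm_toL2_cosC_le (n : ℕ) : ‖toL2 (cosC n)‖ ≤ 1 := (orthonormal_cosC.1 n).le

theorem norm_toL2_sinC_le (n : ℕ) : ‖toL2 (sinC n)‖ ≤ 1 := by
  rcases n with _ | n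
  · simp [sinC_zero, toL2_zero]
  · exact (orthonormal_sinC.1 n).le

/-! ### Observability -/

theorem exists_norm_comp_inj_le (f : State →L[ℂ] ℂ) : ∃ C : ℝ, ∀ n, ‖f.comp (inj n)‖ ≤ C := by
  have h := summable_sq_functional_inj f
  exact ⟨√(∑' n, ‖f.comp (inj n)‖ ^ 2), fun n =>
    Real.le_sqrt_of_sq_le (h.le_tsum n fun _ _ => sq_nonneg _)⟩

theorem Params.speed_lt_of_criticalTime_lt {p : Params} {T : ℝ} (h : p.criticalTime < T) :
    2 * Real.pi / p.speed < T := by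
  refine lt_of_le_of_lt ?_ h
  have := Real.pi_pos
  have := p.speed_pos
  rw [Params.criticalTime, ← Params.speed]
  gcongr
  norm_num

/-- If the observation of the orbit of `e` through the modes `u n` vanishes for all profiles
supported in `O`, then it vanishes mode by mode. -/
theorem mode_observation_eq_zero {p : Params} {T : ℝ} {O : Set ℝ} (hO : IsOpen O) (hOI : O ⊆ I)
    (hcase : (O.Nonempty ∧ p.criticalTime < T) ∨ O = I) (f : State →L[ℂ] ℂ) (e : Amp)
    {u : ℕ → ℝ → ℂ} (hu : ∀ n, Continuous (u n)) (hnorm : ∀ n, ‖toL2 (u n)‖ ≤ 1)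
    (hderiv : ∀ φ ∈ testFunctions I, ∀ n : ℕ,
      pairing (deriv (deriv φ)) (toL2 (u n)) = -((n : ℂ) ^ 2 * pairing φ (toL2 (u n))))
    (hsum : ∀ φ : ℝ → ℂ, Continuous φ → (∀ x ∈ I, x ∉ O → φ x = 0) → ∀ t ∈ Icc 0 T,
      HasSum (fun n => pairing (u n) (toL2 φ) * f (inj n (modeFlow p n t e))) 0) {n : ℕ}
    (horth : ∀ m, pairing (u m) (toL2 (u n)) = if m = n then 1 else 0)
    (hne : O.Nonempty → ∃ x ∈ O, u n x ≠ 0) :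
    ∀ t ∈ Icc 0 T, f (inj n (modeFlow p n t e)) = 0 := by
  rcases hcase with ⟨hOne, hT⟩ | rfl
  · obtain ⟨C, hC⟩ := exists_norm_comp_inj_le f
    refine unique_continuation p (Params.speed_lt_of_criticalTime_lt hT) (fun n => f.comp (inj n))
      -- The family consists of the coefficient sequences of test functions in `O`. It sees mode `n`
      -- because `u n` does not vanish identically on `O`.
      hC e {q | ∃ φ ∈ testFunctions O, q = fun n => pairing φ (toL2 (u n))} ?_ ?_ ?_ ?_
    · rintro _ ⟨φ, -, rfl⟩
      exact ⟨‖pairing φ‖ * 1, fun n => (pairing φ).le_of_opNorm_le_of_le le_rfl (hnorm n)⟩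
    · rintro _ ⟨φ, hφ, rfl⟩ j
      have h1 := deriv_mem_testFunctions hφ
      have h2 := deriv_mem_testFunctions h1
      refine ⟨_, add_const_mul_mem_testFunctions h2 hφ ((j : ℂ) ^ 2), funext fun m => ?_⟩
      rw [pairing_add h2.1.continuous (by have := hφ.1.continuous; fun_prop),
        pairing_const_mul _ hφ.1.continuous, hderiv φ ⟨hφ.1, hφ.2.1, hφ.2.2.trans hOI⟩]
      ring
    · rintro _ ⟨φ, hφ, rfl⟩ t ht
      have := hsum φ hφ.1.continuous (fun x _ hx => eq_zero_of_mem_testFunctions hφ hx) t ht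
      simpa only [pairing_comm hφ.1.continuous (hu _), ContinuousLinearMap.comp_apply] using this
    · obtain ⟨x, hx, hux⟩ := hne hOne
      obtain ⟨φ, hφ, h⟩ := exists_pairing_ne_zero hO hOI (hu n) hx hux
      exact ⟨_, ⟨φ, hφ, rfl⟩, h⟩
  · intro t ht
    -- Without a support restriction the mode itself is an admissible profile, and orthonormality
    -- leaves a single term, whatever the value of `T`.
    have h1 := hsum (u n) (hu n) (fun x hx hx' => absurd hx hx') t ht
    simp only [horth, ite_mul, one_mul, zero_mul] at h1
    have h2 := hasSum_ite_eq n (f (inj n (modeFlow p n t e)))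
    refine HasSum.unique ?_ h1
    refine h2.congr_fun fun m => ?_
    split_ifs with h
    · rw [h]
    · rfl

/-! ### Kalman's rank condition in a single mode. -/

theorem map_modeGen_modeFlow_eq_zero {p : Params} {n : ℕ} {T : ℝ} (hT : 0 < T) (ℓ : Amp →L[ℂ] ℂ)
    {e : Amp} (h : ∀ t ∈ Icc 0 T, ℓ (modeFlow p n t e) = 0) :
    ∀ t ∈ Icc 0 T, ℓ (modeGen p n (modeFlow p n t e)) = 0 := by
  intro t ht
  have h1 : HasDerivAt (fun t => ℓ (modeFlow p n t e)) (ℓ (modeGen p n (modeFlow p n t e))) t :=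
    (ℓ.restrictScalars ℝ).hasFDerivAt.comp_hasDerivAt t (hasDerivAt_modeFlow p n e t)
  exact (uniqueDiffOn_Icc hT t ht).eq_deriv _ h1.hasDerivWithinAt
    ((hasDerivWithinAt_const t (Icc 0 T) (0 : ℂ)).congr h (h t ht))

theorem map_modeGen_eq_zero {p : Params} {n : ℕ} {T : ℝ} (hT : 0 < T) (ℓ : Amp →L[ℂ] ℂ)
    {e : Amp} (h : ∀ t ∈ Icc 0 T, ℓ (modeFlow p n t e) = 0) :
    ℓ e = 0 ∧ ℓ (modeGen p n e) = 0 ∧ ℓ (modeGen p n (modeGen p n e)) = 0 := by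
  have h1 := map_modeGen_modeFlow_eq_zero hT ℓ h
  have h2 := map_modeGen_modeFlow_eq_zero hT (ℓ.comp (modeGen p n)) h1
  have h0 : (0 : ℝ) ∈ Icc 0 T := ⟨le_rfl, hT.le⟩
  have e0 := h 0 h0
  have e1 := h1 0 h0
  have e2 := h2 0 h0
  rw [modeFlow_zero] at e0 e1 e2
  exact ⟨e0, e1, e2⟩

theorem map_amp (ℓ : Amp →L[ℂ] ℂ) (v : Amp) :
    ℓ v = v.1 * ℓ (1, 0, 0) + v.2.1 * ℓ (0, 1, 0) + v.2.2 * ℓ (0, 0, 1) := by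
  simp only [← smul_eq_mul, ← map_smul, ← map_add]
  congr 1
  ext <;> simp

theorem eq_zero_of_map_basis (ℓ : Amp →L[ℂ] ℂ) (h₁ : ℓ (1, 0, 0) = 0) (h₂ : ℓ (0, 1, 0) = 0)
    (h₃ : ℓ (0, 0, 1) = 0) : ℓ = 0 := by
  refine ContinuousLinearMap.ext fun v => ?_
  rw [map_amp, h₁, h₂, h₃]
  simp

/-- The generator carries density to velocity and velocity to stress, so `e`, `A e`, `A² e` span the
mode. -/
theorem observable_density {p : Params} {n : ℕ} (hn : n ≠ 0) {T : ℝ} (hT : 0 < T)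
    (ℓ : Amp →L[ℂ] ℂ) (h : ∀ t ∈ Icc 0 T, ℓ (modeFlow p n t (1, 0, 0)) = 0) : ℓ = 0 := by
  have hb : (p.b : ℂ) ≠ 0 := Complex.ofReal_ne_zero.2 p.b_pos.ne'
  have hκ : (p.κ : ℂ) ≠ 0 := Complex.ofReal_ne_zero.2 p.κ_pos.ne'
  have hμ : (p.μ : ℂ) ≠ 0 := Complex.ofReal_ne_zero.2 p.μ_pos.ne'
  have hn' : (n : ℂ) ≠ 0 := Nat.cast_ne_zero.2 hn
  obtain ⟨e0, e1, e2⟩ := map_modeGen_eq_zero hT ℓ h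
  rw [map_amp, modeGen_apply] at e1 e2
  rw [modeGen_apply] at e2
  have h2 : ℓ (0, 1, 0) = 0 := by simpa [hb, hn', e0] using e1
  have h3 : ℓ (0, 0, 1) = 0 := by simpa [hb, hn', hκ, hμ, e0, h2] using e2
  exact eq_zero_of_map_basis ℓ e0 h2 h3

/-- `A e` yields only one combination of density and stress. The relaxation term separates them:
modulo the velocity, `A² e` is a nonzero multiple of the stress direction. -/
theorem observable_velocity {p : Params} {n : ℕ} (hn : n ≠ 0) {T : ℝ} (hT : 0 < T)
    (ℓ : Amp →L[ℂ] ℂ) (h : ∀ t ∈ Icc 0 T, ℓ (modeFlow p n t (0, 1, 0)) = 0) : ℓ = 0 := by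
  have hρ : (p.ρs : ℂ) ≠ 0 := Complex.ofReal_ne_zero.2 p.ρs_pos.ne'
  have hκ : (p.κ : ℂ) ≠ 0 := Complex.ofReal_ne_zero.2 p.κ_pos.ne'
  have hμ : (p.μ : ℂ) ≠ 0 := Complex.ofReal_ne_zero.2 p.μ_pos.ne'
  have hn' : (n : ℂ) ≠ 0 := Nat.cast_ne_zero.2 hn
  obtain ⟨e0, e1, e2⟩ := map_modeGen_eq_zero hT ℓ h
  rw [map_amp, modeGen_apply] at e1 e2
  rw [modeGen_apply] at e2
  have h3 : ℓ (0, 0, 1) = 0 := by simpa [hn', hκ, hμ, e0] using e2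
  have h1 : ℓ (1, 0, 0) = 0 := by simpa [hρ, hn', e0, h3] using e1
  exact eq_zero_of_map_basis ℓ h1 e0 h3

theorem observable_stress {p : Params} {n : ℕ} (hn : n ≠ 0) {T : ℝ} (hT : 0 < T)
    (ℓ : Amp →L[ℂ] ℂ) (h : ∀ t ∈ Icc 0 T, ℓ (modeFlow p n t (0, 0, 1)) = 0) : ℓ = 0 := by
  have hρ : (p.ρs : ℂ) ≠ 0 := Complex.ofReal_ne_zero.2 p.ρs_pos.ne'
  have hn' : (n : ℂ) ≠ 0 := Nat.cast_ne_zero.2 hn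
  obtain ⟨e0, e1, e2⟩ := map_modeGen_eq_zero hT ℓ h
  rw [map_amp, modeGen_apply] at e1 e2
  rw [modeGen_apply] at e2
  have h2 : ℓ (0, 1, 0) = 0 := by simpa [hρ, hn', e0] using e1
  have h1 : ℓ (1, 0, 0) = 0 := by simpa [hρ, hn', e0, h2] using e2
  exact eq_zero_of_map_basis ℓ h1 h2 e0

/-! ### Approximate controllability -/

theorem sub_mem_L2m {g h : L2On I} (hg : g ∈ L2m) (hh : h ∈ L2m) : g - h ∈ L2m := by
  have hg' : ∫ x in I, g x = 0 := hg
  have hh' : ∫ x in I, h x = 0 := hh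
  rw [integral_eq_pairing_one] at hg' hh'
  change ∫ x in I, (g - h) x = 0
  rw [integral_eq_pairing_one, map_sub, hg', hh', sub_zero]

theorem pairing_cosC_zero_of_mem_L2m {g : L2On I} (hg : g ∈ L2m) : pairing (cosC 0) g = 0 := by
  have hg' : ∫ x in I, g x = 0 := hg
  have : cosC 0 = fun _ => cosC 0 0 * 1 := by
    ext x
    simp [cosC, cosMode]
  rw [this, pairing_const_mul _ continuous_const, ← integral_eq_pairing_one, hg', mul_zero]

/-- In mode `0` the sine is void and the cosines are constant, so only the two means remain; each
product vanishes if either the mean is zero or `f` does not see it. -/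
theorem eq_zero_of_forall_mode (f : State →L[ℂ] ℂ) (h : ∀ n, n ≠ 0 → f.comp (inj n) = 0) (x : State)
    (h₁ : pairing (cosC 0) x.1 * f (inj 0 (1, 0, 0)) = 0)
    (h₃ : pairing (cosC 0) x.2.2 * f (inj 0 (0, 0, 1)) = 0) : f x = 0 := by
  refine (f.hasSum (hasSum_inj_proj x)).unique ?_
  convert hasSum_zero with n
  rcases eq_or_ne n 0 with rfl | hn
  · refine (map_amp (f.comp (inj 0)) (proj 0 x)).trans ?_
    simp only [ContinuousLinearMap.comp_apply, proj_apply, sinC_zero, pairing_zero, h₁, h₃]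
    simp
  · exact DFunLike.congr_fun (h n hn) (proj n x)

theorem approxControllable_density {p : Params} {T : ℝ} (hT : 0 < T) {O₁ O₂ O₃ : Set ℝ}
    (hO₁ : IsOpen O₁) (hO₂ : IsOpen O₂) (hO₃ : IsOpen O₃) (h₁ : O₁ ⊆ I) (h₂ : O₂ ⊆ I)
    (h₃ : O₃ ⊆ I) (hcase : (O₁.Nonempty ∧ p.criticalTime < T) ∨ O₁ = I) :
    ApproxControllable p T (univ ×ˢ (univ ×ˢ L2m)) (densityControls O₁ O₂ O₃) := by
  refine approxControllable_of_reachable hT hO₁ hO₂ hO₃ h₁ h₂ h₃ (isLinearClass_density O₁ O₂ O₃) _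
    (fun x hx y hy => ⟨trivial, trivial, sub_mem_L2m hx.2.2 hy.2.2⟩)
    (fun F hF z₀ hz₀ z hz t ht => ⟨trivial, trivial, stress_mem_L2m hz hF.2 hz₀.2.2 t ht⟩)
    fun f hf x hx => ?_
  have key : ∀ n, ∀ t ∈ Icc 0 T, f (inj n (modeFlow p n t (1, 0, 0))) = 0 := fun n =>
    mode_observation_eq_zero hO₁ h₁ hcase f (1, 0, 0) continuous_cosC norm_toL2_cosC_le
      (fun φ hφ => pairing_deriv_deriv_cosC hφ)
      (fun φ hφ hsupp t ht => by
        refine (dual_orbit_eq_zero hT hf (isProfile_density hφ T O₂ O₃ hO₁ h₁ hsupp) t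
          ht).congr_fun fun m => ?_
        rw [← smul_eq_mul, ← map_smul, ← map_smul, ← map_smul, proj_apply]
        simp)
      (fun m => pairing_cosC_cosC m n) fun hne => exists_cosC_ne hO₁ hne n
  refine eq_zero_of_forall_mode f
    (fun n hn => observable_density hn hT (f.comp (inj n)) (key n)) x ?_ ?_
  -- The mean of the density is directly controlled: at `t = 0` the observation in mode `0` is `f
  -- (inj 0 (1, 0, 0))`.
  · have := key 0 0 ⟨le_rfl, hT.le⟩
    rw [modeFlow_zero] at this
    exact mul_eq_zero_of_right _ this
  · rw [pairing_cosC_zero_of_mem_L2m hx.2.2, zero_mul]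

theorem approxControllable_velocity {p : Params} {T : ℝ} (hT : 0 < T) {O₁ O₂ O₃ : Set ℝ}
    (hO₁ : IsOpen O₁) (hO₂ : IsOpen O₂) (hO₃ : IsOpen O₃) (h₁ : O₁ ⊆ I) (h₂ : O₂ ⊆ I)
    (h₃ : O₃ ⊆ I) (hcase : (O₂.Nonempty ∧ p.criticalTime < T) ∨ O₂ = I) :
    ApproxControllable p T (L2m ×ˢ (univ ×ˢ L2m)) (velocityControls O₁ O₂ O₃) := by
  refine approxControllable_of_reachable hT hO₁ hO₂ hO₃ h₁ h₂ h₃ (isLinearClass_velocity O₁ O₂ O₃) _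
    (fun x hx y hy => ⟨sub_mem_L2m hx.1 hy.1, trivial, sub_mem_L2m hx.2.2 hy.2.2⟩)
    (fun F hF z₀ hz₀ z hz t ht => ⟨density_mem_L2m hz hF.1 hz₀.1 t ht, trivial,
      stress_mem_L2m hz hF.2 hz₀.2.2 t ht⟩)
    fun f hf x hx => ?_
  refine eq_zero_of_forall_mode f
    (fun n hn => observable_velocity (p := p) hn hT (f.comp (inj n)) ?_) x ?_ ?_
  · exact mode_observation_eq_zero hO₂ h₂ hcase f (0, 1, 0) continuous_sinC norm_toL2_sinC_le
      (fun φ hφ => pairing_deriv_deriv_sinC hφ)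
      (fun φ hφ hsupp t ht => by
        refine (dual_orbit_eq_zero hT hf (isProfile_velocity hφ T O₁ O₃ hO₂ h₂ hsupp) t
          ht).congr_fun fun m => ?_
        rw [← smul_eq_mul, ← map_smul, ← map_smul, ← map_smul, proj_apply]
        simp)
      (fun m => pairing_sinC_sinC m n hn) fun hne => exists_sinC_ne hO₂ hne hn
  · rw [pairing_cosC_zero_of_mem_L2m hx.1, zero_mul]
  · rw [pairing_cosC_zero_of_mem_L2m hx.2.2, zero_mul]

theorem approxControllable_stress {p : Params} {T : ℝ} (hT : 0 < T) {O₁ O₂ O₃ : Set ℝ}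
    (hO₁ : IsOpen O₁) (hO₂ : IsOpen O₂) (hO₃ : IsOpen O₃) (h₁ : O₁ ⊆ I) (h₂ : O₂ ⊆ I)
    (h₃ : O₃ ⊆ I) (hcase : (O₃.Nonempty ∧ p.criticalTime < T) ∨ O₃ = I) :
    ApproxControllable p T (L2m ×ˢ (univ ×ˢ univ)) (stressControls O₁ O₂ O₃) := by
  refine approxControllable_of_reachable hT hO₁ hO₂ hO₃ h₁ h₂ h₃ (isLinearClass_stress O₁ O₂ O₃) _
    (fun x hx y hy => ⟨sub_mem_L2m hx.1 hy.1, trivial, trivial⟩)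
    (fun F hF z₀ hz₀ z hz t ht => ⟨density_mem_L2m hz hF.1 hz₀.1 t ht, trivial, trivial⟩)
    fun f hf x hx => ?_
  have key : ∀ n, ∀ t ∈ Icc 0 T, f (inj n (modeFlow p n t (0, 0, 1))) = 0 := fun n =>
    mode_observation_eq_zero hO₃ h₃ hcase f (0, 0, 1) continuous_cosC norm_toL2_cosC_le
      (fun φ hφ => pairing_deriv_deriv_cosC hφ)
      (fun φ hφ hsupp t ht => by
        refine (dual_orbit_eq_zero hT hf (isProfile_stress hφ T O₁ O₂ hO₃ h₃ hsupp) t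
          ht).congr_fun fun m => ?_
        rw [← smul_eq_mul, ← map_smul, ← map_smul, ← map_smul, proj_apply]
        simp)
      (fun m => pairing_cosC_cosC m n) fun hne => exists_cosC_ne hO₃ hne n
  refine eq_zero_of_forall_mode f
    (fun n hn => observable_stress hn hT (f.comp (inj n)) (key n)) x ?_ ?_
  · rw [pairing_cosC_zero_of_mem_L2m hx.1, zero_mul]
  · have := key 0 0 ⟨le_rfl, hT.le⟩
    rw [modeFlow_zero] at this
    exact mul_eq_zero_of_right _ this

end MaxwellNS

end

theorem theorem1p5 (p : MaxwellNS.Params) (O₁ O₂ O₃ : Set ℝ)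
    (hO₁ : IsOpen O₁) (hO₂ : IsOpen O₂) (hO₃ : IsOpen O₃)
    (hO₁I : O₁ ⊆ Set.Ioo 0 Real.pi) (hO₂I : O₂ ⊆ Set.Ioo 0 Real.pi)
    (hO₃I : O₃ ⊆ Set.Ioo 0 Real.pi) (T : ℝ) (hT : 0 < T) :
    -- control of the density, in `L² × L² × L²_m`
    ((O₁.Nonempty → p.criticalTime < T →
        MaxwellNS.ApproxControllable p T (Set.univ ×ˢ (Set.univ ×ˢ MaxwellNS.L2m))
          (MaxwellNS.densityControls O₁ O₂ O₃)) ∧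
      (O₁ = Set.Ioo 0 Real.pi →
        MaxwellNS.ApproxControllable p T (Set.univ ×ˢ (Set.univ ×ˢ MaxwellNS.L2m))
          (MaxwellNS.densityControls O₁ O₂ O₃))) ∧
    -- control of the velocity, in `L²_m × L² × L²_m`
    ((O₂.Nonempty → p.criticalTime < T →
        MaxwellNS.ApproxControllable p T (MaxwellNS.L2m ×ˢ (Set.univ ×ˢ MaxwellNS.L2m))
          (MaxwellNS.velocityControls O₁ O₂ O₃)) ∧
      (O₂ = Set.Ioo 0 Real.pi →
        MaxwellNS.ApproxControllable p T (MaxwellNS.L2m ×ˢ (Set.univ ×ˢ MaxwellNS.L2m))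
          (MaxwellNS.velocityControls O₁ O₂ O₃))) ∧
    -- control of the stress, in `L²_m × L² × L²`
    ((O₃.Nonempty → p.criticalTime < T →
        MaxwellNS.ApproxControllable p T (MaxwellNS.L2m ×ˢ (Set.univ ×ˢ Set.univ))
          (MaxwellNS.stressControls O₁ O₂ O₃)) ∧
      (O₃ = Set.Ioo 0 Real.pi →
        MaxwellNS.ApproxControllable p T (MaxwellNS.L2m ×ˢ (Set.univ ×ˢ Set.univ))
          (MaxwellNS.stressControls O₁ O₂ O₃))) := by
  exact
    ⟨⟨fun h hc => MaxwellNS.approxControllable_density hT hO₁ hO₂ hO₃ hO₁I hO₂I hO₃I (.inl ⟨h, hc⟩),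
      fun h => MaxwellNS.approxControllable_density hT hO₁ hO₂ hO₃ hO₁I hO₂I hO₃I (.inr h)⟩,
    ⟨fun h hc => MaxwellNS.approxControllable_velocity hT hO₁ hO₂ hO₃ hO₁I hO₂I hO₃I (.inl ⟨h, hc⟩),
      fun h => MaxwellNS.approxControllable_velocity hT hO₁ hO₂ hO₃ hO₁I hO₂I hO₃I (.inr h)⟩,
    ⟨fun h hc => MaxwellNS.approxControllable_stress hT hO₁ hO₂ hO₃ hO₁I hO₂I hO₃I (.inl ⟨h, hc⟩),
      fun h => MaxwellNS.approxControllable_stress hT hO₁ hO₂ hO₃ hO₁I hO₂I hO₃I (.inr h)⟩⟩
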